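/- **Theorem 3 (Second moment of the number of genes).** Let $\rho>0$, $\theta>0$, $\gamma\ge 0$. Consider the Moran model for bacterial genomes with horizontal gene transfer for a population of $N\ge 1$ individuals: the genome of each individual $i$ is a finite set $\mathcal G_i^N\subset[0,1]$ of genes, and $(\mathcal G^N_1(t),\dots,\mathcal G^N_N(t))_{t\ge 0}$ is the pure jump Markov process in which * (resampling) for each ordered pair $(i,j)$, $i\ne j$, at rate $\tfrac12$ the genome of $j$ is replaced by a copy of the genome of $i$ (so that each unordered pair resamples at rate 1); * (loss) each gene of each individual is lost from it at rate $\rho/2$; * (gain) each individual gains, at rate $\theta/2$, a gene that is uniformly distributed on $[0,1]$; * (transfer) for each ordered pair $(i,j)$, $i\neq j$, and each $u\in\mathcal G^N_i$, at rate $\gamma/(2N)$ the gene $u$ is added to the genome of $j$ (with no effect if $j$ already carries $u$). This process has an equilibrium (a stationary distribution). Let $(\mathcal G^N_1,\dots,\mathcal G^N_N)$ be distributed according to an equilibrium, and let $$A^{(1,N)}=|\mathcal G_1^N|,\qquad D^{(2,N)}=\tfrac12\big(|\mathcal G^N_1\setminus\mathcal G^N_2|+|\mathcal G^N_2\setminus\mathcal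 G^N_1|\big)\quad(N\ge 2)$$ be the number of genes of one individual and the average number of pairwise differences in a sample of two. These variables have finite second moments, the large population limits $$\mathbb V[A^{(1)}]:=\lim_{N\to\infty}\mathbb V[A^{(1,N)}],\qquad \mathbb V[D^{(2)}]:=\lim_{N\to\infty}\mathbb V[D^{(2,N)}]$$ exist for every $\gamma\ge 0$ and depend only on $\rho,\theta,\gamma$, and, for fixed $\rho$ and $\theta$, as $\gamma\to0$ (with $\gamma\ge 0$), $$\mathbb V[A^{(1)}]=\frac{\theta}{\rho}\Big(1+\frac{1}{1+\rho}\gamma+\Big(\frac{1}{(1+\rho)(2+\rho)}+\frac{\theta}{(1+\rho)^2(3+2\rho)(2+7\rho+6\rho^2)}\Big)\gamma^2\Big)+\mathcal O(\gamma^3),$$ $$\mathbb V[D^{(2)}]=\frac{\theta}{1+\rho}\Big(\frac12+\frac{\theta}{(1+\rho)(1+2\rho)}+\Big(\frac{1}{2(2+\rho)}+\theta\,\frac{2(12+110\rho+248\rho^2+209\rho^3+60\rho^4)}{(1+\rho)(2+\rho)(1+2\rho)^2(3+2\rho)(2+3\rho)(6+5\rho)}\Big)\gamma\Big)+\mathcal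 O(\gamma^2).$$ -/

import Mathlib

open MeasureTheory ProbabilityTheory Filter Topology Asymptotics
open scoped ENNReal unitInterval

noncomputable section

/-- A genome: a finite set of (accessory) genes, genes being points of `[0,1]`. It is wrapped in a
structure because the σ-algebra below is not the one that Mathlib puts on `Finset`. -/
@[ext] structure Genome where
  genes : Finset I

namespace Genome

/-- The finite counting measure on `[0,1]` whose atoms are the genes of `g`. -/
def toMeasure (g : Genome) : Measure I := ∑ u ∈ g.genes, Measure.dirac u

/-- The usual σ-algebra on finite counting measures: the coarsest one for which
`g ↦ |g ∩ B|` is measurable for all Borel sets `B ⊆ [0,1]`. -/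
instance instMeasurableSpace : MeasurableSpace Genome :=
  MeasurableSpace.comap toMeasure Measure.instMeasurableSpace

/-- The genome `g` after the loss of gene `u`. -/
def lose (g : Genome) (u : I) : Genome := ⟨g.genes.erase u⟩

/-- The genome `g` after the gain of gene `u` (which has no effect if `u` is present). -/
def gain (g : Genome) (u : I) : Genome := ⟨insert u g.genes⟩

end Genome

/-- A population of `N` individuals, with the product σ-algebra. -/
abbrev Population (N : ℕ) : Type := Fin N → Genome

namespace Moran

/-- The integral `∫ f(y) q(x, dy)` of `f` against the jump-rate kernel of the Moran model with
horizontal gene transfer: the sum over all possible events in state `x` of the rate of the event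
times the value of `f` in the state after the event. In this order:

* resampling: each ordered pair `(i, j)` is hit at rate `1`; the parent is one of the two, chosen
  at random, and its offspring replaces `j`. So `j` becomes a copy of `i` at rate `1/2` (if the
  parent is `j` itself, nothing changes);
* loss: each gene `u` of each individual `i` is lost at rate `ρ/2`;
* gain: each individual `i` gains a gene that is uniform in `[0,1]` at rate `θ/2`;
* transfer: for each ordered pair `(i, j)`, each gene `u` of `i` is transferred to `j` at rate
  `γ/(2N)` (without effect if `j` already carries `u`). -/
def jump {N : ℕ} (ρ θ γ : ℝ) (f : Population N → ℝ≥0∞) (x : Population N) : ℝ≥0∞ :=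
  (∑ i : Fin N, ∑ j : Fin N with j ≠ i,
      ENNReal.ofReal (1 / 2) * f (Function.update x j (x i))) +
  (∑ i : Fin N, ∑ u ∈ (x i).genes,
      ENNReal.ofReal (ρ / 2) * f (Function.update x i ((x i).lose u))) +
  (∑ i : Fin N,
      ENNReal.ofReal (θ / 2) * ∫⁻ u : I, f (Function.update x i ((x i).gain u))) +
  (∑ i : Fin N, ∑ j : Fin N with j ≠ i, ∑ u ∈ (x i).genes,
      ENNReal.ofReal (γ / (2 * N)) * f (Function.update x j ((x j).gain u)))

/-- The total rate of events in state `x`. -/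
def totalRate {N : ℕ} (ρ θ γ : ℝ) (x : Population N) : ℝ :=
  (jump ρ θ γ (fun _ => 1) x).toReal

/-- `E_x[f(X_t); fewer than n events up to time t]` for the Moran model `X` started in `x`, by
decomposition at the first event: it happens after an exponential time with parameter the total
rate, and the state after it is drawn proportionally to the rates of the events. -/
def stepTransition {N : ℕ} (ρ θ γ : ℝ) (f : Population N → ℝ≥0∞) :
    ℕ → ℝ → Population N → ℝ≥0∞
  | 0, _, _ => 0
  | n + 1, t, x =>
      ENNReal.ofReal (Real.exp (-(totalRate ρ θ γ x * t))) * f x +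
        ∫⁻ s in Set.Icc 0 t, ENNReal.ofReal (Real.exp (-(totalRate ρ θ γ x * s))) *
          jump ρ θ γ (stepTransition ρ θ γ f n (t - s)) x

/-- The transition function `P_t(x, B)` of the Moran model (the transition function of the pure
jump Markov process with rate kernel `q`, i.e. the minimal solution of Kolmogorov's backward
equation): the probability of being in `B` at time `t`, after any finite number of events, when
started in `x`. -/
def transition {N : ℕ} (ρ θ γ t : ℝ) (x : Population N) (B : Set (Population N)) : ℝ≥0∞ :=
  ⨆ n : ℕ, stepTransition ρ θ γ (B.indicator fun _ => 1) n t x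

/-- `π` is an equilibrium of the Moran model: a probability measure which is invariant under
its transition function. -/
structure IsEquilibrium {N : ℕ} (ρ θ γ : ℝ) (π : Measure (Population N)) : Prop where
  prob : IsProbabilityMeasure π
  invariant : ∀ t : ℝ, 0 ≤ t → ∀ B : Set (Population N), MeasurableSet B →
    ∫⁻ x, transition ρ θ γ t x B ∂π = π B

/-- The average number `A⁽ⁿ⁾` of genes in the sample of the first `n` individuals. -/
def avgGenes {N : ℕ} (n : ℕ) (x : Population N) : ℝ :=
  (1 / (n : ℝ)) * ∑ i : Fin N with i.val < n, ((x i).genes.card : ℝ)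

/-- The average number `D⁽ⁿ⁾` of pairwise differences in the sample of the first `n`
individuals. -/
def avgDiff {N : ℕ} (n : ℕ) (x : Population N) : ℝ :=
  (1 / ((n : ℝ) * ((n : ℝ) - 1))) *
    ∑ i : Fin N with i.val < n, ∑ j : Fin N with j.val < n ∧ i ≠ j,
      (((x i).genes \ (x j).genes).card : ℝ)

end Moran

end

open MeasureTheory ProbabilityTheory Filter Topology Asymptotics
open scoped ENNReal unitInterval

/-! ### Measurability of the gene operations. -/

noncomputable section

/-! The proof rests on a moment duality. For samples `S`, `T` of individuals let `numGenes S` count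
the genes present in `S`, and let `numPairs S T` count ordered pairs of distinct genes, the first
present in `S` and the second in `T`. Followed backwards in time, a resampling event moves a line
from `j` to `i`, a loss deletes a line, and a transfer to `j` adds its donor. So the generator
applied to these functions is again a combination of such functions plus the input from gains
(`gen_numGenes`, `gen_numPairs`). Since the two genes of a pair are distinct, a loss or a transfer
touches only one of the two sets; only coalescence moves both at once. In equilibrium the mean of
the generator vanishes, which gives a closed linear system for the moments
(`dualGen_integral_numGenes`, `dualGen_integral_numPairs`).

On functions of the sizes `s`, `t` and the overlap `b`, the dual generator is `limitGen` plus a term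
of order `1 / N` (`dualGen_card`). The limiting system has a solution: first moments `partialSum d
s` and second moments `c s t b + partialSum d s * partialSum d t`, where the covariances `c` have
the source `b (b - 1) / 2 * d s * d t`, produced by two shared lines that coalesce in both sets
together. Existence comes from monotone fixed points below explicit supersolutions. A maximum
principle on the finite set of pairs `(S, T)`, with the same kind of supersolution as barrier, shows
that the moments of every equilibrium are within a constant multiple of `1 / N` of this solution for
fixed sample sizes. Neither uniqueness nor exchangeability of the equilibrium is needed. The
limiting variances are `c 1 1 1 + d 1` and `c 2 2 2 + 1 / 2 * (c 1 1 1 + c 1 1 0) - 2 * c 2 1 1 + 1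
/ 2 * d 2`. For small `γ` the equations are triangular up to a factor `γ`, so substituting bounds
into the equations repeatedly yields the expansions.

Two analytic points precede this. An equilibrium is known only to be invariant under the minimal
transition function. Short times give an inequality between the flow into and out of each set
(`bind_rateKernel_le`). A Lyapunov function tested through truncations then yields a third moment,
hence a finite mean jump rate, and equality of total masses upgrades the inequality to the rate
equation (`lintegral_jump`). Conversely, an equilibrium is built from the excursions of the embedded
jump chain from the empty population, whose expected length is finite by a drift condition, and the
integrated backward equation turns balance of flows into invariance (`isEquilibrium_of_balance`). -/

/-- A kernel all of whose measures are finite (not necessarily uniformly) is s-finite. -/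
theorem isSFiniteKernel_of_forall_ne_top {α β : Type*} [MeasurableSpace α] [MeasurableSpace β]
    (κ : Kernel α β) (h : ∀ a, κ a Set.univ ≠ ∞) : IsSFiniteKernel κ := by
  have hm : Measurable fun a => κ a Set.univ := κ.measurable_coe MeasurableSet.univ
  have hfl : Measurable fun a => ⌊(κ a Set.univ).toNNReal⌋₊ :=
    Nat.measurable_floor.comp hm.ennreal_toNNReal
  have hs : ∀ n : ℕ, MeasurableSet {a | ⌊(κ a Set.univ).toNNReal⌋₊ = n} := fun n =>
    hfl (measurableSet_singleton n)
  refine ⟨⟨fun n => Kernel.piecewise (hs n) κ 0, fun n => ⟨⟨(n : ℝ≥0∞) + 1, ?_, fun a => ?_⟩⟩, ?_⟩⟩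
  · exact ENNReal.add_lt_top.2 ⟨ENNReal.natCast_lt_top n, ENNReal.one_lt_top⟩
  · rw [Kernel.piecewise_apply]
    split_ifs with ha
    · simp only [Set.mem_ofPred_eq] at ha
      have h1 := (Nat.lt_floor_add_one (κ a Set.univ).toNNReal).le
      rw [ha] at h1
      rw [← ENNReal.coe_toNNReal (h a)]
      exact_mod_cast h1
    · simp
  · ext a s hsm
    rw [Kernel.sum_apply' _ _ hsm, tsum_eq_single ⌊(κ a Set.univ).toNNReal⌋₊]
    · rw [Kernel.piecewise_apply', if_pos (by simp)]
    · intro n hn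
      rw [Kernel.piecewise_apply', if_neg (by simpa using hn.symm)]
      simp

namespace Genome

theorem lintegral_toMeasure (g : Genome) (f : I → ℝ≥0∞) :
    ∫⁻ u, f u ∂g.toMeasure = ∑ u ∈ g.genes, f u := by
  simp [toMeasure, lintegral_finsetSum_measure, lintegral_dirac]

theorem toMeasure_apply (g : Genome) {B : Set I} (hB : MeasurableSet B) :
    g.toMeasure B = ∑ u ∈ g.genes, B.indicator 1 u := by
  rw [← lintegral_indicator_one hB, lintegral_toMeasure]

theorem measurable_toMeasure : Measurable toMeasure := comap_measurable _

/-- The kernel that sends a genome to its counting measure. -/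
def geneKernel : Kernel Genome I := ⟨toMeasure, measurable_toMeasure⟩

theorem geneKernel_apply (g : Genome) : geneKernel g = g.toMeasure := rfl

instance : IsSFiniteKernel geneKernel :=
  isSFiniteKernel_of_forall_ne_top _ fun g => by
    rw [geneKernel_apply, toMeasure_apply _ MeasurableSet.univ]
    simp

/-- The sum is an integral against the counting measure, which depends measurably on the genome;
joint measurability of kernel integrals does the rest. All later measurability statements are
reduced to this one. -/
theorem measurable_sum_genes {α : Type*} [MeasurableSpace α] {h : α → Genome} (hh : Measurable h)
    {f : α → I → ℝ≥0∞} (hf : Measurable (Function.uncurry f)) :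
    Measurable fun a => ∑ u ∈ (h a).genes, f a u := by
  have := Measurable.lintegral_kernel_prod_right (κ := geneKernel.comap h hh) hf
  simpa only [Kernel.comap_apply, geneKernel_apply, lintegral_toMeasure] using this

theorem measurable_of_sum {α : Type*} [MeasurableSpace α] {h : α → Genome}
    (H : ∀ B : Set I, MeasurableSet B →
      Measurable fun a => ∑ u ∈ (h a).genes, B.indicator (1 : I → ℝ≥0∞) u) : Measurable h := by
  refine Measurable.of_comap_le ?_
  rw [instMeasurableSpace, MeasurableSpace.comap_comp]
  refine Measurable.comap_le (Measure.measurable_of_measurable_coe _ fun B hB => ?_)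
  simpa only [Function.comp_apply, toMeasure_apply _ hB] using H B hB

/-- Membership is the sum over the genes of the indicator of the diagonal, which is measurable in `I
× I`. -/
theorem measurable_ite_mem : Measurable fun p : Genome × I =>
    if p.2 ∈ p.1.genes then (1 : ℝ≥0∞) else 0 := by
  have : Measurable fun p : Genome × I => ∑ u ∈ p.1.genes, if u = p.2 then (1 : ℝ≥0∞) else 0 := by
    refine measurable_sum_genes measurable_fst
      (f := fun (p : Genome × I) u => if u = p.2 then (1 : ℝ≥0∞) else 0) ?_
    refine Measurable.ite ?_ measurable_const measurable_const
    exact measurableSet_eq_fun measurable_snd measurable_fst.snd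
  refine (congrArg Measurable (funext fun p => ?_)).mp this
  simp

theorem measurableSet_mem : MeasurableSet {p : Genome × I | p.2 ∈ p.1.genes} := by
  have := measurable_ite_mem (measurableSet_singleton 1)
  convert this using 1
  ext p
  simp

theorem measurable_lose : Measurable fun p : Genome × I => p.1.lose p.2 := by
  refine measurable_of_sum fun B hB => ?_
  have : Measurable fun p : Genome × I => ∑ u ∈ p.1.genes,
      if u = p.2 then (0 : ℝ≥0∞) else B.indicator (1 : I → ℝ≥0∞) u := by
    refine measurable_sum_genes measurable_fst (f := fun (p : Genome × I) u =>
      if u = p.2 then (0 : ℝ≥0∞) else B.indicator (1 : I → ℝ≥0∞) u) ?_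
    refine Measurable.ite ?_ measurable_const ?_
    · exact measurableSet_eq_fun measurable_snd measurable_fst.snd
    · exact (measurable_one.indicator hB).comp measurable_snd
  refine (congrArg Measurable (funext fun p => ?_)).mp this
  rw [lose, ← Finset.filter_ne', Finset.sum_filter]
  simp [ite_not]

theorem measurable_gain : Measurable fun p : Genome × I => p.1.gain p.2 := by
  refine measurable_of_sum fun B hB => ?_
  have : Measurable fun p : Genome × I => (if p.2 ∈ p.1.genes then (0 : ℝ≥0∞) else
      B.indicator (1 : I → ℝ≥0∞) p.2) + ∑ u ∈ p.1.genes, B.indicator (1 : I → ℝ≥0∞) u := by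
    refine Measurable.add ?_ (measurable_sum_genes measurable_fst
      (f := fun (_ : Genome × I) u => B.indicator (1 : I → ℝ≥0∞) u) ?_)
    · exact Measurable.ite measurableSet_mem measurable_const
        ((measurable_one.indicator hB).comp measurable_snd)
    · exact (measurable_one.indicator hB).comp measurable_snd
  refine (congrArg Measurable (funext fun p => ?_)).mp this
  by_cases hp : p.2 ∈ p.1.genes
  · simp [gain, hp]
  · simp [gain, hp, Finset.sum_insert]

end Genome

/-! ### The jump rates as a measurable kernel. -/

namespace Moran

variable {N : ℕ}

theorem measurable_update_comp {α : Type*} [MeasurableSpace α] {h : α → Population N}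
    {g : α → Genome} (hh : Measurable h) (hg : Measurable g) (j : Fin N) :
    Measurable fun a => Function.update (h a) j (g a) := by
  refine measurable_pi_lambda _ fun k => ?_
  by_cases hk : k = j
  · subst hk; simpa using hg
  · simpa [Function.update_of_ne hk, Function.comp_def] using (measurable_pi_apply k).comp hh

theorem measurable_lose_update (i : Fin N) : Measurable fun p : Population N × I =>
    Function.update p.1 i ((p.1 i).lose p.2) :=
  measurable_update_comp measurable_fst (Genome.measurable_lose.comp
    (((measurable_pi_apply i).comp measurable_fst).prodMk measurable_snd)) i

theorem measurable_gain_update (j : Fin N) : Measurable fun p : Population N × I =>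
    Function.update p.1 j ((p.1 j).gain p.2) :=
  measurable_update_comp measurable_fst (Genome.measurable_gain.comp
    (((measurable_pi_apply j).comp measurable_fst).prodMk measurable_snd)) j

theorem measurable_jump (ρ θ γ : ℝ) {f : Population N → ℝ≥0∞} (hf : Measurable f) :
    Measurable (jump ρ θ γ f) := by
  unfold jump
  refine ((Measurable.add ?_ ?_).add ?_).add ?_
  · refine Finset.measurable_sum _ fun i _ => Finset.measurable_sum _ fun j _ => ?_
    exact (hf.comp (measurable_update_comp measurable_id (measurable_pi_apply i) j)).const_mul _
  · refine Finset.measurable_sum _ fun i _ => ?_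
    exact Genome.measurable_sum_genes (measurable_pi_apply i)
      ((hf.comp (measurable_lose_update i)).const_mul _)
  · refine Finset.measurable_sum _ fun i _ => Measurable.const_mul ?_ _
    exact Measurable.lintegral_prod_right (hf.comp (measurable_gain_update i))
  · refine Finset.measurable_sum _ fun i _ => Finset.measurable_sum _ fun j _ => ?_
    exact Genome.measurable_sum_genes (measurable_pi_apply i)
      ((hf.comp (measurable_gain_update j)).const_mul _)

/-- The measure `q(x, ·)` of jump rates out of the state `x`. -/
def rateMeasure (ρ θ γ : ℝ) (x : Population N) : Measure (Population N) :=
  (∑ i : Fin N, ∑ j : Fin N with j ≠ i,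
      ENNReal.ofReal (1 / 2) • Measure.dirac (Function.update x j (x i))) +
  (∑ i : Fin N, ∑ u ∈ (x i).genes,
      ENNReal.ofReal (ρ / 2) • Measure.dirac (Function.update x i ((x i).lose u))) +
  (∑ i : Fin N, ENNReal.ofReal (θ / 2) •
      (volume : Measure I).map fun u => Function.update x i ((x i).gain u)) +
  (∑ i : Fin N, ∑ j : Fin N with j ≠ i, ∑ u ∈ (x i).genes,
      ENNReal.ofReal (γ / (2 * N)) • Measure.dirac (Function.update x j ((x j).gain u)))

/-- Identifies `jump` with integration against a genuine measure, so that convergence theorems and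
composition of kernels become available. -/
theorem lintegral_rateMeasure (ρ θ γ : ℝ) (x : Population N) {f : Population N → ℝ≥0∞}
    (hf : Measurable f) : ∫⁻ y, f y ∂rateMeasure ρ θ γ x = jump ρ θ γ f x := by
  have hg : ∀ i : Fin N, Measurable fun u => Function.update x i ((x i).gain u) := fun i =>
    (measurable_gain_update i).comp measurable_prodMk_left
  simp only [rateMeasure, jump, lintegral_add_measure, lintegral_finsetSum_measure,
    lintegral_smul_measure, lintegral_dirac' _ hf, smul_eq_mul]
  simp only [lintegral_map hf (hg _)]

theorem jump_one_ne_top (ρ θ γ : ℝ) (x : Population N) : jump ρ θ γ (fun _ => 1) x ≠ ∞ := by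
  simp only [jump, mul_one, lintegral_const, measure_univ]
  simp [ENNReal.mul_eq_top]

theorem rateMeasure_univ (ρ θ γ : ℝ) (x : Population N) :
    rateMeasure ρ θ γ x Set.univ = ENNReal.ofReal (totalRate ρ θ γ x) := by
  rw [totalRate, ENNReal.ofReal_toReal (jump_one_ne_top ρ θ γ x),
    ← lintegral_rateMeasure ρ θ γ x measurable_const, lintegral_one]

theorem totalRate_nonneg (ρ θ γ : ℝ) (x : Population N) : 0 ≤ totalRate ρ θ γ x :=
  ENNReal.toReal_nonneg

theorem measurable_totalRate (ρ θ γ : ℝ) :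
    Measurable (totalRate ρ θ γ : Population N → ℝ) :=
  (measurable_jump ρ θ γ measurable_const).ennreal_toReal

/-- The jump-rate kernel of the Moran model. -/
def rateKernel (N : ℕ) (ρ θ γ : ℝ) : Kernel (Population N) (Population N) where
  toFun := rateMeasure ρ θ γ
  measurable' := by
    refine Measure.measurable_of_measurable_coe _ fun B hB => ?_
    refine (congrArg Measurable (funext fun x => ?_)).mp
      (measurable_jump ρ θ γ (measurable_one.indicator hB))
    rw [← lintegral_rateMeasure ρ θ γ x (measurable_one.indicator hB), lintegral_indicator_one hB]

theorem lintegral_rateKernel (ρ θ γ : ℝ) (x : Population N) {f : Population N → ℝ≥0∞}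
    (hf : Measurable f) : ∫⁻ y, f y ∂rateKernel N ρ θ γ x = jump ρ θ γ f x :=
  lintegral_rateMeasure ρ θ γ x hf

theorem rateKernel_univ (ρ θ γ : ℝ) (x : Population N) :
    rateKernel N ρ θ γ x Set.univ = ENNReal.ofReal (totalRate ρ θ γ x) :=
  rateMeasure_univ ρ θ γ x

instance (ρ θ γ : ℝ) : IsSFiniteKernel (rateKernel N ρ θ γ) :=
  isSFiniteKernel_of_forall_ne_top _ fun x => by
    rw [rateKernel_univ]; exact ENNReal.ofReal_ne_top

theorem jump_mono (ρ θ γ : ℝ) {f g : Population N → ℝ≥0∞} (h : f ≤ g) (x : Population N) :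
    jump ρ θ γ f x ≤ jump ρ θ γ g x := by
  unfold jump
  gcongr
  all_goals exact h _

theorem measurable_jump_comp {α : Type*} [MeasurableSpace α] (ρ θ γ : ℝ)
    {f : α → Population N → ℝ≥0∞} (hf : Measurable (Function.uncurry f)) {g : α → Population N}
    (hg : Measurable g) : Measurable fun a => jump ρ θ γ (f a) (g a) := by
  have := Measurable.lintegral_kernel_prod_right (κ := (rateKernel N ρ θ γ).comap g hg) hf
  refine (congrArg Measurable (funext fun p => ?_)).mp this
  rw [Kernel.comap_apply]
  exact lintegral_rateKernel _ _ _ _ (hf.comp measurable_prodMk_left)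

end Moran

/-! ### From invariance to an inequality between flows. -/

namespace Moran

variable {N : ℕ}

/-- The probability that the Moran model makes no jump before time `t`, started in `x`. -/
def survival (ρ θ γ t : ℝ) (x : Population N) : ℝ≥0∞ :=
  ENNReal.ofReal (Real.exp (-(totalRate ρ θ γ x * t)))

theorem measurable_survival_prod (ρ θ γ : ℝ) :
    Measurable fun p : ℝ × Population N => survival ρ θ γ p.1 p.2 :=
  ENNReal.measurable_ofReal.comp (Real.measurable_exp.comp
    (((measurable_totalRate ρ θ γ).comp measurable_snd).mul measurable_fst).neg)

theorem measurable_survival (ρ θ γ t : ℝ) :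
    Measurable (survival ρ θ γ t : Population N → ℝ≥0∞) :=
  ENNReal.measurable_ofReal.comp (Real.measurable_exp.comp
    ((measurable_totalRate ρ θ γ).mul measurable_const).neg)

theorem tendsto_survival (ρ θ γ : ℝ) (x : Population N) :
    Tendsto (fun n : ℕ => survival ρ θ γ (1 / ((n : ℝ) + 1)) x) atTop (𝓝 1) := by
  have h : Tendsto (fun n : ℕ => Real.exp (-(totalRate ρ θ γ x * (1 / ((n : ℝ) + 1)))))
      atTop (𝓝 1) := by
    have := ((tendsto_one_div_add_atTop_nhds_zero_nat (𝕜 := ℝ)).const_mul (totalRate ρ θ γ x)).neg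
    simpa [Function.comp_def] using (Real.continuous_exp.tendsto _).comp this
  simpa [survival] using ENNReal.tendsto_ofReal h

theorem survival_anti (ρ θ γ : ℝ) (x : Population N) {s t : ℝ} (h : s ≤ t) :
    survival ρ θ γ t x ≤ survival ρ θ γ s x := by
  have := totalRate_nonneg ρ θ γ x
  unfold survival
  gcongr

theorem one_le_survival_add (ρ θ γ : ℝ) (x : Population N) {t : ℝ} (ht : 0 ≤ t) :
    1 ≤ survival ρ θ γ t x + ENNReal.ofReal t * ENNReal.ofReal (totalRate ρ θ γ x) := by
  rw [← ENNReal.ofReal_mul ht, survival, ← ENNReal.ofReal_add (Real.exp_nonneg _)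
    (mul_nonneg ht (totalRate_nonneg ρ θ γ x)), ← ENNReal.ofReal_one]
  refine ENNReal.ofReal_le_ofReal ?_
  have := Real.add_one_le_exp (-(totalRate ρ θ γ x * t))
  linarith

theorem stepTransition_succ (ρ θ γ : ℝ) (f : Population N → ℝ≥0∞) (n : ℕ) (t : ℝ)
    (x : Population N) : stepTransition ρ θ γ f (n + 1) t x = survival ρ θ γ t x * f x +
      ∫⁻ s in Set.Icc 0 t, survival ρ θ γ s x *
        jump ρ θ γ (stepTransition ρ θ γ f n (t - s)) x := rfl

/-- Keep only the paths with at most one event up to time `t`, and bound each survival factor from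
below by its value at `t`; the integrand over the time of the event is then constant. -/
theorem stepTransition_two_ge (ρ θ γ : ℝ) (f : Population N → ℝ≥0∞) (t : ℝ)
    (x : Population N) :
    survival ρ θ γ t x * f x + ENNReal.ofReal t * (survival ρ θ γ t x *
        jump ρ θ γ (fun y => survival ρ θ γ t y * f y) x) ≤ stepTransition ρ θ γ f 2 t x := by
  rw [stepTransition_succ]
  gcongr
  set c := survival ρ θ γ t x * jump ρ θ γ (fun y => survival ρ θ γ t y * f y) x
  have : ENNReal.ofReal t * c = ∫⁻ _ in Set.Icc 0 t, c := by
    rw [setLIntegral_const, Real.volume_Icc, sub_zero, mul_comm]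
  rw [this]
  refine setLIntegral_mono' measurableSet_Icc fun s hs => ?_
  refine mul_le_mul' (survival_anti ρ θ γ x hs.2) (jump_mono ρ θ γ (fun y => ?_) x)
  rw [stepTransition_succ]
  refine le_add_right (mul_le_mul' (survival_anti ρ θ γ y ?_) le_rfl)
  linarith [hs.1]

/-- Invariance bounds `π B` below by the contribution of at most one event (`h1`), and `1 ≤ exp (-r
t) + r t` bounds it above (`h2`). The common no-event term is finite, so it cancels, and then so
does the factor `t`. -/
theorem IsEquilibrium.lintegral_survival_jump_le {ρ θ γ : ℝ} {π : Measure (Population N)}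
    (h : IsEquilibrium ρ θ γ π) {B : Set (Population N)} (hB : MeasurableSet B) {t : ℝ}
    (ht : 0 < t) :
    ∫⁻ x, survival ρ θ γ t x *
        jump ρ θ γ (fun y => survival ρ θ γ t y * B.indicator (fun _ => 1) y) x ∂π ≤
      ∫⁻ x in B, ENNReal.ofReal (totalRate ρ θ γ x) ∂π := by
  have := h.prob
  have hf : Measurable (B.indicator fun _ => (1 : ℝ≥0∞)) := measurable_const.indicator hB
  have hEf : Measurable fun x => survival ρ θ γ t x * B.indicator (fun _ => 1) x :=
    (measurable_survival (N := N) ρ θ γ t).mul hf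
  have hr : Measurable fun x : Population N => ENNReal.ofReal (totalRate ρ θ γ x) :=
    (measurable_totalRate ρ θ γ).ennreal_ofReal
  have hrf : ∫⁻ x in B, ENNReal.ofReal (totalRate ρ θ γ x) ∂π =
      ∫⁻ x, ENNReal.ofReal (totalRate ρ θ γ x) * B.indicator (fun _ => 1) x ∂π := by
    rw [← lintegral_indicator hB]
    refine lintegral_congr fun x => ?_
    by_cases hx : x ∈ B <;> simp [hx]
  have hm : Measurable fun x => survival ρ θ γ t x *
      jump ρ θ γ (fun y => survival ρ θ γ t y * B.indicator (fun _ => 1) y) x :=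
    (measurable_survival (N := N) ρ θ γ t).mul (measurable_jump ρ θ γ hEf)
  have hrm : Measurable fun x => ENNReal.ofReal (totalRate ρ θ γ x) *
      B.indicator (fun _ => (1 : ℝ≥0∞)) x := hr.mul hf
  have h1 : ∫⁻ x, survival ρ θ γ t x * B.indicator (fun _ => 1) x ∂π +
      ENNReal.ofReal t * ∫⁻ x, survival ρ θ γ t x *
        jump ρ θ γ (fun y => survival ρ θ γ t y * B.indicator (fun _ => 1) y) x ∂π ≤ π B := by
    rw [← h.invariant t ht.le B hB, ← lintegral_const_mul _ hm, ← lintegral_add_left hEf]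
    refine lintegral_mono fun x => ?_
    refine (stepTransition_two_ge ρ θ γ _ t x).trans ?_
    exact le_iSup (fun n => stepTransition ρ θ γ (B.indicator fun _ => 1) n t x) 2
  have h2 : π B ≤ ∫⁻ x, survival ρ θ γ t x * B.indicator (fun _ => 1) x ∂π +
      ENNReal.ofReal t * ∫⁻ x, ENNReal.ofReal (totalRate ρ θ γ x) *
        B.indicator (fun _ => 1) x ∂π := by
    rw [← lintegral_const_mul _ hrm, ← lintegral_add_left hEf,
      ← one_mul (π B), ← lintegral_indicator_const hB]
    refine lintegral_mono fun x => ?_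
    calc B.indicator (fun _ => (1 : ℝ≥0∞)) x = 1 * B.indicator (fun _ => 1) x := by rw [one_mul]
      _ ≤ (survival ρ θ γ t x + ENNReal.ofReal t * ENNReal.ofReal (totalRate ρ θ γ x)) *
          B.indicator (fun _ => 1) x :=
          mul_le_mul' (one_le_survival_add ρ θ γ x ht.le) le_rfl
      _ = _ := by ring
  have hfin : ∫⁻ x, survival ρ θ γ t x * B.indicator (fun _ => 1) x ∂π ≠ ∞ :=
    ne_top_of_le_ne_top (measure_ne_top π B) (le_self_add.trans h1)
  rw [hrf]
  have h3 := (ENNReal.add_le_add_iff_left hfin).1 (h1.trans h2)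
  exact (ENNReal.mul_le_mul_iff_right (by simpa using ht) ENNReal.ofReal_ne_top).1 h3

/-- An equilibrium is subinvariant for the jump rates: the flow into a set is at most the flow out
of it. -/
theorem IsEquilibrium.bind_rateKernel_le {ρ θ γ : ℝ} {π : Measure (Population N)}
    (h : IsEquilibrium ρ θ γ π) :
    π.bind (rateKernel N ρ θ γ) ≤
      π.withDensity fun x => ENNReal.ofReal (totalRate ρ θ γ x) := by
  refine Measure.le_iff.2 fun B hB => ?_
  rw [Measure.bind_apply hB (Kernel.aemeasurable _), withDensity_apply _ hB]
  have hf : Measurable (B.indicator fun _ => (1 : ℝ≥0∞)) := measurable_const.indicator hB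
  have hEf : ∀ t, Measurable fun x => survival ρ θ γ t x * B.indicator (fun _ => 1) x :=
    fun t => (measurable_survival (N := N) ρ θ γ t).mul hf
  have hEmono : ∀ y : Population N, Monotone fun n : ℕ => survival ρ θ γ (1 / ((n : ℝ) + 1)) y :=
    fun y m n hmn => survival_anti ρ θ γ y (Nat.one_div_le_one_div hmn)
  have hJ : ∀ x : Population N, Tendsto (fun n : ℕ => jump ρ θ γ (fun y =>
      survival ρ θ γ (1 / ((n : ℝ) + 1)) y * B.indicator (fun _ => 1) y) x)
      atTop (𝓝 (jump ρ θ γ (B.indicator fun _ => 1) x)) := fun x => by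
    have : Tendsto (fun n : ℕ => ∫⁻ y, survival ρ θ γ (1 / ((n : ℝ) + 1)) y *
        B.indicator (fun _ => 1) y ∂rateKernel N ρ θ γ x) atTop
        (𝓝 (∫⁻ y, B.indicator (fun _ => 1) y ∂rateKernel N ρ θ γ x)) := by
      refine lintegral_tendsto_of_tendsto_of_monotone (fun n => (hEf _).aemeasurable)
        (ae_of_all _ fun y m n hmn => mul_le_mul' (hEmono y hmn) le_rfl) (ae_of_all _ fun y => ?_)
      have := ENNReal.Tendsto.mul_const (b := B.indicator (fun _ => (1 : ℝ≥0∞)) y)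
        (tendsto_survival ρ θ γ y) (Or.inl one_ne_zero)
      rwa [one_mul] at this
    rw [lintegral_rateKernel ρ θ γ x hf] at this
    exact this.congr fun n => lintegral_rateKernel ρ θ γ x (hEf _)
  have hlim : Tendsto (fun n : ℕ => ∫⁻ x, survival ρ θ γ (1 / ((n : ℝ) + 1)) x *
      jump ρ θ γ (fun y => survival ρ θ γ (1 / ((n : ℝ) + 1)) y *
        B.indicator (fun _ => 1) y) x ∂π) atTop
      (𝓝 (∫⁻ x, jump ρ θ γ (B.indicator fun _ => 1) x ∂π)) := by
    refine lintegral_tendsto_of_tendsto_of_monotone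
      (fun n => ((measurable_survival _ _ _ _).mul (measurable_jump ρ θ γ (hEf _))).aemeasurable)
      (ae_of_all _ fun x m n hmn => mul_le_mul' (hEmono x hmn)
        (jump_mono ρ θ γ (fun y => mul_le_mul' (hEmono y hmn) le_rfl) x))
      (ae_of_all _ fun x => ?_)
    have := ENNReal.Tendsto.mul (tendsto_survival ρ θ γ x) (Or.inl one_ne_zero) (hJ x)
      (Or.inr ENNReal.one_ne_top)
    rwa [one_mul] at this
  have hq : ∫⁻ x, rateKernel N ρ θ γ x B ∂π = ∫⁻ x, jump ρ θ γ (B.indicator fun _ => 1) x ∂π :=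
    lintegral_congr fun x => by
      rw [← lintegral_rateKernel ρ θ γ x hf, lintegral_indicator_const hB, one_mul]
  rw [hq]
  -- The bound holds for all `t > 0`. Along `t = 1 / (n + 1)` the survival factors increase to `1`,
  -- so monotone convergence applies to both integrals.
  exact le_of_tendsto' hlim fun n => h.lintegral_survival_jump_le hB Nat.one_div_pos_of_nat

end Moran

/-! ### The integrated backward equation, and invariance from balance of flows. -/

/-- An exponential clock of rate `r` started at `w` either rings during `[w, t]` or does not. The
case `r = 0` is included. -/
theorem ofReal_exp_add_lintegral_exp {r : ℝ} (hr : 0 ≤ r) {w t : ℝ} (hwt : w ≤ t) :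
    ENNReal.ofReal (Real.exp (-(r * (t - w)))) +
      ENNReal.ofReal r * ∫⁻ v in Set.Icc w t, ENNReal.ofReal (Real.exp (-(r * (v - w)))) = 1 := by
  have hc : Continuous fun v => r * Real.exp (-(r * (v - w))) := by fun_prop
  have h1 : ∫ v in w..t, r * Real.exp (-(r * (v - w))) = 1 - Real.exp (-(r * (t - w))) := by
    have hd : ∀ v ∈ Set.uIcc w t, HasDerivAt (fun v => -Real.exp (-(r * (v - w))))
        (r * Real.exp (-(r * (v - w)))) v := fun v _ => by
      have : HasDerivAt (fun v => -Real.exp (-(r * (v - w))))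
          (-(Real.exp (-(r * (v - w))) * -(r * 1))) v :=
        ((((hasDerivAt_id v).sub_const w).const_mul r).neg.exp).neg
      exact this.congr_deriv (by ring)
    rw [intervalIntegral.integral_eq_sub_of_hasDerivAt hd (hc.intervalIntegrable _ _)]
    simp; ring
  have hm : Measurable fun v => ENNReal.ofReal (Real.exp (-(r * (v - w)))) :=
    (Continuous.measurable (by fun_prop)).ennreal_ofReal
  rw [← lintegral_const_mul _ hm]
  simp_rw [← ENNReal.ofReal_mul hr]
  rw [← ofReal_integral_eq_lintegral_ofReal (hc.integrableOn_Icc)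
    (ae_of_all _ fun v => mul_nonneg hr (Real.exp_nonneg _)), integral_Icc_eq_integral_Ioc,
    ← intervalIntegral.integral_of_le hwt, h1, ← ENNReal.ofReal_add (Real.exp_nonneg _)]
  · simp
  · rw [sub_nonneg, Real.exp_le_one_iff, neg_nonpos]
    exact mul_nonneg hr (sub_nonneg.2 hwt)

/-- From the mild to the integrated form of a linear evolution equation. -/
theorem integrated_of_mild {r : ℝ} (hr : 0 ≤ r) {G u : ℝ → ℝ≥0∞} (hG : Measurable G) (a : ℝ≥0∞)
    (hu : ∀ t, 0 ≤ t → u t = ENNReal.ofReal (Real.exp (-(r * t))) * a +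
      ∫⁻ s in Set.Icc 0 t, ENNReal.ofReal (Real.exp (-(r * s))) * G (t - s)) {t : ℝ} (ht : 0 ≤ t) :
    u t + ENNReal.ofReal r * ∫⁻ s in Set.Icc 0 t, u s = a + ∫⁻ s in Set.Icc 0 t, G s := by
  set e : ℝ → ℝ≥0∞ := fun s => ENNReal.ofReal (Real.exp (-(r * s))) with he
  have hem : Measurable e := (Continuous.measurable (by fun_prop)).ennreal_ofReal
  have hrefl : ∀ t, ∫⁻ s in Set.Icc 0 t, e s * G (t - s) = ∫⁻ w in Set.Icc 0 t, e (t - w) * G w := by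
    intro t
    rw [← lintegral_indicator measurableSet_Icc, ← lintegral_indicator measurableSet_Icc,
      ← lintegral_sub_left_eq_self _ t]
    refine lintegral_congr fun s => ?_
    by_cases hs : s ∈ Set.Icc 0 t
    · rw [Set.indicator_of_mem hs, Set.indicator_of_mem (by
        constructor <;> linarith [hs.1, hs.2]), sub_sub_cancel]
    · rw [Set.indicator_of_notMem hs, Set.indicator_of_notMem fun h => hs (by
        constructor <;> linarith [h.1, h.2])]
  have hu' : ∀ t, 0 ≤ t → u t = e t * a + ∫⁻ w in Set.Icc 0 t, e (t - w) * G w := fun t ht => by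
    rw [hu t ht, ← hrefl]
  -- Tonelli on the triangle `0 ≤ w ≤ v ≤ t`, encoded by an indicator on the plane; no integrability
  -- is required in `ℝ≥0∞`.
  have hswap : ∫⁻ v in Set.Icc 0 t, ∫⁻ w in Set.Icc 0 v, e (v - w) * G w =
      ∫⁻ w in Set.Icc 0 t, G w * ∫⁻ v in Set.Icc w t, e (v - w) := by
    have hF : Measurable fun p : ℝ × ℝ =>
        {p : ℝ × ℝ | 0 ≤ p.2 ∧ p.2 ≤ p.1 ∧ p.1 ≤ t}.indicator
          (fun p => e (p.1 - p.2) * G p.2) p := by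
      refine Measurable.indicator ((hem.comp (measurable_fst.sub measurable_snd)).mul
        (hG.comp measurable_snd)) ?_
      exact (measurableSet_le measurable_const measurable_snd).inter
        ((measurableSet_le measurable_snd measurable_fst).inter
          (measurableSet_le measurable_fst measurable_const))
    have := lintegral_lintegral_swap (μ := volume) (ν := volume) (f := fun v w : ℝ =>
      {p : ℝ × ℝ | 0 ≤ p.2 ∧ p.2 ≤ p.1 ∧ p.1 ≤ t}.indicator
          (fun p => e (p.1 - p.2) * G p.2) (v, w)) hF.aemeasurable
    rw [← lintegral_indicator measurableSet_Icc, ← lintegral_indicator measurableSet_Icc]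
    convert this using 3 with v w
    · by_cases hv : v ∈ Set.Icc 0 t
      · rw [Set.indicator_of_mem hv, ← lintegral_indicator measurableSet_Icc]
        refine lintegral_congr fun w => ?_
        by_cases hw : w ∈ Set.Icc 0 v
        · rw [Set.indicator_of_mem hw, Set.indicator_of_mem]
          exact ⟨hw.1, hw.2, hv.2⟩
        · rw [Set.indicator_of_notMem hw, Set.indicator_of_notMem]
          exact fun h => hw ⟨h.1, h.2.1⟩
      · rw [Set.indicator_of_notMem hv]
        symm
        refine lintegral_eq_zero_of_ae_eq_zero (ae_of_all _ fun w =>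
          Set.indicator_of_notMem (fun h => hv ?_) _)
        exact ⟨h.1.trans h.2.1, h.2.2⟩
    · by_cases hw : w ∈ Set.Icc 0 t
      · have hew : Measurable fun v => e (v - w) := hem.comp (measurable_id.sub_const w)
        rw [Set.indicator_of_mem hw, ← lintegral_const_mul _ hew,
          ← lintegral_indicator measurableSet_Icc]
        refine lintegral_congr fun v => ?_
        by_cases hv : v ∈ Set.Icc w t
        · rw [Set.indicator_of_mem hv, Set.indicator_of_mem, mul_comm]
          exact ⟨hw.1, hv.1, hv.2⟩
        · rw [Set.indicator_of_notMem hv, Set.indicator_of_notMem]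
          exact fun h => hv ⟨h.2.1, h.2.2⟩
      · rw [Set.indicator_of_notMem hw]
        symm
        refine lintegral_eq_zero_of_ae_eq_zero (ae_of_all _ fun v =>
          Set.indicator_of_notMem (fun h => hw ?_) _)
        exact ⟨h.1, h.2.1.trans h.2.2⟩
  have hsum : ∫⁻ s in Set.Icc 0 t, u s = (∫⁻ v in Set.Icc 0 t, e v) * a +
      ∫⁻ w in Set.Icc 0 t, G w * ∫⁻ v in Set.Icc w t, e (v - w) := by
    rw [← hswap, ← lintegral_mul_const _ hem, ← lintegral_add_left (hem.mul_const a)]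
    exact setLIntegral_congr_fun measurableSet_Icc fun v hv => hu' v hv.1
  have hinner : Measurable fun w => ∫⁻ v in Set.Icc w t, e (v - w) := by
    have hF : Measurable fun p : ℝ × ℝ => {p : ℝ × ℝ | p.1 ≤ p.2 ∧ p.2 ≤ t}.indicator
          (fun p => e (p.2 - p.1)) p := by
      refine Measurable.indicator (hem.comp (measurable_snd.sub measurable_fst)) ?_
      exact (measurableSet_le measurable_fst measurable_snd).inter
          (measurableSet_le measurable_snd measurable_const)
    refine (congrArg Measurable (funext fun w => ?_)).mp (hF.lintegral_prod_right' (ν := volume))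
    rw [← lintegral_indicator measurableSet_Icc]
    rfl
  have hGi : Measurable fun w => G w * ∫⁻ v in Set.Icc w t, e (v - w) := hG.mul hinner
  have hGe : Measurable fun w => e (t - w) * G w :=
    (hem.comp (measurable_const.sub measurable_id)).mul hG
  rw [hu' t ht, hsum, mul_add, ← mul_assoc, ← lintegral_const_mul _ hGi]
  have hcomb : (e t * a + ∫⁻ w in Set.Icc 0 t, e (t - w) * G w) +
      (ENNReal.ofReal r * (∫⁻ v in Set.Icc 0 t, e v) * a +
        ∫⁻ w in Set.Icc 0 t, ENNReal.ofReal r * (G w * ∫⁻ v in Set.Icc w t, e (v - w))) =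
      (e t + ENNReal.ofReal r * ∫⁻ v in Set.Icc 0 t, e v) * a +
        ∫⁻ w in Set.Icc 0 t, (e (t - w) * G w +
          ENNReal.ofReal r * (G w * ∫⁻ v in Set.Icc w t, e (v - w))) := by
    rw [lintegral_add_left hGe, add_mul]
    exact add_add_add_comm _ _ _ _
  -- The coefficient of `a`, and for each `w` the coefficient of `G w`, is the total probability of
  -- the exponential clock, hence equal to `1`.
  rw [hcomb]
  have h0 := ofReal_exp_add_lintegral_exp hr ht
  simp only [sub_zero] at h0
  rw [h0, one_mul]
  congr 1
  refine setLIntegral_congr_fun measurableSet_Icc fun w hw => ?_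
  have := ofReal_exp_add_lintegral_exp hr hw.2
  calc e (t - w) * G w + ENNReal.ofReal r * (G w * ∫⁻ v in Set.Icc w t, e (v - w))
        = (e (t - w) + ENNReal.ofReal r * ∫⁻ v in Set.Icc w t, e (v - w)) * G w := by ring
    _ = G w := by rw [he]; simp only; rw [this, one_mul]

namespace Moran

variable {N : ℕ}

theorem measurable_stepTransition (ρ θ γ : ℝ) {f : Population N → ℝ≥0∞} (hf : Measurable f)
    (n : ℕ) : Measurable fun p : ℝ × Population N => stepTransition ρ θ γ f n p.1 p.2 := by
  induction n with
  | zero => exact measurable_const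
  | succ n ih =>
    simp only [stepTransition_succ]
    refine Measurable.add ((measurable_survival_prod ρ θ γ).mul (hf.comp measurable_snd)) ?_
    have hj : Measurable fun p : (ℝ × Population N) × ℝ =>
        jump ρ θ γ (stepTransition ρ θ γ f n (p.1.1 - p.2)) p.1.2 :=
      measurable_jump_comp ρ θ γ
        (f := fun p : (ℝ × Population N) × ℝ => stepTransition ρ θ γ f n (p.1.1 - p.2))
        (Measurable.comp (g := fun p : ℝ × Population N => stepTransition ρ θ γ f n p.1 p.2)
          (f := fun q : ((ℝ × Population N) × ℝ) × Population N => (q.1.1.1 - q.1.2, q.2)) ih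
          ((measurable_fst.fst.fst.sub measurable_fst.snd).prodMk measurable_snd))
        measurable_fst.snd
    have hs : Measurable fun p : (ℝ × Population N) × ℝ => survival ρ θ γ p.2 p.1.2 :=
      Measurable.comp (g := fun p : ℝ × Population N => survival ρ θ γ p.1 p.2)
        (f := fun p : (ℝ × Population N) × ℝ => (p.2, p.1.2)) (measurable_survival_prod ρ θ γ)
        (measurable_snd.prodMk measurable_fst.snd)
    have hF : Measurable fun p : (ℝ × Population N) × ℝ =>
        {p : (ℝ × Population N) × ℝ | 0 ≤ p.2 ∧ p.2 ≤ p.1.1}.indicator (fun p =>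
          survival ρ θ γ p.2 p.1.2 *
            jump ρ θ γ (stepTransition ρ θ γ f n (p.1.1 - p.2)) p.1.2) p := by
      refine (hs.mul hj).indicator ?_
      exact (measurableSet_le measurable_const measurable_snd).inter
        (measurableSet_le measurable_snd measurable_fst.fst)
    refine (congrArg Measurable (funext fun p => ?_)).mp (hF.lintegral_prod_right' (ν := volume))
    rw [← lintegral_indicator measurableSet_Icc]
    rfl

theorem stepTransition_mono (ρ θ γ : ℝ) (f : Population N → ℝ≥0∞) (n : ℕ) (t : ℝ)
    (x : Population N) : stepTransition ρ θ γ f n t x ≤ stepTransition ρ θ γ f (n + 1) t x := by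
  induction n generalizing t x with
  | zero => exact zero_le
  | succ n ih =>
    rw [stepTransition_succ, stepTransition_succ]
    gcongr
    exact jump_mono ρ θ γ (fun y => ih _ y) x

/-- The jump kernel has total mass `totalRate`, so replacing the inner transition by `1` leaves the
no-event probability plus the probability of a first event before `t`. -/
theorem stepTransition_le_one (ρ θ γ : ℝ) {f : Population N → ℝ≥0∞} (hf : ∀ x, f x ≤ 1) (n : ℕ)
    {t : ℝ} (ht : 0 ≤ t) (x : Population N) : stepTransition ρ θ γ f n t x ≤ 1 := by
  induction n generalizing t x with
  | zero => exact zero_le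
  | succ n ih =>
    have h0 := ofReal_exp_add_lintegral_exp (totalRate_nonneg ρ θ γ x) ht
    simp only [sub_zero] at h0
    rw [stepTransition_succ, ← h0, mul_comm (ENNReal.ofReal _) (∫⁻ _ in _, _),
      ← lintegral_mul_const' _ _ ENNReal.ofReal_ne_top]
    refine add_le_add ((mul_le_mul' le_rfl (hf x)).trans (mul_one _).le) ?_
    refine setLIntegral_mono' measurableSet_Icc fun s hs => mul_le_mul' le_rfl ?_
    have hm : ENNReal.ofReal (totalRate ρ θ γ x) = jump ρ θ γ (fun _ => 1) x := by
      rw [totalRate, ENNReal.ofReal_toReal (jump_one_ne_top ρ θ γ x)]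
    rw [hm]
    exact jump_mono ρ θ γ (fun y => ih (sub_nonneg.2 hs.2) y) x

variable {ρ θ γ : ℝ} {B : Set (Population N)}

theorem measurable_transition (hB : MeasurableSet B) :
    Measurable fun p : ℝ × Population N => transition ρ θ γ p.1 p.2 B :=
  Measurable.iSup fun n => measurable_stepTransition ρ θ γ (measurable_const.indicator hB) n

theorem transition_le_one {t : ℝ} (ht : 0 ≤ t) (x : Population N) :
    transition ρ θ γ t x B ≤ 1 :=
  iSup_le fun n => stepTransition_le_one ρ θ γ (f := B.indicator fun _ => 1)
    (fun _ => Set.indicator_apply_le' (fun _ => le_rfl) fun _ => zero_le) n ht x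

/-- Kolmogorov's backward equation in mild form. -/
theorem transition_eq (hB : MeasurableSet B) (t : ℝ) (x : Population N) :
    transition ρ θ γ t x B = survival ρ θ γ t x * B.indicator (fun _ => 1) x +
      ∫⁻ s in Set.Icc 0 t, survival ρ θ γ s x *
        jump ρ θ γ (fun y => transition ρ θ γ (t - s) y B) x := by
  have hf : Measurable (B.indicator fun _ => (1 : ℝ≥0∞)) := measurable_const.indicator hB
  have hmono : ∀ (t : ℝ) (x : Population N),
      Monotone fun n => stepTransition ρ θ γ (B.indicator fun _ => 1) n t x := fun t x =>
    monotone_nat_of_le_succ fun n => stepTransition_mono ρ θ γ _ n t x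
  have hsm : ∀ n t, Measurable (stepTransition ρ θ γ (B.indicator fun _ => (1 : ℝ≥0∞)) n t) :=
    fun n t => Measurable.comp (g := fun p : ℝ × Population N =>
        stepTransition ρ θ γ (B.indicator fun _ => 1) n p.1 p.2)
      (f := fun x => (t, x)) (measurable_stepTransition ρ θ γ hf n)
      (measurable_const.prodMk measurable_id)
  have hjump : ∀ s, jump ρ θ γ (fun y => transition ρ θ γ (t - s) y B) x =
      ⨆ n, jump ρ θ γ (stepTransition ρ θ γ (B.indicator fun _ => 1) n (t - s)) x := fun s => by
    have htm : Measurable fun y : Population N => transition ρ θ γ (t - s) y B :=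
      Measurable.iSup fun n => hsm n _
    rw [← lintegral_rateKernel _ _ _ _ htm]
    simp_rw [← lintegral_rateKernel _ _ _ _ (hsm _ _)]
    exact lintegral_iSup (fun n => hsm n _) fun m n hmn y => hmono _ y hmn
  have h1 : transition ρ θ γ t x B =
      ⨆ n, stepTransition ρ θ γ (B.indicator fun _ => 1) (n + 1) t x :=
    ((hmono t x).iSup_nat_add 1).symm
  rw [h1]
  simp_rw [stepTransition_succ, hjump, ENNReal.mul_iSup]
  rw [← ENNReal.add_iSup, lintegral_iSup]
  · intro n
    have hj : Measurable fun s : ℝ =>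
        jump ρ θ γ (stepTransition ρ θ γ (B.indicator fun _ => 1) n (t - s)) x :=
      measurable_jump_comp ρ θ γ
        (f := fun s => stepTransition ρ θ γ (B.indicator fun _ => 1) n (t - s))
        (Measurable.comp (g := fun p : ℝ × Population N =>
            stepTransition ρ θ γ (B.indicator fun _ => 1) n p.1 p.2)
          (f := fun q : ℝ × Population N => (t - q.1, q.2)) (measurable_stepTransition ρ θ γ hf n)
          ((measurable_const.sub measurable_fst).prodMk measurable_snd))
        measurable_const
    have hs : Measurable fun s : ℝ => survival ρ θ γ s x :=
      Measurable.comp (g := fun p : ℝ × Population N => survival ρ θ γ p.1 p.2)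
        (f := fun s => (s, x)) (measurable_survival_prod ρ θ γ)
        (measurable_id.prodMk measurable_const)
    exact hs.mul hj
  · intro m n hmn s
    exact mul_le_mul' le_rfl (jump_mono ρ θ γ (fun y => hmono _ y hmn) x)

/-- A probability measure with finite mean jump rate for which the flows into and out of all sets
balance is an equilibrium. -/
theorem isEquilibrium_of_balance {π : Measure (Population N)} [IsProbabilityMeasure π]
    (hr : ∫⁻ x, ENNReal.ofReal (totalRate ρ θ γ x) ∂π ≠ ∞)
    (hbal : ∀ f : Population N → ℝ≥0∞, Measurable f →
      ∫⁻ x, jump ρ θ γ f x ∂π = ∫⁻ x, ENNReal.ofReal (totalRate ρ θ γ x) * f x ∂π) :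
    IsEquilibrium ρ θ γ π := by
  refine ⟨inferInstance, fun t ht B hB => ?_⟩
  have hrm : Measurable fun x : Population N => ENNReal.ofReal (totalRate ρ θ γ x) :=
    (measurable_totalRate ρ θ γ).ennreal_ofReal
  have htr := measurable_transition (ρ := ρ) (θ := θ) (γ := γ) hB
  have htx : ∀ s, Measurable fun x : Population N => transition ρ θ γ s x B := fun s =>
    Measurable.comp (g := fun p : ℝ × Population N => transition ρ θ γ p.1 p.2 B)
      (f := fun x => (s, x)) htr (measurable_const.prodMk measurable_id)
  have hjm : Measurable fun p : ℝ × Population N =>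
      jump ρ θ γ (fun y => transition ρ θ γ p.1 y B) p.2 :=
    measurable_jump_comp ρ θ γ (f := fun (p : ℝ × Population N) y => transition ρ θ γ p.1 y B)
      (Measurable.comp (g := fun p : ℝ × Population N => transition ρ θ γ p.1 p.2 B)
        (f := fun q : (ℝ × Population N) × Population N => (q.1.1, q.2)) htr
        (measurable_fst.fst.prodMk measurable_snd)) measurable_snd
  -- The backward equation is integrated in time first: the rate then appears multiplied by the
  -- transition function, which is the form to which balance applies.
  have hpt : ∀ x, transition ρ θ γ t x B +
      ∫⁻ s in Set.Icc 0 t, ENNReal.ofReal (totalRate ρ θ γ x) * transition ρ θ γ s x B =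
      B.indicator (fun _ => 1) x +
        ∫⁻ s in Set.Icc 0 t, jump ρ θ γ (fun y => transition ρ θ γ s y B) x := fun x => by
    have hG : Measurable fun s : ℝ => jump ρ θ γ (fun y => transition ρ θ γ s y B) x :=
      Measurable.comp (g := fun p : ℝ × Population N =>
          jump ρ θ γ (fun y => transition ρ θ γ p.1 y B) p.2)
        (f := fun s => (s, x)) hjm (measurable_id.prodMk measurable_const)
    have := integrated_of_mild (totalRate_nonneg ρ θ γ x) hG (B.indicator (fun _ => 1) x)
      (u := fun s => transition ρ θ γ s x B) (fun s _ => transition_eq hB s x) ht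
    rw [← this, lintegral_const_mul' _ _ ENNReal.ofReal_ne_top]
  have h1 : ∀ F : ℝ → Population N → ℝ≥0∞, Measurable (Function.uncurry F) →
      ∫⁻ x, (∫⁻ s in Set.Icc 0 t, F s x) ∂π = ∫⁻ s in Set.Icc 0 t, ∫⁻ x, F s x ∂π := fun F hF =>
    lintegral_lintegral_swap (f := fun x s => F s x) (hF.comp measurable_swap).aemeasurable
  have hrt : Measurable (Function.uncurry fun (s : ℝ) (x : Population N) =>
      ENNReal.ofReal (totalRate ρ θ γ x) * transition ρ θ γ s x B) :=
    (hrm.comp measurable_snd).mul htr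
  have hint : ∫⁻ x, transition ρ θ γ t x B ∂π +
      ∫⁻ s in Set.Icc 0 t, ∫⁻ x, ENNReal.ofReal (totalRate ρ θ γ x) * transition ρ θ γ s x B ∂π =
      π B + ∫⁻ s in Set.Icc 0 t, ∫⁻ x, jump ρ θ γ (fun y => transition ρ θ γ s y B) x ∂π := by
    rw [← h1 _ hrt, ← h1 (fun s x => jump ρ θ γ (fun y => transition ρ θ γ s y B) x) hjm,
      ← one_mul (π B), ← lintegral_indicator_const hB, ← lintegral_add_left (htx t),
      ← lintegral_add_left (measurable_const.indicator hB)]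
    exact lintegral_congr hpt
  have heq : ∀ s, ∫⁻ x, jump ρ θ γ (fun y => transition ρ θ γ s y B) x ∂π =
      ∫⁻ x, ENNReal.ofReal (totalRate ρ θ γ x) * transition ρ θ γ s x B ∂π := fun s =>
    hbal _ (htx s)
  simp_rw [heq] at hint
  -- The term to cancel is at most `t` times the mean jump rate. This is where finiteness of the
  -- mean rate enters.
  refine (ENNReal.add_left_inj ?_).1 hint
  have hle : ∫⁻ s in Set.Icc 0 t, ∫⁻ x, ENNReal.ofReal (totalRate ρ θ γ x) *
      transition ρ θ γ s x B ∂π ≤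
      ∫⁻ _ in Set.Icc 0 t, ∫⁻ x, ENNReal.ofReal (totalRate ρ θ γ x) ∂π :=
    setLIntegral_mono' measurableSet_Icc fun s hs => lintegral_mono fun x =>
      (mul_le_mul' le_rfl (transition_le_one hs.1 x)).trans (mul_one _).le
  refine ne_top_of_le_ne_top ?_ hle
  rw [setLIntegral_const, Real.volume_Icc]
  exact ENNReal.mul_ne_top hr ENNReal.ofReal_ne_top

end Moran

/-! ### Gene counts in samples, and the generator on real-valued functions. -/

namespace Moran

variable {N : ℕ}

/-- The genes that are carried by at least one individual of the sample `S`. -/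
def unionGenes (S : Finset (Fin N)) (x : Population N) : Finset I :=
  S.biUnion fun i => (x i).genes

/-- The number of genes that are carried by at least one individual of the sample `S`. -/
def numGenes (S : Finset (Fin N)) (x : Population N) : ℝ := (unionGenes S x).card

theorem mem_unionGenes {S : Finset (Fin N)} {x : Population N} {u : I} :
    u ∈ unionGenes S x ↔ ∃ i ∈ S, u ∈ (x i).genes := by simp [unionGenes]

theorem unionGenes_union (S T : Finset (Fin N)) (x : Population N) :
    unionGenes (S ∪ T) x = unionGenes S x ∪ unionGenes T x := Finset.union_biUnion ..

theorem unionGenes_insert (i : Fin N) (S : Finset (Fin N)) (x : Population N) :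
    unionGenes (insert i S) x = (x i).genes ∪ unionGenes S x := Finset.biUnion_insert ..

theorem numGenes_nonneg (S : Finset (Fin N)) (x : Population N) : 0 ≤ numGenes S x :=
  Nat.cast_nonneg _

@[simp] theorem numGenes_empty (x : Population N) : numGenes ∅ x = 0 := by
  simp [numGenes, unionGenes]

theorem numGenes_mono {S T : Finset (Fin N)} (h : S ⊆ T) (x : Population N) :
    numGenes S x ≤ numGenes T x :=
  Nat.cast_le.2 (Finset.card_le_card (Finset.biUnion_subset_biUnion_of_subset_left _ h))

theorem measurableSet_mem_unionGenes (S : Finset (Fin N)) :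
    MeasurableSet {p : Population N × I | p.2 ∈ unionGenes S p.1} := by
  have : {p : Population N × I | p.2 ∈ unionGenes S p.1} =
      ⋃ i ∈ S, {p : Population N × I | p.2 ∈ (p.1 i).genes} := by
    ext p; simp [mem_unionGenes]
  rw [this]
  refine Finset.measurableSet_biUnion _ fun i _ => ?_
  have hm : Measurable fun p : Population N × I => (p.1 i, p.2) :=
    ((measurable_pi_apply i).comp measurable_fst).prodMk measurable_snd
  exact hm Genome.measurableSet_mem

theorem card_unionGenes_insert (i : Fin N) (S : Finset (Fin N)) (x : Population N) :
    (unionGenes (insert i S) x).card =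
      (unionGenes S x).card + ((x i).genes.filter (· ∉ unionGenes S x)).card := by
  rw [unionGenes_insert, Finset.union_comm, ← Finset.union_sdiff_self_eq_union,
    Finset.card_union_of_disjoint Finset.disjoint_sdiff, Finset.sdiff_eq_filter]

theorem measurable_numGenes (S : Finset (Fin N)) : Measurable (numGenes S) := by
  have h : Measurable fun x : Population N => ((unionGenes S x).card : ℝ≥0∞) := by
    induction S using Finset.induction_on with
    | empty => simp [unionGenes]
    | insert i S _ ih =>
      simp only [card_unionGenes_insert, Nat.cast_add]
      refine ih.add ?_
      have hm : Measurable fun x : Population N => ∑ u ∈ (x i).genes,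
          if u ∈ unionGenes S x then (0 : ℝ≥0∞) else 1 :=
        Genome.measurable_sum_genes (measurable_pi_apply i)
          (f := fun x u => if u ∈ unionGenes S x then (0 : ℝ≥0∞) else 1)
          (Measurable.ite (measurableSet_mem_unionGenes S) measurable_const measurable_const)
      refine (congrArg Measurable (funext fun x => ?_)).mp hm
      rw [Finset.card_filter, Nat.cast_sum]
      refine Finset.sum_congr rfl fun u _ => ?_
      by_cases hu : u ∈ unionGenes S x <;> simp [hu]
  refine (congrArg Measurable (funext fun x => ?_)).mp h.ennreal_toReal
  simp [numGenes]

theorem exists_fresh (x : Population N) : ∃ u : I, ∀ i, u ∉ (x i).genes := by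
  have : Infinite I := (Set.Icc_infinite (zero_lt_one' ℝ)).to_subtype
  obtain ⟨u, hu⟩ := Infinite.exists_notMem_finset (unionGenes Finset.univ x)
  exact ⟨u, fun i hi => hu (mem_unionGenes.2 ⟨i, Finset.mem_univ i, hi⟩)⟩

/-- A gene that is not present in the population. -/
def fresh (x : Population N) : I := (exists_fresh x).choose

theorem fresh_notMem (x : Population N) (i : Fin N) : fresh x ∉ (x i).genes :=
  (exists_fresh x).choose_spec i

/-- The effect of the gain of a new gene does not depend on which new gene is gained. -/
def GainInvariant (g : Population N → ℝ) : Prop :=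
  ∀ (x : Population N) (i : Fin N) (u v : I), (∀ k, u ∉ (x k).genes) → (∀ k, v ∉ (x k).genes) →
    g (Function.update x i ((x i).gain u)) = g (Function.update x i ((x i).gain v))

/-- The real-valued version of `jump`, where the gained gene is a given new gene. -/
def realJump (ρ θ γ : ℝ) (g : Population N → ℝ) (x : Population N) : ℝ :=
  (∑ i : Fin N, ∑ j : Fin N with j ≠ i, 1 / 2 * g (Function.update x j (x i))) +
  (∑ i : Fin N, ∑ u ∈ (x i).genes, ρ / 2 * g (Function.update x i ((x i).lose u))) +
  (∑ i : Fin N, θ / 2 * g (Function.update x i ((x i).gain (fresh x)))) +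
  (∑ i : Fin N, ∑ j : Fin N with j ≠ i, ∑ u ∈ (x i).genes,
      γ / (2 * N) * g (Function.update x j ((x j).gain u)))

/-- The generator of the Moran model without the gain of genes. -/
def genNoGain (ρ γ : ℝ) (g : Population N → ℝ) (x : Population N) : ℝ :=
  (∑ i : Fin N, ∑ j : Fin N with j ≠ i, 1 / 2 * (g (Function.update x j (x i)) - g x)) +
  (∑ i : Fin N, ∑ u ∈ (x i).genes, ρ / 2 * (g (Function.update x i ((x i).lose u)) - g x)) +
  (∑ i : Fin N, ∑ j : Fin N with j ≠ i, ∑ u ∈ (x i).genes,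
      γ / (2 * N) * (g (Function.update x j ((x j).gain u)) - g x))

/-- The generator of the Moran model on gain-invariant functions. -/
def gen (ρ θ γ : ℝ) (g : Population N → ℝ) (x : Population N) : ℝ :=
  genNoGain ρ γ g x +
    ∑ i : Fin N, θ / 2 * (g (Function.update x i ((x i).gain (fresh x))) - g x)

theorem gen_eq_realJump (ρ θ γ : ℝ) (g : Population N → ℝ) (x : Population N) :
    gen ρ θ γ g x = realJump ρ θ γ g x - realJump ρ θ γ (fun _ => 1) x * g x := by
  simp only [gen, genNoGain, realJump, mul_sub, Finset.sum_sub_distrib, add_mul, Finset.sum_mul,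
    mul_one]
  ring

variable {ρ θ γ : ℝ}

theorem realJump_nonneg (hρ : 0 ≤ ρ) (hθ : 0 ≤ θ) (hγ : 0 ≤ γ) {g : Population N → ℝ}
    (hg : ∀ x, 0 ≤ g x) (x : Population N) : 0 ≤ realJump ρ θ γ g x := by
  unfold realJump
  have h1 : 0 ≤ γ / (2 * N) := by positivity
  refine add_nonneg (add_nonneg (add_nonneg ?_ ?_) ?_) ?_ <;>
  repeat' first
    | refine Finset.sum_nonneg fun _ _ => ?_
    | refine mul_nonneg (by positivity) (hg _)

/-- Only finitely many genes are present, so a uniform gene is almost surely new; for gain-invariant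
`g` the integral over the gained gene is therefore the value at one fixed new gene. -/
theorem jump_ofReal_eq_realJump (hρ : 0 ≤ ρ) (hθ : 0 ≤ θ) (hγ : 0 ≤ γ) {g : Population N → ℝ}
    (hg : ∀ x, 0 ≤ g x) (hgi : GainInvariant g) (x : Population N) :
    jump ρ θ γ (fun y => ENNReal.ofReal (g y)) x = ENNReal.ofReal (realJump ρ θ γ g x) := by
  have h1 : 0 ≤ γ / (2 * N) := by positivity
  have hgain : ∀ i, ∫⁻ u : I, ENNReal.ofReal (g (Function.update x i ((x i).gain u))) =
      ENNReal.ofReal (g (Function.update x i ((x i).gain (fresh x)))) := fun i => by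
    have hae : ∀ᵐ u : I, u ∉ unionGenes Finset.univ x :=
      measure_eq_zero_iff_ae_notMem.1 ((unionGenes Finset.univ x).finite_toSet.measure_zero volume)
    rw [lintegral_congr_ae (g := fun _ =>
      ENNReal.ofReal (g (Function.update x i ((x i).gain (fresh x)))))]
    · simp
    · filter_upwards [hae] with u hu
      rw [hgi x i u (fresh x) (fun k hk => hu (mem_unionGenes.2 ⟨k, Finset.mem_univ k, hk⟩))
        (fresh_notMem x)]
  unfold jump realJump
  rw [ENNReal.ofReal_add, ENNReal.ofReal_add, ENNReal.ofReal_add]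
  rotate_left
  iterate 6
    · repeat' first
        | refine add_nonneg ?_ ?_
        | refine Finset.sum_nonneg fun _ _ => ?_
        | refine mul_nonneg (by positivity) (hg _)
  congr 1
  · congr 1
    · congr 1
      · rw [ENNReal.ofReal_sum_of_nonneg fun i _ => Finset.sum_nonneg fun _ _ =>
          mul_nonneg (by norm_num) (hg _)]
        refine Finset.sum_congr rfl fun i _ => ?_
        rw [ENNReal.ofReal_sum_of_nonneg fun _ _ => mul_nonneg (by norm_num) (hg _)]
        exact Finset.sum_congr rfl fun j _ => (ENNReal.ofReal_mul (by norm_num)).symm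
      · rw [ENNReal.ofReal_sum_of_nonneg fun i _ => Finset.sum_nonneg fun _ _ =>
          mul_nonneg (by positivity) (hg _)]
        refine Finset.sum_congr rfl fun i _ => ?_
        rw [ENNReal.ofReal_sum_of_nonneg fun _ _ => mul_nonneg (by positivity) (hg _)]
        exact Finset.sum_congr rfl fun j _ => (ENNReal.ofReal_mul (by positivity)).symm
    · rw [ENNReal.ofReal_sum_of_nonneg fun i _ => mul_nonneg (by positivity) (hg _)]
      refine Finset.sum_congr rfl fun i _ => ?_
      rw [ENNReal.ofReal_mul (by positivity), hgain]
  · rw [ENNReal.ofReal_sum_of_nonneg fun i _ => Finset.sum_nonneg fun _ _ =>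
      Finset.sum_nonneg fun _ _ => mul_nonneg h1 (hg _)]
    refine Finset.sum_congr rfl fun i _ => ?_
    rw [ENNReal.ofReal_sum_of_nonneg fun _ _ => Finset.sum_nonneg fun _ _ => mul_nonneg h1 (hg _)]
    refine Finset.sum_congr rfl fun j _ => ?_
    rw [ENNReal.ofReal_sum_of_nonneg fun _ _ => mul_nonneg h1 (hg _)]
    exact Finset.sum_congr rfl fun u _ => (ENNReal.ofReal_mul h1).symm

theorem totalRate_eq_realJump (hρ : 0 ≤ ρ) (hθ : 0 ≤ θ) (hγ : 0 ≤ γ) (x : Population N) :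
    totalRate ρ θ γ x = realJump ρ θ γ (fun _ => 1) x := by
  have := jump_ofReal_eq_realJump hρ hθ hγ (g := fun _ : Population N => 1)
    (fun _ => zero_le_one) (fun _ _ _ _ _ _ => rfl) x
  rw [totalRate, ← ENNReal.toReal_ofReal (realJump_nonneg hρ hθ hγ
    (g := fun _ => 1) (fun _ => zero_le_one) x), ← this]
  simp

theorem jump_ofReal (hρ : 0 ≤ ρ) (hθ : 0 ≤ θ) (hγ : 0 ≤ γ) {g : Population N → ℝ}
    (hg : ∀ x, 0 ≤ g x) (hgi : GainInvariant g) (x : Population N) :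
    jump ρ θ γ (fun y => ENNReal.ofReal (g y)) x =
      ENNReal.ofReal (gen ρ θ γ g x + totalRate ρ θ γ x * g x) := by
  rw [jump_ofReal_eq_realJump hρ hθ hγ hg hgi, gen_eq_realJump,
    totalRate_eq_realJump hρ hθ hγ, sub_add_cancel]

theorem gen_add_nonneg (hρ : 0 ≤ ρ) (hθ : 0 ≤ θ) (hγ : 0 ≤ γ) {g : Population N → ℝ}
    (hg : ∀ x, 0 ≤ g x) (x : Population N) :
    0 ≤ gen ρ θ γ g x + totalRate ρ θ γ x * g x := by
  rw [gen_eq_realJump, totalRate_eq_realJump hρ hθ hγ, sub_add_cancel]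
  exact realJump_nonneg hρ hθ hγ hg x

theorem totalRate_eq (hρ : 0 ≤ ρ) (hθ : 0 ≤ θ) (hγ : 0 ≤ γ) (x : Population N) :
    totalRate ρ θ γ x = N * (N - 1 : ℕ) / 2 + ρ / 2 * ∑ i, ((x i).genes.card : ℝ) + N * (θ / 2) +
      γ / (2 * N) * (N - 1 : ℕ) * ∑ i, ((x i).genes.card : ℝ) := by
  have h1 : ∀ i : Fin N, (Finset.univ.filter fun j => j ≠ i).card = N - 1 := fun i => by
    rw [Finset.filter_ne', Finset.card_erase_of_mem (Finset.mem_univ i), Finset.card_univ,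
      Fintype.card_fin]
  rw [totalRate_eq_realJump hρ hθ hγ, realJump]
  simp only [mul_one, Finset.sum_const, h1, nsmul_eq_mul, Finset.card_univ, Fintype.card_fin,
    Finset.mul_sum]
  congr 1
  · congr 2
    · ring
    · exact Finset.sum_congr rfl fun i _ => mul_comm _ _
  · exact Finset.sum_congr rfl fun i _ => by ring

theorem card_genes_eq (x : Population N) (i : Fin N) :
    ((x i).genes.card : ℝ) = numGenes {i} x := by simp [numGenes, unionGenes]

theorem sum_card_genes_le (x : Population N) :
    ∑ i, ((x i).genes.card : ℝ) ≤ N * numGenes Finset.univ x := by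
  calc ∑ i, ((x i).genes.card : ℝ) ≤ ∑ _i : Fin N, numGenes Finset.univ x :=
        Finset.sum_le_sum fun i _ => by
          rw [card_genes_eq]; exact numGenes_mono (Finset.subset_univ _) x
    _ = N * numGenes Finset.univ x := by simp

/-- The rate grows only linearly in the number of genes. Hence a third moment suffices to integrate
the rate against functions of quadratic growth such as `numPairs`. -/
theorem exists_totalRate_le (hρ : 0 ≤ ρ) (hθ : 0 ≤ θ) (hγ : 0 ≤ γ) (N : ℕ) :
    ∃ R : ℝ, 0 ≤ R ∧ ∀ x : Population N, totalRate ρ θ γ x ≤ R * (1 + numGenes Finset.univ x) := by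
  set c : ℝ := ρ / 2 + γ / (2 * N) * (N - 1 : ℕ) with hc
  set b : ℝ := N * (N - 1 : ℕ) / 2 + N * (θ / 2) with hb
  have hc0 : 0 ≤ c := by positivity
  have hb0 : 0 ≤ b := by positivity
  refine ⟨b + c * N, by positivity, fun x => ?_⟩
  rw [totalRate_eq hρ hθ hγ]
  have h1 := mul_le_mul_of_nonneg_left (sum_card_genes_le x) hc0
  have h2 := mul_nonneg hb0 (numGenes_nonneg Finset.univ x)
  have h3 : 0 ≤ c * N := by positivity
  calc _ = b + c * ∑ i, ((x i).genes.card : ℝ) := by rw [hb, hc]; ring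
    _ ≤ b + c * (N * numGenes Finset.univ x) := by gcongr
    _ ≤ _ := by nlinarith

end Moran

/-! ### Duality: the generator acts by moving sets of ancestral lines. -/

namespace Moran

variable {N : ℕ}

/-- After `j` has become a copy of `i`, the ancestor of `j` is `i`, and all other individuals are
their own ancestors. -/
theorem unionGenes_resample (S : Finset (Fin N)) (x : Population N) (i j : Fin N) :
    unionGenes S (Function.update x j (x i)) = unionGenes (S.image (Function.update id j i)) x := by
  rw [unionGenes, unionGenes, Finset.image_biUnion]
  congr 1
  ext1 k
  by_cases hk : k = j
  · subst hk; simp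
  · simp [Function.update_of_ne hk]

theorem numGenes_resample (S : Finset (Fin N)) (x : Population N) (i j : Fin N) :
    numGenes S (Function.update x j (x i)) = numGenes (S.image (Function.update id j i)) x := by
  rw [numGenes, unionGenes_resample, numGenes]

theorem mem_genes_update {x : Population N} {i k : Fin N} {g : Genome} {u : I} :
    u ∈ (Function.update x i g k).genes ↔ (k = i ∧ u ∈ g.genes) ∨ (k ≠ i ∧ u ∈ (x k).genes) := by
  by_cases hk : k = i
  · subst hk; simp
  · simp [hk]

/-- The count drops exactly when `i` is the only member of the sample that carries `u`. -/
theorem numGenes_lose (S : Finset (Fin N)) (x : Population N) (i : Fin N) {u : I}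
    (hu : u ∈ (x i).genes) :
    numGenes S (Function.update x i ((x i).lose u)) =
      numGenes S x - if i ∈ S ∧ u ∉ unionGenes (S.erase i) x then 1 else 0 := by
  split_ifs with h
  · have : unionGenes S (Function.update x i ((x i).lose u)) = (unionGenes S x).erase u := by
      ext v
      have h2 : ∀ k ∈ S, k ≠ i → u ∉ (x k).genes := fun k hk hki hmem =>
        h.2 (mem_unionGenes.2 ⟨k, Finset.mem_erase.2 ⟨hki, hk⟩, hmem⟩)
      simp only [mem_unionGenes, mem_genes_update, Finset.mem_erase, Genome.lose]
      constructor
      · rintro ⟨k, hk, ⟨rfl, h3, h4⟩ | ⟨hki, h3⟩⟩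
        · exact ⟨h3, k, hk, h4⟩
        · exact ⟨fun e => h2 k hk hki (e ▸ h3), k, hk, h3⟩
      · rintro ⟨hvu, k, hk, h3⟩
        by_cases hki : k = i
        · subst hki; exact ⟨k, hk, Or.inl ⟨rfl, hvu, h3⟩⟩
        · exact ⟨k, hk, Or.inr ⟨hki, h3⟩⟩
    have hmem : u ∈ unionGenes S x := mem_unionGenes.2 ⟨i, h.1, hu⟩
    rw [numGenes, this, numGenes, Finset.card_erase_of_mem hmem,
      Nat.cast_sub (Finset.card_pos.2 ⟨u, hmem⟩), Nat.cast_one]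
  · have : unionGenes S (Function.update x i ((x i).lose u)) = unionGenes S x := by
      ext v
      simp only [mem_unionGenes, mem_genes_update, Finset.mem_erase, Genome.lose]
      constructor
      · rintro ⟨k, hk, ⟨rfl, h3, h4⟩ | ⟨hki, h3⟩⟩
        · exact ⟨k, hk, h4⟩
        · exact ⟨k, hk, h3⟩
      · rintro ⟨k, hk, h3⟩
        by_cases hki : k = i
        · subst hki
          by_cases hvu : v = u
          · subst hvu
            have h4 : v ∈ unionGenes (S.erase k) x := by
              by_contra h5; exact h ⟨hk, h5⟩
            obtain ⟨l, hl, h5⟩ := mem_unionGenes.1 h4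
            exact ⟨l, Finset.mem_of_mem_erase hl, Or.inr ⟨Finset.ne_of_mem_erase hl, h5⟩⟩
          · exact ⟨k, hk, Or.inl ⟨rfl, hvu, h3⟩⟩
        · exact ⟨k, hk, Or.inr ⟨hki, h3⟩⟩
    rw [numGenes, this, numGenes, sub_zero]

theorem numGenes_gain (S : Finset (Fin N)) (x : Population N) (j : Fin N) (u : I) :
    numGenes S (Function.update x j ((x j).gain u)) =
      numGenes S x + if j ∈ S ∧ u ∉ unionGenes S x then 1 else 0 := by
  have key : unionGenes S (Function.update x j ((x j).gain u)) =
      if j ∈ S then insert u (unionGenes S x) else unionGenes S x := by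
    ext v
    split_ifs with h
    · simp only [mem_unionGenes, mem_genes_update, Finset.mem_insert, Genome.gain]
      constructor
      · rintro ⟨k, hk, ⟨rfl, h3 | h3⟩ | ⟨hki, h3⟩⟩
        · exact Or.inl h3
        · exact Or.inr ⟨k, hk, h3⟩
        · exact Or.inr ⟨k, hk, h3⟩
      · rintro (h3 | ⟨k, hk, h3⟩)
        · exact ⟨j, h, Or.inl ⟨rfl, Or.inl h3⟩⟩
        · by_cases hkj : k = j
          · subst hkj; exact ⟨k, hk, Or.inl ⟨rfl, Or.inr h3⟩⟩
          · exact ⟨k, hk, Or.inr ⟨hkj, h3⟩⟩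
    · simp only [mem_unionGenes, mem_genes_update]
      constructor
      · rintro ⟨k, hk, ⟨rfl, h3⟩ | ⟨hki, h3⟩⟩
        · exact absurd hk h
        · exact ⟨k, hk, h3⟩
      · rintro ⟨k, hk, h3⟩
        exact ⟨k, hk, Or.inr ⟨fun e => h (e ▸ hk), h3⟩⟩
  rw [numGenes, key, numGenes]
  by_cases h : j ∈ S <;> by_cases hu : u ∈ unionGenes S x <;> simp [h, hu]

theorem numGenes_gain_fresh (S : Finset (Fin N)) (x : Population N) (j : Fin N) {u : I}
    (hu : ∀ k, u ∉ (x k).genes) :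
    numGenes S (Function.update x j ((x j).gain u)) = numGenes S x + if j ∈ S then 1 else 0 := by
  rw [numGenes_gain]
  have : u ∉ unionGenes S x := fun h => by
    obtain ⟨k, _, hk⟩ := mem_unionGenes.1 h
    exact hu k hk
  simp [this]

theorem sum_genes_notMem_union (S : Finset (Fin N)) (x : Population N) (i : Fin N) :
    ∑ u ∈ (x i).genes, (if u ∉ unionGenes S x then (1 : ℝ) else 0) =
      numGenes (insert i S) x - numGenes S x := by
  rw [numGenes, card_unionGenes_insert, Nat.cast_add, ← numGenes, add_sub_cancel_left,
    Finset.sum_boole]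

/-- Genes private to `i` within `S` are those that disappear from the sample with the line `i`. This
is why losses, summed over the genes of `i`, act on the dual by deleting `i`. -/
theorem sum_genes_private (S : Finset (Fin N)) (x : Population N) (i : Fin N) :
    ∑ u ∈ (x i).genes, (if i ∈ S ∧ u ∉ unionGenes (S.erase i) x then (1 : ℝ) else 0) =
      numGenes S x - numGenes (S.erase i) x := by
  by_cases h : i ∈ S
  · simp only [h, true_and]
    rw [sum_genes_notMem_union, Finset.insert_erase h]
  · simp [h]

/-- A transfer from `i` to `j ∈ S` matters for the genes of `i` that the sample lacks; counting them
means adding the donor `i` to the sample. -/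
theorem sum_genes_transfer (S : Finset (Fin N)) (x : Population N) (i j : Fin N) :
    ∑ u ∈ (x i).genes, (if j ∈ S ∧ u ∉ unionGenes S x then (1 : ℝ) else 0) =
      if j ∈ S then numGenes (insert i S) x - numGenes S x else 0 := by
  by_cases h : j ∈ S
  · simp only [h, true_and, if_true]
    rw [sum_genes_notMem_union]
  · simp [h]

/-- The number of ordered pairs of distinct genes `(u, v)` such that `u` is present in the sample
`S` and `v` in the sample `T`. -/
def numPairs (S T : Finset (Fin N)) (x : Population N) : ℝ :=
  numGenes S x * numGenes T x - numGenes S x - numGenes T x + numGenes (S ∪ T) x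

/-- By inclusion-exclusion the expression is the product of the two cardinalities minus that of the
intersection. -/
theorem numPairs_nonneg (S T : Finset (Fin N)) (x : Population N) : 0 ≤ numPairs S T x := by
  have h : (unionGenes S x ∪ unionGenes T x).card + (unionGenes S x ∩ unionGenes T x).card =
    (unionGenes S x).card + (unionGenes T x).card := Finset.card_union_add_card_inter _ _
  have h1 := Finset.card_le_card (Finset.inter_subset_left (s₁ := unionGenes S x)
    (s₂ := unionGenes T x))
  have h2 := Finset.card_le_card (Finset.inter_subset_right (s₁ := unionGenes S x)
    (s₂ := unionGenes T x))
  have h3 : (unionGenes S x ∩ unionGenes T x).card ≤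
      (unionGenes S x).card * (unionGenes T x).card := by
    rcases Nat.eq_zero_or_pos (unionGenes T x).card with h0 | h0
    · omega
    · exact h1.trans (Nat.le_mul_of_pos_right _ h0)
  rw [numPairs, numGenes, numGenes, numGenes, unionGenes_union]
  have h' : ((unionGenes S x ∪ unionGenes T x).card : ℝ) +
    ((unionGenes S x ∩ unionGenes T x).card : ℝ) =
    (unionGenes S x).card + (unionGenes T x).card := by exact_mod_cast h
  have h3' : ((unionGenes S x ∩ unionGenes T x).card : ℝ) ≤
      (unionGenes S x).card * (unionGenes T x).card := by exact_mod_cast h3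
  linarith

/-- The generator of the dual process of pairs of sets of ancestral lines. -/
def dualGen (ρ γ : ℝ) (F : Finset (Fin N) → Finset (Fin N) → ℝ) (S T : Finset (Fin N)) : ℝ :=
  1 / 2 * ∑ i, ∑ j, (F (S.image (Function.update id j i)) (T.image (Function.update id j i)) -
    F S T) +
  ρ / 2 * (∑ i, (F (S.erase i) T - F S T) + ∑ i, (F S (T.erase i) - F S T)) +
  γ / (2 * N) * (S.card * ∑ i, (F (insert i S) T - F S T) +
    T.card * ∑ i, (F S (insert i T) - F S T))

theorem sum_ne_eq_sum {f : Fin N → Fin N → ℝ} (hf : ∀ i, f i i = 0) :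
    ∑ i, ∑ j with j ≠ i, f i j = ∑ i, ∑ j, f i j := by
  refine Finset.sum_congr rfl fun i _ => ?_
  refine Finset.sum_filter_of_ne fun j _ h => ?_
  rintro rfl
  exact h (hf j)

theorem sum_resample {F : Finset (Fin N) → Finset (Fin N) → Population N → ℝ}
    (S T : Finset (Fin N)) (x : Population N)
    (h : ∀ i j, F S T (Function.update x j (x i)) =
      F (S.image (Function.update id j i)) (T.image (Function.update id j i)) x) :
    ∑ i, ∑ j with j ≠ i, 1 / 2 * (F S T (Function.update x j (x i)) - F S T x) =
      1 / 2 * ∑ i, ∑ j, (F (S.image (Function.update id j i))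
        (T.image (Function.update id j i)) x - F S T x) := by
  rw [sum_ne_eq_sum fun i => by simp]
  simp only [h, Finset.mul_sum]

/-- The diagonal may be added because it contributes nothing; then every recipient `j ∈ S`
contributes the same sum over donors. -/
theorem sum_ne_ite_mem (S : Finset (Fin N)) {f : Fin N → ℝ} (hf : ∀ i ∈ S, f i = 0) :
    ∑ i, ∑ j with j ≠ i, (if j ∈ S then f i else 0) = S.card * ∑ i, f i := by
  rw [sum_ne_eq_sum fun i => ?_]
  · simp [Finset.mul_sum]
  · split_ifs with h
    exacts [hf i h, rfl]

variable (ρ θ γ : ℝ)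

theorem genNoGain_numGenes (S : Finset (Fin N)) (x : Population N) :
    genNoGain ρ γ (numGenes S) x = dualGen ρ γ (fun S _ => numGenes S x) S ∅ := by
  have h1 := sum_resample (F := fun S _ => numGenes S) S ∅ x (numGenes_resample S x)
  have h2 : ∑ i, ∑ u ∈ (x i).genes,
      ρ / 2 * (numGenes S (Function.update x i ((x i).lose u)) - numGenes S x) =
      ρ / 2 * ∑ i, (numGenes (S.erase i) x - numGenes S x) := by
    rw [Finset.mul_sum]
    refine Finset.sum_congr rfl fun i _ => ?_
    rw [← Finset.mul_sum, ← neg_sub (numGenes S x), ← sum_genes_private, ← Finset.sum_neg_distrib]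
    congr 1
    refine Finset.sum_congr rfl fun u hu => ?_
    rw [numGenes_lose S x i hu]
    ring
  have h3 : ∑ i, ∑ j with j ≠ i, ∑ u ∈ (x i).genes,
      γ / (2 * N) * (numGenes S (Function.update x j ((x j).gain u)) - numGenes S x) =
      γ / (2 * N) * (S.card * ∑ i, (numGenes (insert i S) x - numGenes S x)) := by
    rw [← sum_ne_ite_mem S fun i hi => by rw [Finset.insert_eq_self.2 hi, sub_self],
      Finset.mul_sum]
    refine Finset.sum_congr rfl fun i _ => ?_
    rw [Finset.mul_sum]
    refine Finset.sum_congr rfl fun j _ => ?_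
    rw [← sum_genes_transfer, Finset.mul_sum]
    refine Finset.sum_congr rfl fun u _ => ?_
    rw [numGenes_gain, add_sub_cancel_left]
  rw [genNoGain, h2, h3, dualGen]
  exact (congrArg (fun z => z + _ + _) h1).trans (by simp)

/-- The generator applied to the number of genes in a sample, as the dual generator. -/
theorem gen_numGenes (S : Finset (Fin N)) (x : Population N) :
    gen ρ θ γ (numGenes S) x =
      dualGen ρ γ (fun S _ => numGenes S x) S ∅ + θ / 2 * S.card := by
  have h4 : ∑ i, θ / 2 * (numGenes S (Function.update x i ((x i).gain (fresh x))) -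
      numGenes S x) = θ / 2 * S.card := by
    simp only [numGenes_gain_fresh S x _ (fresh_notMem x), add_sub_cancel_left]
    simp [mul_comm]
  rw [gen, genNoGain_numGenes, h4]

/-- A loss concerns one gene, and the two genes of a pair are distinct, so no term appears in which
`i` is deleted from both sets at once. In the algebra, the cross term `δ S u * δ T u` cancels
against `δ (S ∪ T) u` when `i` is in both sets, because `u` is private in `S` and in `T` exactly if
it is private in `S ∪ T`. -/
theorem numPairs_lose_sum (S T : Finset (Fin N)) (x : Population N) (i : Fin N) :
    ∑ u ∈ (x i).genes, (numPairs S T (Function.update x i ((x i).lose u)) - numPairs S T x) =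
      (numPairs (S.erase i) T x - numPairs S T x) +
        (numPairs S (T.erase i) x - numPairs S T x) := by
  set δ : Finset (Fin N) → I → ℝ := fun R u =>
    if i ∈ R ∧ u ∉ unionGenes (R.erase i) x then 1 else 0 with hδ
  have hs : ∀ R, ∑ u ∈ (x i).genes, δ R u = numGenes R x - numGenes (R.erase i) x := fun R =>
    sum_genes_private R x i
  have hd : ∀ u ∈ (x i).genes, numPairs S T (Function.update x i ((x i).lose u)) -
      numPairs S T x = -(δ S u * numGenes T x) - δ T u * numGenes S x + δ S u + δ T u +
        (δ S u * δ T u - δ (S ∪ T) u) := fun u hu => by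
    simp only [numPairs, numGenes_lose _ x i hu, hδ]
    ring
  rw [Finset.sum_congr rfl hd]
  simp only [Finset.sum_add_distrib, Finset.sum_sub_distrib, Finset.sum_neg_distrib,
    ← Finset.sum_mul, hs]
  have hcross : ∑ u ∈ (x i).genes, δ S u * δ T u =
      if i ∈ S ∧ i ∈ T then numGenes (S ∪ T) x - numGenes ((S ∪ T).erase i) x else 0 := by
    split_ifs with h
    · rw [← hs]
      refine Finset.sum_congr rfl fun u _ => ?_
      simp only [hδ, h.1, h.2, true_and, Finset.mem_union, true_or, Finset.erase_union_distrib,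
        unionGenes_union, not_or]
      by_cases h1 : u ∈ unionGenes (S.erase i) x <;> by_cases h2 : u ∈ unionGenes (T.erase i) x <;>
        simp [h1, h2]
    · refine Finset.sum_eq_zero fun u _ => ?_
      by_cases h1 : i ∈ S
      · have h2 : i ∉ T := fun h2 => h ⟨h1, h2⟩
        simp [hδ, h2]
      · simp [hδ, h1]
  rw [hcross]
  simp only [numPairs]
  by_cases h1 : i ∈ S <;> by_cases h2 : i ∈ T
  · have e1 : S.erase i ∪ T = S ∪ T := by ext k; by_cases hk : k = i <;> simp [hk, h2]
    have e2 : S ∪ T.erase i = S ∪ T := by ext k; by_cases hk : k = i <;> simp [hk, h1]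
    simp only [h1, h2, and_self, if_true, e1, e2]; ring
  · have e1 : S.erase i ∪ T = (S ∪ T).erase i := by
      ext k; by_cases hk : k = i <;> simp [hk, h2]
    simp only [h2, and_false, if_false, e1, Finset.erase_eq_of_notMem h2]; ring
  · have e2 : S ∪ T.erase i = (S ∪ T).erase i := by
      ext k; by_cases hk : k = i <;> simp [hk, h1]
    simp only [h1, false_and, if_false, e2, Finset.erase_eq_of_notMem h1]; ring
  · have e3 : (S ∪ T).erase i = S ∪ T := Finset.erase_eq_of_notMem (by simp [h1, h2])
    simp only [h1, false_and, if_false, e3, Finset.erase_eq_of_notMem h1,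
      Finset.erase_eq_of_notMem h2]; ring

/-- As for losses, a transfer affects a single gene of the pair. If `j` is in both sets, the cross
term supplies the change of `numGenes (S ∪ T)`, which is then counted once for each of the two
right-hand terms. -/
theorem numPairs_transfer_sum (S T : Finset (Fin N)) (x : Population N) (i j : Fin N) :
    ∑ u ∈ (x i).genes, (numPairs S T (Function.update x j ((x j).gain u)) - numPairs S T x) =
      (if j ∈ S then numPairs (insert i S) T x - numPairs S T x else 0) +
        (if j ∈ T then numPairs S (insert i T) x - numPairs S T x else 0) := by
  set δ : Finset (Fin N) → I → ℝ := fun R u =>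
    if j ∈ R ∧ u ∉ unionGenes R x then 1 else 0 with hδ
  have hs : ∀ R, ∑ u ∈ (x i).genes, δ R u =
      if j ∈ R then numGenes (insert i R) x - numGenes R x else 0 := fun R =>
    sum_genes_transfer R x i j
  have hd : ∀ u ∈ (x i).genes, numPairs S T (Function.update x j ((x j).gain u)) -
      numPairs S T x = δ S u * numGenes T x + δ T u * numGenes S x - δ S u - δ T u +
        (δ S u * δ T u + δ (S ∪ T) u) := fun u hu => by
    simp only [numPairs, numGenes_gain, hδ]
    ring
  rw [Finset.sum_congr rfl hd]
  simp only [Finset.sum_add_distrib, Finset.sum_sub_distrib, ← Finset.sum_mul, hs]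
  have hcross : ∑ u ∈ (x i).genes, δ S u * δ T u =
      if j ∈ S ∧ j ∈ T then numGenes (insert i (S ∪ T)) x - numGenes (S ∪ T) x else 0 := by
    split_ifs with h
    · have := hs (S ∪ T)
      rw [if_pos (by simp [h.1])] at this
      rw [← this]
      refine Finset.sum_congr rfl fun u _ => ?_
      simp only [hδ, h.1, h.2, true_and, Finset.mem_union, true_or,
        unionGenes_union, not_or]
      by_cases h1 : u ∈ unionGenes S x <;> by_cases h2 : u ∈ unionGenes T x <;>
        simp [h1, h2]
    · refine Finset.sum_eq_zero fun u _ => ?_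
      by_cases h1 : j ∈ S
      · have h2 : j ∉ T := fun h2 => h ⟨h1, h2⟩
        simp [hδ, h2]
      · simp [hδ, h1]
  rw [hcross]
  simp only [numPairs, Finset.mem_union, Finset.insert_union, Finset.union_insert]
  by_cases h1 : j ∈ S <;> by_cases h2 : j ∈ T <;> simp only [h1, h2, and_self, or_self, and_false,
    false_and, if_true, if_false, or_false, false_or] <;> ring

/-- The generator applied to the number of pairs of genes in two samples, as the dual
generator. -/
theorem gen_numPairs (S T : Finset (Fin N)) (x : Population N) :
    gen ρ θ γ (numPairs S T) x = dualGen ρ γ (fun S T => numPairs S T x) S T +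
      θ / 2 * (S.card * numGenes T x + T.card * numGenes S x) := by
  have h1 := sum_resample (F := numPairs) S T x fun i j => by
    simp only [numPairs, numGenes_resample, Finset.image_union]
  have h2 : ∑ i, ∑ u ∈ (x i).genes,
      ρ / 2 * (numPairs S T (Function.update x i ((x i).lose u)) - numPairs S T x) =
      ρ / 2 * (∑ i, (numPairs (S.erase i) T x - numPairs S T x) +
        ∑ i, (numPairs S (T.erase i) x - numPairs S T x)) := by
    simp only [← Finset.mul_sum, numPairs_lose_sum, Finset.sum_add_distrib]
  have h3 : ∑ i, ∑ j with j ≠ i, ∑ u ∈ (x i).genes,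
      γ / (2 * N) * (numPairs S T (Function.update x j ((x j).gain u)) - numPairs S T x) =
      γ / (2 * N) * (S.card * ∑ i, (numPairs (insert i S) T x - numPairs S T x) +
        T.card * ∑ i, (numPairs S (insert i T) x - numPairs S T x)) := by
    rw [← sum_ne_ite_mem S fun i hi => by rw [Finset.insert_eq_self.2 hi, sub_self],
      ← sum_ne_ite_mem T fun i hi => by rw [Finset.insert_eq_self.2 hi, sub_self]]
    simp only [← Finset.mul_sum, numPairs_transfer_sum, Finset.sum_add_distrib]
  have h4 : ∑ i, θ / 2 * (numPairs S T (Function.update x i ((x i).gain (fresh x))) -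
      numPairs S T x) = θ / 2 * (S.card * numGenes T x + T.card * numGenes S x) := by
    rw [← Finset.mul_sum]
    congr 1
    -- The new gene forms pairs with old genes only; the pair of the new gene with itself is not
    -- counted, so no constant term appears.
    have h5 : ∀ i, numPairs S T (Function.update x i ((x i).gain (fresh x))) - numPairs S T x =
        (if i ∈ S then numGenes T x else 0) + (if i ∈ T then numGenes S x else 0) := fun i => by
      simp only [numPairs, numGenes_gain_fresh _ x _ (fresh_notMem x), Finset.mem_union]
      by_cases h1 : i ∈ S <;> by_cases h2 : i ∈ T <;> simp [h1, h2] <;> ring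
    simp only [h5, Finset.sum_add_distrib]
    simp
  rw [gen, genNoGain, h1, h2, h3, h4, dualGen]

theorem gainInvariant_numGenes (S : Finset (Fin N)) : GainInvariant (numGenes S) :=
  fun x i u v hu hv => by rw [numGenes_gain_fresh S x i hu, numGenes_gain_fresh S x i hv]

theorem gainInvariant_numPairs (S T : Finset (Fin N)) : GainInvariant (numPairs S T) :=
  fun x i u v hu hv => by
    simp only [numPairs, gainInvariant_numGenes _ x i u v hu hv]

theorem measurable_numPairs (S T : Finset (Fin N)) : Measurable (numPairs S T) :=
  (((measurable_numGenes S).mul (measurable_numGenes T)).sub (measurable_numGenes S)).sub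
    (measurable_numGenes T) |>.add (measurable_numGenes (S ∪ T))

end Moran

/-! ### Lyapunov functions and moment bounds for equilibria. -/

namespace Moran

variable {N : ℕ} {ρ θ γ : ℝ}

theorem genNoGain_add (f g : Population N → ℝ) (x : Population N) :
    genNoGain ρ γ (fun y => f y + g y) x = genNoGain ρ γ f x + genNoGain ρ γ g x := by
  simp only [genNoGain, add_sub_add_comm, mul_add, Finset.sum_add_distrib]
  ring

theorem genNoGain_const_mul (c : ℝ) (f : Population N → ℝ) (x : Population N) :
    genNoGain ρ γ (fun y => c * f y) x = c * genNoGain ρ γ f x := by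
  simp only [genNoGain, ← mul_sub, mul_left_comm _ c, ← Finset.mul_sum, ← mul_add]

theorem genNoGain_sum_mul {ι : Type*} (s : Finset ι) (c : ι → ℝ) (f : ι → Population N → ℝ)
    (x : Population N) : genNoGain ρ γ (fun y => ∑ k ∈ s, c k * f k y) x =
      ∑ k ∈ s, c k * genNoGain ρ γ (f k) x := by
  classical
  induction s using Finset.induction_on with
  | empty => simp [genNoGain]
  | insert k s hk ih =>
    simp only [Finset.sum_insert hk]
    rw [← ih, genNoGain_add, genNoGain_const_mul]

/-- If `g` does not increase at events other than gains, it can be pulled out of the generator. -/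
theorem genNoGain_mul_le (hρ : 0 ≤ ρ) (hγ : 0 ≤ γ) {f g : Population N → ℝ} (hf : ∀ x, 0 ≤ f x)
    (x : Population N) (h1 : ∀ i j, g (Function.update x j (x i)) ≤ g x)
    (h2 : ∀ i, ∀ u ∈ (x i).genes, g (Function.update x i ((x i).lose u)) ≤ g x)
    (h3 : ∀ i j, ∀ u ∈ (x i).genes, g (Function.update x j ((x j).gain u)) ≤ g x) :
    genNoGain ρ γ (fun y => f y * g y) x ≤ g x * genNoGain ρ γ f x := by
  have hγN : 0 ≤ γ / (2 * N) := by positivity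
  have key : ∀ (c : ℝ) (y : Population N), 0 ≤ c → g y ≤ g x →
      c * (f y * g y - f x * g x) ≤ g x * (c * (f y - f x)) := fun c y hc hy => by
    have := mul_le_mul_of_nonneg_left (mul_le_mul_of_nonneg_left hy (hf y)) hc
    linarith
  simp only [genNoGain, mul_add, Finset.mul_sum]
  refine add_le_add (add_le_add (Finset.sum_le_sum fun i _ => Finset.sum_le_sum fun j _ => ?_)
    (Finset.sum_le_sum fun i _ => Finset.sum_le_sum fun u hu => ?_))
    (Finset.sum_le_sum fun i _ => Finset.sum_le_sum fun j _ => Finset.sum_le_sum fun u hu => ?_)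
  · exact key _ _ (by norm_num) (h1 i j)
  · exact key _ _ (by positivity) (h2 i u hu)
  · exact key _ _ hγN (h3 i j u hu)

theorem numGenes_univ_resample_le (x : Population N) (i j : Fin N) :
    numGenes Finset.univ (Function.update x j (x i)) ≤ numGenes Finset.univ x := by
  rw [numGenes_resample]
  exact numGenes_mono (Finset.subset_univ _) x

theorem numGenes_lose_le (S : Finset (Fin N)) (x : Population N) (i : Fin N) {u : I}
    (hu : u ∈ (x i).genes) :
    numGenes S (Function.update x i ((x i).lose u)) ≤ numGenes S x := by
  rw [numGenes_lose S x i hu]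
  split_ifs <;> linarith

theorem numGenes_univ_transfer (x : Population N) (i j : Fin N) {u : I} (hu : u ∈ (x i).genes) :
    numGenes Finset.univ (Function.update x j ((x j).gain u)) = numGenes Finset.univ x := by
  rw [numGenes_gain, if_neg, add_zero]
  exact fun h => h.2 (mem_unionGenes.2 ⟨i, Finset.mem_univ i, hu⟩)

/-- A Lyapunov function: a weighted sum of the numbers of genes in all samples. -/
def lyapunov (κ : ℝ) (x : Population N) : ℝ := ∑ S : Finset (Fin N), κ ^ S.card * numGenes S x

/-- If at most one of `i`, `j` lies in `S`, the two moved sets are `S` and its transposition in some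
order, and equality holds. If both lie in `S`, both moves only shrink `S`. -/
theorem numGenes_resample_add_le (S : Finset (Fin N)) (x : Population N) (i j : Fin N) :
    numGenes (S.image (Function.update id j i)) x + numGenes (S.image (Function.update id i j)) x ≤
      numGenes S x + numGenes (S.image (Equiv.swap i j)) x := by
  have himg : ∀ (T : Finset (Fin N)) (f g : Fin N → Fin N), (∀ k ∈ T, f k = g k) →
      T.image f = T.image g := fun T f g h => Finset.image_congr h
  have hne : ∀ {a k}, a ∉ S → k ∈ S → k ≠ a := fun ha hk e => ha (e ▸ hk)
  have hid : ∀ a b, a ∉ S → S.image (Function.update id a b) = S := fun a b ha => by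
    rw [himg S _ id fun k hk => Function.update_of_ne (hne ha hk) _ _, Finset.image_id]
  have hsub : ∀ a b, b ∈ S → S.image (Function.update id a b) ⊆ S := fun a b hb k hk => by
    obtain ⟨l, hl, rfl⟩ := Finset.mem_image.1 hk
    by_cases hla : l = a
    · subst hla; simpa using hb
    · simpa [Function.update_of_ne hla] using hl
  have hsw : ∀ a b, a ∈ S → b ∉ S →
      S.image (Function.update id a b) = S.image (Equiv.swap a b) := fun a b _ hb => by
    refine himg S _ _ fun k hk => ?_
    by_cases hka : k = a
    · subst hka; simp
    · rw [Function.update_of_ne hka, Equiv.swap_apply_of_ne_of_ne hka (hne hb hk), id]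
  by_cases hi : i ∈ S <;> by_cases hj : j ∈ S
  · have e : S.image (Equiv.swap i j) = S := by
      refine Finset.eq_of_subset_of_card_le (fun k hk => ?_) ?_
      · obtain ⟨l, hl, rfl⟩ := Finset.mem_image.1 hk
        rw [Equiv.swap_apply_def]
        split_ifs
        exacts [hj, hi, hl]
      · rw [Finset.card_image_of_injective _ (Equiv.injective _)]
    rw [e]
    exact add_le_add (numGenes_mono (hsub j i hi) x) (numGenes_mono (hsub i j hj) x)
  · rw [hid j i hj, hsw i j hi hj]
  · rw [hid i j hi, hsw j i hj hi, Equiv.swap_comm, add_comm]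
  · rw [hid i j hi, hid j i hj]
    have e : S.image (Equiv.swap i j) = S := by
      rw [himg S (Equiv.swap i j) id fun k hk =>
        Equiv.swap_apply_of_ne_of_ne (hne hi hk) (hne hj hk), Finset.image_id]
    rw [e]

/-- The weights depend only on the size of `S`, so the weighted sum is invariant under
transpositions. Pairing the event `(i, j)` with `(j, i)` and comparing with the transposition shows
that resampling cannot increase the Lyapunov function on average. -/
theorem sum_resample_nonpos (κ : ℝ) (hκ : 0 ≤ κ) (x : Population N) :
    ∑ S : Finset (Fin N), κ ^ S.card *
      ∑ i, ∑ j, (numGenes (S.image (Function.update id j i)) x - numGenes S x) ≤ 0 := by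
  have hswap : ∀ i j : Fin N, ∑ S : Finset (Fin N), κ ^ S.card *
      numGenes (S.image (Equiv.swap i j)) x = ∑ S : Finset (Fin N), κ ^ S.card * numGenes S x :=
    fun i j => by
      rw [← (Equiv.finsetCongr (Equiv.swap i j)).sum_comp
        (fun S : Finset (Fin N) => κ ^ S.card * numGenes S x)]
      refine Finset.sum_congr rfl fun S _ => ?_
      rw [Equiv.finsetCongr_apply, Finset.card_map, Finset.map_eq_image]
      rfl
  have h1 : ∑ S : Finset (Fin N), κ ^ S.card *
      ∑ i, ∑ j, (numGenes (S.image (Function.update id j i)) x - numGenes S x) =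
      ∑ S : Finset (Fin N), κ ^ S.card *
      ∑ i, ∑ j, (numGenes (S.image (Function.update id i j)) x - numGenes S x) :=
    Finset.sum_congr rfl fun S _ => by rw [Finset.sum_comm]
  have h2 : ∑ S : Finset (Fin N), κ ^ S.card *
      ∑ i, ∑ j, (numGenes (S.image (Equiv.swap i j)) x - numGenes S x) = 0 := by
    simp only [Finset.mul_sum]
    rw [Finset.sum_comm]
    refine Finset.sum_eq_zero fun i _ => ?_
    rw [Finset.sum_comm]
    refine Finset.sum_eq_zero fun j _ => ?_
    simp only [mul_sub, Finset.sum_sub_distrib, hswap, sub_self]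
  have h3 : ∑ S : Finset (Fin N), κ ^ S.card *
      ∑ i, ∑ j, (numGenes (S.image (Function.update id j i)) x - numGenes S x) +
      ∑ S : Finset (Fin N), κ ^ S.card *
      ∑ i, ∑ j, (numGenes (S.image (Function.update id i j)) x - numGenes S x) ≤
      ∑ S : Finset (Fin N), κ ^ S.card *
      ∑ i, ∑ j, (numGenes (S.image (Equiv.swap i j)) x - numGenes S x) := by
    simp only [← Finset.sum_add_distrib, ← mul_add]
    refine Finset.sum_le_sum fun S _ => mul_le_mul_of_nonneg_left ?_ (pow_nonneg hκ _)
    refine Finset.sum_le_sum fun i _ => Finset.sum_le_sum fun j _ => ?_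
    linarith [numGenes_resample_add_le S x i j]
  linarith

theorem sum_finset_eq (i : Fin N) (f : Finset (Fin N) → ℝ) :
    ∑ S, f S = ∑ S ∈ (Finset.univ.erase i).powerset, (f S + f (insert i S)) := by
  rw [Finset.sum_add_distrib, ← Finset.sum_powerset_insert (Finset.notMem_erase i _),
    Finset.insert_erase (Finset.mem_univ i), Finset.powerset_univ]

/-- Pair `S` with `insert i S` for `i ∉ S`. With `Δ` the number of genes that `i` adds, deleting `i`
from the larger set contributes `-κ ^ (S.card + 1) * ρ / 2 * Δ`, while transfer into the smaller one
contributes at most `κ ^ S.card * γ / 2 * Δ`, because `S.card ≤ N`. The condition on `κ` leaves at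
least `-Δ`. Keeping only `S = ∅` and summing over `i` dominates the number of all genes. -/
theorem genNoGain_lyapunov_le (hN : 1 ≤ N) (hγ : 0 ≤ γ) {κ : ℝ} (hκ1 : 1 ≤ κ)
    (hκ : γ + 2 ≤ κ * ρ) (x : Population N) :
    genNoGain ρ γ (lyapunov κ) x ≤ -numGenes Finset.univ x := by
  have hN' : (0 : ℝ) < N := by exact_mod_cast hN
  have e : genNoGain ρ γ (lyapunov κ) x = 1 / 2 * ∑ S : Finset (Fin N), κ ^ S.card *
      ∑ i, ∑ j, (numGenes (S.image (Function.update id j i)) x - numGenes S x) +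
      ∑ i, ∑ S : Finset (Fin N), κ ^ S.card * (ρ / 2 * (numGenes (S.erase i) x - numGenes S x) +
        γ / (2 * N) * S.card * (numGenes (insert i S) x - numGenes S x)) := by
    unfold lyapunov
    rw [genNoGain_sum_mul]
    simp only [genNoGain_numGenes, dualGen]
    rw [Finset.sum_comm, Finset.mul_sum, ← Finset.sum_add_distrib]
    refine Finset.sum_congr rfl fun S _ => ?_
    simp only [Finset.card_empty, Nat.cast_zero, zero_mul, sub_self, Finset.sum_const_zero,
      add_zero, mul_add, Finset.sum_add_distrib]
    simp only [← Finset.mul_sum]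
    ring
  have hi : ∀ i, ∑ S : Finset (Fin N), κ ^ S.card * (ρ / 2 * (numGenes (S.erase i) x -
      numGenes S x) + γ / (2 * N) * S.card * (numGenes (insert i S) x - numGenes S x)) ≤
      -numGenes {i} x := fun i => by
    rw [sum_finset_eq i]
    have hterm : ∀ S ∈ (Finset.univ.erase i).powerset, κ ^ S.card * (ρ / 2 *
        (numGenes (S.erase i) x - numGenes S x) +
        γ / (2 * N) * S.card * (numGenes (insert i S) x - numGenes S x)) +
        κ ^ (insert i S).card * (ρ / 2 *
        (numGenes ((insert i S).erase i) x - numGenes (insert i S) x) +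
        γ / (2 * N) * (insert i S).card *
          (numGenes (insert i (insert i S)) x - numGenes (insert i S) x)) ≤
        -(numGenes (insert i S) x - numGenes S x) := fun S hS => by
      have hiS : i ∉ S := fun h => Finset.notMem_erase i _ (Finset.mem_powerset.1 hS h)
      rw [Finset.erase_eq_of_notMem hiS, Finset.erase_insert hiS, Finset.insert_idem,
        Finset.card_insert_of_notMem hiS]
      have hΔ : 0 ≤ numGenes (insert i S) x - numGenes S x :=
        sub_nonneg.2 (numGenes_mono (Finset.subset_insert i S) x)
      set Δ := numGenes (insert i S) x - numGenes S x
      have hcard : γ / (2 * N) * S.card ≤ γ / 2 := by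
        have : (S.card : ℝ) ≤ N := by exact_mod_cast (card_finset_fin_le S)
        rw [div_mul_eq_mul_div, div_le_div_iff₀ (by positivity) (by norm_num)]
        nlinarith
      have hpow : 1 ≤ κ ^ S.card := one_le_pow₀ hκ1
      have hle : κ ^ S.card * Δ * (γ / (2 * N) * S.card - κ * ρ / 2) ≤
          κ ^ S.card * Δ * (-1) :=
        mul_le_mul_of_nonneg_left (by linarith) (mul_nonneg (by positivity) hΔ)
      have h2 : Δ ≤ κ ^ S.card * Δ := le_mul_of_one_le_left hΔ hpow
      have h3 : numGenes S x - numGenes (insert i S) x = -Δ := (neg_sub _ _).symm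
      rw [h3, pow_succ]
      nlinarith
    refine (Finset.sum_le_sum hterm).trans ?_
    rw [Finset.sum_neg_distrib, neg_le_neg_iff]
    have := Finset.single_le_sum (f := fun S => numGenes (insert i S) x - numGenes S x)
      (s := (Finset.univ.erase i).powerset)
      (fun S _ => sub_nonneg.2 (numGenes_mono (Finset.subset_insert i S) x))
      (Finset.empty_mem_powerset _)
    simpa using this
  have hM : numGenes Finset.univ x ≤ ∑ i, numGenes {i} x := by
    rw [← Finset.sum_congr rfl fun i _ => card_genes_eq x i, numGenes, unionGenes]
    exact_mod_cast Finset.card_biUnion_le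
  have h1 := sum_resample_nonpos κ (zero_le_one.trans hκ1) x
  have h2 := Finset.sum_le_sum fun i (_ : i ∈ Finset.univ) => hi i
  rw [Finset.sum_neg_distrib] at h2
  rw [e]
  linarith

theorem lyapunov_nonneg {κ : ℝ} (hκ : 0 ≤ κ) (x : Population N) : 0 ≤ lyapunov κ x :=
  Finset.sum_nonneg fun S _ => mul_nonneg (pow_nonneg hκ _) (numGenes_nonneg S x)

theorem le_lyapunov {κ : ℝ} (hκ : 1 ≤ κ) (x : Population N) :
    numGenes Finset.univ x ≤ lyapunov κ x := by
  refine (le_mul_of_one_le_left (numGenes_nonneg _ x) (one_le_pow₀ hκ)).trans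
    (Finset.single_le_sum (f := fun S : Finset (Fin N) => κ ^ S.card * numGenes S x)
      (fun S _ => mul_nonneg (pow_nonneg (zero_le_one.trans hκ) _) (numGenes_nonneg S x))
      (Finset.mem_univ Finset.univ))

theorem lyapunov_le {κ : ℝ} (hκ : 0 ≤ κ) (x : Population N) :
    lyapunov κ x ≤ (∑ S : Finset (Fin N), κ ^ S.card) * numGenes Finset.univ x := by
  rw [lyapunov, Finset.sum_mul]
  exact Finset.sum_le_sum fun S _ => mul_le_mul_of_nonneg_left
    (numGenes_mono (Finset.subset_univ S) x) (pow_nonneg hκ _)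

theorem lyapunov_gain_fresh_le {κ : ℝ} (hκ : 0 ≤ κ) (x : Population N) (j : Fin N) {u : I}
    (hu : ∀ k, u ∉ (x k).genes) : lyapunov κ (Function.update x j ((x j).gain u)) ≤
      lyapunov κ x + ∑ S : Finset (Fin N), κ ^ S.card := by
  simp only [lyapunov, numGenes_gain_fresh _ x j hu, ← Finset.sum_add_distrib]
  refine Finset.sum_le_sum fun S _ => ?_
  have := pow_nonneg hκ S.card
  split_ifs <;> nlinarith

theorem gainInvariant_lyapunov (κ : ℝ) : GainInvariant (lyapunov κ : Population N → ℝ) :=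
  fun x i u v hu hv => by simp only [lyapunov, gainInvariant_numGenes _ x i u v hu hv]

theorem measurable_lyapunov (κ : ℝ) : Measurable (lyapunov κ : Population N → ℝ) :=
  Finset.measurable_sum _ fun S _ => (measurable_numGenes S).const_mul _

theorem exists_lyapunov (hρ : 0 < ρ) (γ : ℝ) : ∃ κ : ℝ, 1 ≤ κ ∧ γ + 2 ≤ κ * ρ := by
  refine ⟨max 1 ((γ + 2) / ρ), le_max_left _ _, ?_⟩
  rw [← div_le_iff₀ hρ]
  exact le_max_right _ _

theorem gen_lyapunov_le (hN : 1 ≤ N) (hθ : 0 ≤ θ) (hγ : 0 ≤ γ) {κ : ℝ} (hκ1 : 1 ≤ κ)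
    (hκ : γ + 2 ≤ κ * ρ) (x : Population N) :
    gen ρ θ γ (lyapunov κ) x ≤
      N * (θ / 2 * ∑ S : Finset (Fin N), κ ^ S.card) - numGenes Finset.univ x := by
  have h1 := genNoGain_lyapunov_le (ρ := ρ) hN hγ hκ1 hκ x
  have h2 : ∑ i : Fin N, θ / 2 * (lyapunov κ (Function.update x i ((x i).gain (fresh x))) -
      lyapunov κ x) ≤ ∑ _i : Fin N, θ / 2 * ∑ S : Finset (Fin N), κ ^ S.card :=
    Finset.sum_le_sum fun i _ => mul_le_mul_of_nonneg_left
      (by linarith [lyapunov_gain_fresh_le (zero_le_one.trans hκ1) x i (fresh_notMem x)])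
      (by positivity)
  rw [Finset.sum_const, Finset.card_univ, Fintype.card_fin, nsmul_eq_mul] at h2
  rw [gen]
  linarith

/-- The drift condition that bounds the third moment of the total number of genes. -/
theorem exists_gen_lyapunov_mul_sq_le (hN : 1 ≤ N) (hρ : 0 ≤ ρ) (hθ : 0 ≤ θ) (hγ : 0 ≤ γ) {κ : ℝ}
    (hκ1 : 1 ≤ κ) (hκ : γ + 2 ≤ κ * ρ) : ∃ a : ℝ, ∀ x : Population N,
    gen ρ θ γ (fun y => lyapunov κ y * numGenes Finset.univ y ^ 2) x ≤
      a - 1 / 2 * numGenes Finset.univ x ^ 3 := by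
  have hκ0 := zero_le_one.trans hκ1
  set K := ∑ S : Finset (Fin N), κ ^ S.card with hK
  have hK0 : 0 ≤ K := Finset.sum_nonneg fun S _ => pow_nonneg hκ0 _
  -- With `L` the Lyapunov function, a gain raises `L * M ^ 2` by at most `K * (M + 1) ^ 2 + L * (2
  -- * M + 1)`; since `L ≤ K * M`, this is at most `5 * K * (1 + M ^ 2)`.
  set c := N * (θ / 2 * (5 * K)) with hc
  have hc0 : 0 ≤ c := by positivity
  refine ⟨c + 4 * c ^ 3, fun x => ?_⟩
  set M := numGenes Finset.univ x with hM
  have hM0 : 0 ≤ M := numGenes_nonneg _ x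
  have h1 : genNoGain ρ γ (fun y => lyapunov κ y * numGenes Finset.univ y ^ 2) x ≤
      M ^ 2 * genNoGain ρ γ (lyapunov κ) x := by
    refine genNoGain_mul_le (g := fun y => numGenes Finset.univ y ^ 2) hρ hγ
      (lyapunov_nonneg hκ0) x (fun i j => ?_) (fun i u hu => ?_) (fun i j u hu => ?_)
    · exact pow_le_pow_left₀ (numGenes_nonneg _ _) (numGenes_univ_resample_le x i j) 2
    · exact pow_le_pow_left₀ (numGenes_nonneg _ _) (numGenes_lose_le _ x i hu) 2
    · exact (congrArg (· ^ 2) (numGenes_univ_transfer x i j hu)).le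
  have h2 : M ^ 2 * genNoGain ρ γ (lyapunov κ) x ≤ M ^ 2 * (-M) :=
    mul_le_mul_of_nonneg_left (genNoGain_lyapunov_le hN hγ hκ1 hκ x) (by positivity)
  have h3 : ∑ i : Fin N, θ / 2 * (lyapunov κ (Function.update x i ((x i).gain (fresh x))) *
      numGenes Finset.univ (Function.update x i ((x i).gain (fresh x))) ^ 2 -
      lyapunov κ x * M ^ 2) ≤ ∑ _i : Fin N, θ / 2 * (5 * K * (1 + M ^ 2)) := by
    refine Finset.sum_le_sum fun i _ => mul_le_mul_of_nonneg_left ?_ (by positivity)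
    rw [numGenes_gain_fresh _ x i (fresh_notMem x), if_pos (Finset.mem_univ i), ← hM]
    have hg := lyapunov_gain_fresh_le hκ0 x i (fresh_notMem x)
    have hl := lyapunov_le hκ0 x
    rw [← hK] at hg hl
    rw [← hM] at hl
    have e1 := mul_le_mul_of_nonneg_right hg (sq_nonneg (M + 1))
    have e2 : lyapunov κ x * (2 * M + 1) ≤ K * M * (2 * M + 1) :=
      mul_le_mul_of_nonneg_right hl (by positivity)
    have e3 : 0 ≤ K * (M - 1) ^ 2 := by positivity
    nlinarith
  rw [Finset.sum_const, Finset.card_univ, Fintype.card_fin, nsmul_eq_mul] at h3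
  -- For `M ≥ 2 * c` the cubic term absorbs the quadratic one; below that threshold the quadratic
  -- term is at most `4 * c ^ 3`.
  have h4 : c * M ^ 2 ≤ 1 / 2 * M ^ 3 + 4 * c ^ 3 := by
    rcases le_total M (2 * c) with h | h
    · have : M ^ 2 ≤ (2 * c) ^ 2 := pow_le_pow_left₀ hM0 h 2
      have := mul_le_mul_of_nonneg_left this hc0
      have : 0 ≤ M ^ 3 := by positivity
      nlinarith
    · have := mul_le_mul_of_nonneg_right h (sq_nonneg M)
      have : 0 ≤ c ^ 3 := by positivity
      nlinarith
  have h5 : N * (θ / 2 * (5 * K * (1 + M ^ 2))) = c + c * M ^ 2 := by rw [hc]; ring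
  rw [gen]
  simp only [← hM]
  nlinarith

/-- A drift condition bounds moments of equilibria. -/
theorem IsEquilibrium.lintegral_le_of_drift (hρ : 0 ≤ ρ) (hθ : 0 ≤ θ) (hγ : 0 ≤ γ)
    {π : Measure (Population N)} (h : IsEquilibrium ρ θ γ π) {W W' : Population N → ℝ}
    (hWm : Measurable W) (hWi : GainInvariant W) (hW0 : ∀ x, 0 ≤ W x)
    (hW'0 : ∀ x, 0 ≤ W' x) {a : ℝ} (ha : 0 ≤ a)
    (hdrift : ∀ x, gen ρ θ γ W x ≤ a - W' x)
    (hbdd : ∀ C, ∃ K, ∀ x, W x < C → totalRate ρ θ γ x ≤ K) :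
    ∫⁻ x, ENNReal.ofReal (W' x) ∂π ≤ ENNReal.ofReal a := by
  have := h.prob
  have hCstep : ∀ C : ℕ, ∫⁻ x in {x | W x < C}, ENNReal.ofReal (W' x) ∂π ≤ ENNReal.ofReal a := by
    intro C
    have hset : MeasurableSet {x | W x < C} := measurableSet_lt hWm measurable_const
    -- Only an inequality between flows is available so far, and only for nonnegative functions. The
    -- truncation from above turns the upper bound on the drift of `W` into a lower bound on that of
    -- `f`, the direction required. It is supported where the rate is bounded, so `totalRate * f` is
    -- integrable and can be cancelled.
    set f : Population N → ℝ := fun x => max (C - W x) 0 with hf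
    have hf0 : ∀ x, 0 ≤ f x := fun x => le_max_right _ _
    have hfm : Measurable f := (measurable_const.sub hWm).max measurable_const
    have hfi : GainInvariant f := fun x i u v hu hv => by
      simp only [hf, hWi x i u v hu hv]
    have hrm : Measurable fun x : Population N => ENNReal.ofReal (totalRate ρ θ γ x) :=
      (measurable_totalRate ρ θ γ).ennreal_ofReal
    have h1 : ∫⁻ x, ENNReal.ofReal (gen ρ θ γ f x + totalRate ρ θ γ x * f x) ∂π ≤
        ∫⁻ x, ENNReal.ofReal (totalRate ρ θ γ x * f x) ∂π := by
      have := lintegral_mono' h.bind_rateKernel_le (le_refl fun x => ENNReal.ofReal (f x))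
      rw [Measure.lintegral_bind (Kernel.aemeasurable _) hfm.ennreal_ofReal.aemeasurable,
        lintegral_withDensity_eq_lintegral_mul _ hrm hfm.ennreal_ofReal] at this
      simp only [lintegral_rateKernel _ _ _ _ hfm.ennreal_ofReal, jump_ofReal hρ hθ hγ hf0 hfi,
        Pi.mul_apply, ← ENNReal.ofReal_mul (totalRate_nonneg ρ θ γ _)] at this
      exact this
    obtain ⟨K, hK⟩ := hbdd C
    have hfin : ∫⁻ x, ENNReal.ofReal (totalRate ρ θ γ x * f x) ∂π ≠ ∞ := by
      have hle : ∀ x, ENNReal.ofReal (totalRate ρ θ γ x * f x) ≤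
          ENNReal.ofReal (max K 0 * C) := by
        intro x
        refine ENNReal.ofReal_le_ofReal ?_
        have hC0 : (0 : ℝ) ≤ C := Nat.cast_nonneg C
        by_cases hx : W x < C
        · exact mul_le_mul ((hK x hx).trans (le_max_left _ _))
            (max_le (by linarith [hW0 x]) hC0) (hf0 x) (le_max_right _ _)
        · have : f x = 0 := max_eq_right (by linarith)
          rw [this, mul_zero]
          exact mul_nonneg (le_max_right _ _) hC0
      refine ne_top_of_le_ne_top ?_ (lintegral_mono hle)
      rw [lintegral_const, measure_univ, mul_one]
      exact ENNReal.ofReal_ne_top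
    have hpt : ∀ x, ENNReal.ofReal (totalRate ρ θ γ x * f x) +
        {x | W x < C}.indicator (fun x => ENNReal.ofReal (W' x)) x ≤
        ENNReal.ofReal (gen ρ θ γ f x + totalRate ρ θ γ x * f x) + ENNReal.ofReal a := by
      intro x
      have hJ := gen_add_nonneg hρ hθ hγ hf0 x
      by_cases hx : W x < C
      · rw [Set.indicator_of_mem (by exact hx), ← ENNReal.ofReal_add
          (mul_nonneg (totalRate_nonneg ρ θ γ x) (hf0 x)) (hW'0 x), ← ENNReal.ofReal_add hJ ha]
        refine ENNReal.ofReal_le_ofReal ?_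
        have hfx : f x = C - W x := max_eq_left (by linarith)
        have hle : ∀ y, -(W y - W x) ≤ f y - f x := fun y => by
          have : C - W y ≤ f y := le_max_left _ _
          linarith
        have hgen : -gen ρ θ γ W x ≤ gen ρ θ γ f x := by
          have hγN : 0 ≤ γ / (2 * N) := by positivity
          simp only [gen, genNoGain, neg_add, ← Finset.sum_neg_distrib, ← mul_neg]
          gcongr <;> exact hle _
        linarith [hdrift x]
      · rw [Set.indicator_of_notMem (by exact hx), add_zero]
        have hfx : f x = 0 := max_eq_right (by linarith)
        rw [hfx, mul_zero, ENNReal.ofReal_zero]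
        exact zero_le
    have hint := lintegral_mono hpt (μ := π)
    rw [lintegral_add_left, lintegral_indicator hset, lintegral_add_right _ measurable_const] at hint
    · have h2 := hint.trans (add_le_add_left h1 _)
      have h3 := (ENNReal.add_le_add_iff_left hfin).1 h2
      simpa using h3
    · exact ((measurable_totalRate ρ θ γ).mul hfm).ennreal_ofReal
  have hmono : Monotone fun C : ℕ => {x | W x < C} := fun m n hmn x (hx : W x < m) =>
    lt_of_lt_of_le hx (by exact_mod_cast hmn)
  have hU : ⋃ C : ℕ, {x | W x < C} = Set.univ :=
    Set.eq_univ_of_forall fun x => Set.mem_iUnion.2 (exists_nat_gt (W x))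
  have hsup : ∫⁻ x, ENNReal.ofReal (W' x) ∂π =
      ⨆ C : ℕ, ∫⁻ x in {x | W x < C}, ENNReal.ofReal (W' x) ∂π := by
    rw [← setLIntegral_univ, ← hU, setLIntegral_iUnion_of_directed _ hmono.directed_le]
  rw [hsup]
  exact iSup_le hCstep

end Moran

/-! ### Existence of an equilibrium. -/

/-- Excursions from an atom: a Markov kernel with a drift towards an atom has a finite invariant
measure. -/
theorem exists_invariant_of_drift {E : Type*} [MeasurableSpace E] (K : Kernel E E)
    [IsMarkovKernel K] (e : E) {D : Set E} (hD : MeasurableSet D) (he : ∀ x, x ∉ D ↔ x = e)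
    {w : E → ℝ≥0∞} (hw : Measurable w) (hdrift : ∀ x ∈ D, ∫⁻ y, w y ∂K x + 1 ≤ w x)
    (hfin : ∫⁻ y, w y ∂K e ≠ ∞) :
    ∃ ν : Measure E, ν Set.univ ≠ ∞ ∧ ν ≠ 0 ∧ ν.bind K = ν := by
  have heD : e ∉ D := (he e).2 rfl
  -- `ν n` is the law of the chain after `n` steps on the event that it has not returned to `e`; the
  -- sum over `n` is the occupation measure of one excursion.
  let ν : ℕ → Measure E := fun n => n.rec (Measure.dirac e) fun _ μ => (μ.bind K).restrict D
  have hν0 : ν 0 = Measure.dirac e := rfl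
  have hνs : ∀ n, ν (n + 1) = ((ν n).bind K).restrict D := fun n => rfl
  have hνD : ∀ n, (ν (n + 1)).restrict D = ν (n + 1) := fun n => by
    rw [hνs, Measure.restrict_restrict hD, Set.inter_self]
  have hKw : Measurable fun x => ∫⁻ y, w y ∂K x := hw.lintegral_kernel
  have hstep : ∀ n, ∫⁻ x, w x ∂ν (n + 2) + ν (n + 1) Set.univ ≤ ∫⁻ x, w x ∂ν (n + 1) := by
    intro n
    have h1 : ∫⁻ x, w x ∂ν (n + 2) ≤ ∫⁻ x, ∫⁻ y, w y ∂K x ∂ν (n + 1) := by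
      rw [hνs (n + 1), ← Measure.lintegral_bind (Kernel.aemeasurable _) hw.aemeasurable]
      exact lintegral_mono' Measure.restrict_le_self le_rfl
    calc ∫⁻ x, w x ∂ν (n + 2) + ν (n + 1) Set.univ
        ≤ ∫⁻ x, ∫⁻ y, w y ∂K x ∂ν (n + 1) + ∫⁻ _, 1 ∂ν (n + 1) := by
          rw [lintegral_one]; exact add_le_add_left h1 _
      _ = ∫⁻ x, (∫⁻ y, w y ∂K x + 1) ∂ν (n + 1) := (lintegral_add_left hKw _).symm
      _ ≤ ∫⁻ x, w x ∂ν (n + 1) := by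
          rw [← hνD n]
          exact setLIntegral_mono' hD hdrift
  -- Each step inside `D` costs one unit of `w`, so the expected excursion length telescopes against
  -- the mean of `w` after the first step.
  have hsum : ∀ n, ∑ k ∈ Finset.range n, ν (k + 1) Set.univ + ∫⁻ x, w x ∂ν (n + 1) ≤
      ∫⁻ x, w x ∂ν 1 := by
    intro n
    induction n with
    | zero => simp
    | succ n ih =>
      refine le_trans ?_ ih
      rw [Finset.sum_range_succ, add_assoc]
      refine add_le_add_right ?_ _
      rw [add_comm]
      exact hstep n
  have hν1 : ∫⁻ x, w x ∂ν 1 ≤ ∫⁻ y, w y ∂K e := by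
    rw [show ν 1 = ((ν 0).bind K).restrict D from rfl, hν0, Measure.dirac_bind K.measurable]
    exact lintegral_mono' Measure.restrict_le_self le_rfl
  have htsum : ∑' n, ν n Set.univ ≠ ∞ := by
    rw [tsum_eq_zero_add' ENNReal.summable]
    refine ENNReal.add_ne_top.2 ⟨by simp [hν0], ?_⟩
    refine ne_top_of_le_ne_top hfin (le_trans ?_ hν1)
    rw [ENNReal.tsum_eq_iSup_nat]
    exact iSup_le fun n => le_self_add.trans (hsum n)
  have huniv : Measure.sum ν Set.univ ≠ ∞ := by rwa [Measure.sum_apply _ MeasurableSet.univ]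
  have hbindsum : ∀ B, MeasurableSet B →
      (Measure.sum ν).bind K B = ∑' n, (ν n).bind K B := fun B hB => by
    rw [Measure.bind_apply hB (Kernel.aemeasurable _), lintegral_sum_measure]
    exact tsum_congr fun n => (Measure.bind_apply hB (Kernel.aemeasurable _)).symm
  have hbuniv : (Measure.sum ν).bind K Set.univ = Measure.sum ν Set.univ := by
    rw [Measure.bind_apply MeasurableSet.univ (Kernel.aemeasurable _)]
    simp
  have hDeq : ∀ B, MeasurableSet B →
      (Measure.sum ν).bind K (B ∩ D) = Measure.sum ν (B ∩ D) := fun B hB => by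
    rw [hbindsum _ (hB.inter hD), Measure.sum_apply _ (hB.inter hD),
      tsum_eq_zero_add' (f := fun n => ν n (B ∩ D)) ENNReal.summable]
    have h0 : ν 0 (B ∩ D) = 0 := by
      rw [hν0, Measure.dirac_apply' _ (hB.inter hD), Set.indicator_of_notMem]
      exact fun h => heD h.2
    rw [h0, zero_add]
    refine tsum_congr fun n => ?_
    rw [hνs, Measure.restrict_apply (hB.inter hD), Set.inter_assoc, Set.inter_self]
  -- On `D` invariance is a shift of the index. The remaining mass sits at the single state `e`, and
  -- there it follows because a Markov kernel preserves the finite total mass.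
  have hcompl : (Measure.sum ν).bind K Dᶜ = Measure.sum ν Dᶜ := by
    have h1 := hDeq Set.univ MeasurableSet.univ
    rw [Set.univ_inter] at h1
    have h2 := measure_add_measure_compl (μ := (Measure.sum ν).bind K) hD
    have h3 := measure_add_measure_compl (μ := Measure.sum ν) hD
    rw [hbuniv, h1, ← h3] at h2
    refine (ENNReal.add_right_inj ?_).1 h2
    exact ne_top_of_le_ne_top huniv (measure_mono (Set.subset_univ _))
  refine ⟨Measure.sum ν, huniv, fun h0 => ?_, ?_⟩
  · have : Measure.sum ν Set.univ = 0 := by rw [h0]; rfl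
    rw [Measure.sum_apply _ MeasurableSet.univ, ENNReal.tsum_eq_zero] at this
    simpa [hν0] using this 0
  · ext B hB
    rw [← measure_inter_add_sdiff (μ := (Measure.sum ν).bind K) B hD,
      ← measure_inter_add_sdiff (μ := Measure.sum ν) B hD, hDeq B hB]
    congr 1
    by_cases heB : e ∈ B
    · have : B \ D = Dᶜ := by
        ext x
        simp only [Set.mem_sdiff, Set.mem_compl_iff, and_iff_right_iff_imp]
        exact fun hx => (he x).1 hx ▸ heB
      rw [this, hcompl]
    · have : B \ D = ∅ := by
        ext x
        simp only [Set.mem_sdiff, Set.mem_empty_iff_false, iff_false, not_and, not_not]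
        intro hx
        by_contra hxD
        exact heB ((he x).1 hxD ▸ hx)
      rw [this, measure_empty, measure_empty]

namespace Moran

variable {N : ℕ} {ρ θ γ : ℝ}

/-- The kernel of the embedded jump chain. -/
def jumpChain (N : ℕ) (ρ θ γ : ℝ) : Kernel (Population N) (Population N) where
  toFun x := (ENNReal.ofReal (totalRate ρ θ γ x))⁻¹ • rateKernel N ρ θ γ x
  measurable' := by
    refine Measure.measurable_of_measurable_coe _ fun B hB => ?_
    exact ((measurable_totalRate ρ θ γ).ennreal_ofReal.inv).mul
      ((rateKernel N ρ θ γ).measurable_coe hB)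

theorem jumpChain_apply (x : Population N) : jumpChain N ρ θ γ x =
    (ENNReal.ofReal (totalRate ρ θ γ x))⁻¹ • rateKernel N ρ θ γ x := rfl

theorem lintegral_jumpChain (x : Population N) {f : Population N → ℝ≥0∞} (hf : Measurable f) :
    ∫⁻ y, f y ∂jumpChain N ρ θ γ x =
      (ENNReal.ofReal (totalRate ρ θ γ x))⁻¹ * jump ρ θ γ f x := by
  rw [jumpChain_apply, lintegral_smul_measure, lintegral_rateKernel _ _ _ _ hf, smul_eq_mul]

theorem isMarkovKernel_jumpChain (h : ∀ x : Population N, 0 < totalRate ρ θ γ x) :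
    IsMarkovKernel (jumpChain N ρ θ γ) := ⟨fun x => ⟨by
  rw [jumpChain_apply, Measure.smul_apply, rateKernel_univ, smul_eq_mul]
  exact ENNReal.inv_mul_cancel (by simpa using h x) ENNReal.ofReal_ne_top⟩⟩

/-- An equilibrium exists if there is a drift towards an atom. -/
theorem exists_isEquilibrium_of_drift (hρ : 0 ≤ ρ) (hθ : 0 ≤ θ) (hγ : 0 ≤ γ) {r₀ : ℝ}
    (hr₀ : 0 < r₀) (hr : ∀ x : Population N, r₀ ≤ totalRate ρ θ γ x) (e : Population N)
    {D : Set (Population N)} (hD : MeasurableSet D) (he : ∀ x, x ∉ D ↔ x = e)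
    {W : Population N → ℝ} (hWm : Measurable W) (hWi : GainInvariant W) (hW0 : ∀ x, 0 ≤ W x)
    (hdrift : ∀ x ∈ D, gen ρ θ γ W x ≤ -totalRate ρ θ γ x) :
    ∃ π : Measure (Population N), IsEquilibrium ρ θ γ π := by
  have hpos : ∀ x : Population N, 0 < totalRate ρ θ γ x := fun x => hr₀.trans_le (hr x)
  have := isMarkovKernel_jumpChain hpos
  have hr0 : ∀ x : Population N, ENNReal.ofReal (totalRate ρ θ γ x) ≠ 0 := fun x => by
    simpa using hpos x
  have hrm : Measurable fun x : Population N => ENNReal.ofReal (totalRate ρ θ γ x) :=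
    (measurable_totalRate ρ θ γ).ennreal_ofReal
  have hinv : ∀ x : Population N, (ENNReal.ofReal (totalRate ρ θ γ x))⁻¹ *
      ENNReal.ofReal (totalRate ρ θ γ x) = 1 := fun x =>
    ENNReal.inv_mul_cancel (hr0 x) ENNReal.ofReal_ne_top
  obtain ⟨ν, hfin, hne, hν⟩ := exists_invariant_of_drift (jumpChain N ρ θ γ) e hD he
    (w := fun x => ENNReal.ofReal (W x)) hWm.ennreal_ofReal (fun x hx => by
      rw [lintegral_jumpChain x hWm.ennreal_ofReal, jump_ofReal hρ hθ hγ hW0 hWi,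
        ← hinv x, ← mul_add, ← ENNReal.ofReal_add (gen_add_nonneg hρ hθ hγ hW0 x)
          (totalRate_nonneg ρ θ γ x)]
      calc _ ≤ (ENNReal.ofReal (totalRate ρ θ γ x))⁻¹ *
            ENNReal.ofReal (totalRate ρ θ γ x * W x) := by
            gcongr
            linarith [hdrift x hx]
        _ = ENNReal.ofReal (W x) := by
            rw [ENNReal.ofReal_mul (totalRate_nonneg ρ θ γ x), ← mul_assoc, hinv, one_mul])
    (by
      rw [lintegral_jumpChain e hWm.ennreal_ofReal, jump_ofReal hρ hθ hγ hW0 hWi]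
      exact ENNReal.mul_ne_top (ENNReal.inv_ne_top.2 (hr0 e)) ENNReal.ofReal_ne_top)
  -- Weighting each state by its mean holding time `1 / totalRate` converts invariance for the jump
  -- chain into balance of flows. The lower bound on the rates keeps the mass finite, and the mean
  -- rate under `μ` is the mass of `ν`.
  set μ := ν.withDensity fun x => (ENNReal.ofReal (totalRate ρ θ γ x))⁻¹ with hμ
  have hμint : ∀ f : Population N → ℝ≥0∞, Measurable f → ∫⁻ x, f x ∂μ =
      ∫⁻ x, (ENNReal.ofReal (totalRate ρ θ γ x))⁻¹ * f x ∂ν := fun f hf => by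
    exact lintegral_withDensity_eq_lintegral_mul _ hrm.inv hf
  have hμr : ∀ f : Population N → ℝ≥0∞, Measurable f →
      ∫⁻ x, ENNReal.ofReal (totalRate ρ θ γ x) * f x ∂μ = ∫⁻ x, f x ∂ν := fun f hf => by
    refine (hμint _ (hrm.mul hf)).trans ?_
    exact lintegral_congr fun x => by rw [Pi.mul_apply, ← mul_assoc, hinv, one_mul]
  have hbal : ∀ f : Population N → ℝ≥0∞, Measurable f →
      ∫⁻ x, jump ρ θ γ f x ∂μ = ∫⁻ x, ENNReal.ofReal (totalRate ρ θ γ x) * f x ∂μ := by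
    intro f hf
    rw [hμr f hf, hμint _ (measurable_jump ρ θ γ hf)]
    conv_rhs => rw [← hν]
    rw [Measure.lintegral_bind (Kernel.aemeasurable _) hf.aemeasurable]
    exact lintegral_congr fun x => (lintegral_jumpChain x hf).symm
  have hμu : μ Set.univ ≠ ∞ := by
    rw [← lintegral_one, hμint _ measurable_const]
    refine ne_top_of_le_ne_top (b := ∫⁻ _, (ENNReal.ofReal r₀)⁻¹ ∂ν) ?_ (lintegral_mono fun x => ?_)
    · rw [lintegral_const]
      exact ENNReal.mul_ne_top (ENNReal.inv_ne_top.2 (by simpa using hr₀)) hfin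
    · rw [mul_one]
      exact ENNReal.inv_le_inv.2 (ENNReal.ofReal_le_ofReal (hr x))
  have hμ0 : μ Set.univ ≠ 0 := fun h0 => by
    have h1 : μ = 0 := Measure.measure_univ_eq_zero.1 h0
    have h2 := hμr (fun _ => 1) measurable_const
    rw [h1, lintegral_zero_measure, lintegral_one] at h2
    exact hne (Measure.measure_univ_eq_zero.1 h2.symm)
  have hprob : IsProbabilityMeasure ((μ Set.univ)⁻¹ • μ) := ⟨by
    rw [Measure.smul_apply, smul_eq_mul, ENNReal.inv_mul_cancel hμ0 hμu]⟩
  refine ⟨(μ Set.univ)⁻¹ • μ, isEquilibrium_of_balance ?_ fun f hf => ?_⟩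
  · rw [lintegral_smul_measure, smul_eq_mul]
    refine ENNReal.mul_ne_top (ENNReal.inv_ne_top.2 hμ0) ?_
    have h2 := hμr (fun _ => 1) measurable_const
    simp only [mul_one, lintegral_one] at h2
    rwa [h2]
  · rw [lintegral_smul_measure, lintegral_smul_measure, hbal f hf]

/-- The total number of genes in the population, counted with multiplicity. -/
def totalGenes (x : Population N) : ℕ := ∑ k, (x k).genes.card

theorem totalGenes_cast (x : Population N) :
    (totalGenes x : ℝ) = ∑ k, ((x k).genes.card : ℝ) := Nat.cast_sum _ _

theorem measurable_totalGenes : Measurable fun x : Population N => (totalGenes x : ℝ) := by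
  simp only [totalGenes_cast, card_genes_eq]
  exact Finset.measurable_sum _ fun i _ => measurable_numGenes _

theorem totalGenes_eq_zero_iff (x : Population N) : totalGenes x = 0 ↔ x = fun _ => ⟨∅⟩ := by
  rw [totalGenes, Finset.sum_eq_zero_iff]
  constructor
  · intro h
    ext1 i
    exact Genome.ext (Finset.card_eq_zero.1 (h i (Finset.mem_univ i)))
  · rintro rfl i _
    rfl

theorem totalGenes_lose (x : Population N) (i : Fin N) {u : I} (hu : u ∈ (x i).genes) :
    totalGenes (Function.update x i ((x i).lose u)) + 1 = totalGenes x := by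
  rw [totalGenes, totalGenes, ← Finset.add_sum_erase _ _ (Finset.mem_univ i),
    ← Finset.add_sum_erase (a := i) _ (fun k => (x k).genes.card) (Finset.mem_univ i)]
  have h1 : ∑ k ∈ Finset.univ.erase i, (Function.update x i ((x i).lose u) k).genes.card =
      ∑ k ∈ Finset.univ.erase i, (x k).genes.card :=
    Finset.sum_congr rfl fun k hk => by rw [Function.update_of_ne (Finset.ne_of_mem_erase hk)]
  have h2 : ((x i).lose u).genes.card + 1 = (x i).genes.card := Finset.card_erase_add_one hu
  rw [h1, Function.update_self]
  omega

theorem totalGenes_gain_fresh (x : Population N) (i : Fin N) {u : I}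
    (hu : ∀ k, u ∉ (x k).genes) :
    totalGenes (Function.update x i ((x i).gain u)) = totalGenes x + 1 := by
  rw [totalGenes, totalGenes, ← Finset.add_sum_erase _ _ (Finset.mem_univ i),
    ← Finset.add_sum_erase (a := i) _ (fun k => (x k).genes.card) (Finset.mem_univ i)]
  have h1 : ∑ k ∈ Finset.univ.erase i, (Function.update x i ((x i).gain u) k).genes.card =
      ∑ k ∈ Finset.univ.erase i, (x k).genes.card :=
    Finset.sum_congr rfl fun k hk => by rw [Function.update_of_ne (Finset.ne_of_mem_erase hk)]
  have h2 : ((x i).gain u).genes.card = (x i).genes.card + 1 :=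
    Finset.card_insert_of_notMem (hu i)
  rw [h1, Function.update_self]
  omega

/-- A bounded function that has a negative drift in all states but the empty one. -/
theorem gen_one_sub_pow_le (hρ : 0 ≤ ρ) (hθ : 0 ≤ θ) (hγ : 0 ≤ γ) {p : ℝ} (hp : 0 ≤ p)
    (x : Population N) :
    gen ρ θ γ (fun y => 1 - p ^ totalGenes y) x ≤
      totalRate ρ θ γ x * p ^ totalGenes x -
        ρ / 2 * (totalGenes x : ℝ) * p ^ (totalGenes x - 1) := by
  have hγN : 0 ≤ γ / (2 * N) := by positivity
  have e : gen ρ θ γ (fun y => 1 - p ^ totalGenes y) x =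
      totalRate ρ θ γ x * p ^ totalGenes x -
        realJump ρ θ γ (fun y => p ^ totalGenes y) x := by
    rw [gen_eq_realJump, totalRate_eq_realJump hρ hθ hγ]
    have : realJump ρ θ γ (fun y => 1 - p ^ totalGenes y) x =
        realJump ρ θ γ (fun _ => 1) x - realJump ρ θ γ (fun y => p ^ totalGenes y) x := by
      simp only [realJump, mul_sub, Finset.sum_sub_distrib]
      ring
    rw [this]
    ring
  rw [e]
  refine sub_le_sub_left ?_ _
  have hloss : ∑ i : Fin N, ∑ u ∈ (x i).genes,
      ρ / 2 * p ^ totalGenes (Function.update x i ((x i).lose u)) =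
      ρ / 2 * (totalGenes x : ℝ) * p ^ (totalGenes x - 1) := by
    have : ∀ i : Fin N, ∑ u ∈ (x i).genes,
        ρ / 2 * p ^ totalGenes (Function.update x i ((x i).lose u)) =
        (x i).genes.card * (ρ / 2 * p ^ (totalGenes x - 1)) := fun i => by
      rw [Finset.sum_congr rfl (g := fun _ => ρ / 2 * p ^ (totalGenes x - 1)),
        Finset.sum_const, nsmul_eq_mul]
      intro u hu
      rw [← totalGenes_lose x i hu, Nat.add_sub_cancel]
    rw [Finset.sum_congr rfl fun i _ => this i, ← Finset.sum_mul]
    rw [← totalGenes_cast]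
    ring
  -- The other three kinds of events contribute nonnegatively to the mean of `p ^ totalGenes` and
  -- are dropped.
  rw [← hloss, realJump]
  have h1 : 0 ≤ ∑ i : Fin N, ∑ j : Fin N with j ≠ i,
      1 / 2 * p ^ totalGenes (Function.update x j (x i)) := by positivity
  have h2 : 0 ≤ ∑ i : Fin N,
      θ / 2 * p ^ totalGenes (Function.update x i ((x i).gain (fresh x))) := by positivity
  have h3 : 0 ≤ ∑ i : Fin N, ∑ j : Fin N with j ≠ i, ∑ u ∈ (x i).genes,
      γ / (2 * N) * p ^ totalGenes (Function.update x j ((x j).gain u)) := by positivity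
  linarith

theorem gen_add_mul (c d : ℝ) (f g : Population N → ℝ) (x : Population N) :
    gen ρ θ γ (fun y => c * f y + d * g y) x = c * gen ρ θ γ f x + d * gen ρ θ γ g x := by
  rw [gen, gen, gen, genNoGain_add, genNoGain_const_mul, genNoGain_const_mul]
  have : ∑ i, θ / 2 * (c * f (Function.update x i ((x i).gain (fresh x))) +
      d * g (Function.update x i ((x i).gain (fresh x))) - (c * f x + d * g x)) =
      c * ∑ i, θ / 2 * (f (Function.update x i ((x i).gain (fresh x))) - f x) +
      d * ∑ i, θ / 2 * (g (Function.update x i ((x i).gain (fresh x))) - g x) := by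
    rw [Finset.mul_sum, Finset.mul_sum, ← Finset.sum_add_distrib]
    exact Finset.sum_congr rfl fun i _ => by ring
  rw [this]
  ring

/-- With `z ≥ 1` genes the total rate is at most `b * z`, so its contribution is at most `z * p ^ (z
- 1) * (p * b)`, while losses contribute `-ρ / 2 * z * p ^ (z - 1)`. Choosing `p * b ≤ ρ / 4` leaves
half of the loss term. -/
theorem exists_gen_one_sub_pow_le (hρ : 0 < ρ) (hθ : 0 < θ) (hγ : 0 ≤ γ) (hN : 1 ≤ N) :
    ∃ p : ℝ, 0 < p ∧ p ≤ 1 ∧ ∀ x : Population N, 1 ≤ totalGenes x →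
      gen ρ θ γ (fun y => 1 - p ^ totalGenes y) x ≤ -(ρ / 4) * p ^ totalGenes x := by
  have hN' : (0 : ℝ) < N := by exact_mod_cast hN
  set b : ℝ := N * (N - 1 : ℕ) / 2 + N * (θ / 2) + (ρ / 2 + γ / (2 * N) * (N - 1 : ℕ)) with hb
  have hb0 : 0 < b := by positivity
  have hrb : ∀ x : Population N, 1 ≤ totalGenes x →
      totalRate ρ θ γ x ≤ b * totalGenes x := fun x hx => by
    have hx' : (1 : ℝ) ≤ totalGenes x := by exact_mod_cast hx
    have hc : 0 ≤ N * (N - 1 : ℕ) / 2 + N * (θ / 2) := by positivity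
    rw [totalRate_eq hρ.le hθ.le hγ, ← totalGenes_cast, hb]
    nlinarith
  set p : ℝ := min 1 (ρ / (4 * b)) with hp
  have hp0 : 0 < p := lt_min one_pos (by positivity)
  have hp1 : p ≤ 1 := min_le_left _ _
  have hpb : p * b ≤ ρ / 4 := by
    have : p ≤ ρ / (4 * b) := min_le_right _ _
    calc p * b ≤ ρ / (4 * b) * b := by gcongr
      _ = ρ / 4 := by field_simp
  refine ⟨p, hp0, hp1, fun x hx => ?_⟩
  have h1 := gen_one_sub_pow_le hρ.le hθ.le hγ hp0.le x
  have hx' : (1 : ℝ) ≤ totalGenes x := by exact_mod_cast hx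
  obtain ⟨m, hm⟩ : ∃ m, totalGenes x = m + 1 := ⟨totalGenes x - 1, by omega⟩
  have h2 := mul_le_mul_of_nonneg_right (hrb x hx) (pow_nonneg hp0.le (totalGenes x))
  refine (h1.trans (sub_le_sub_right h2 _)).trans ?_
  rw [hm, Nat.add_sub_cancel, ← hm, hm, pow_succ]
  have hpm := pow_pos hp0 m
  rw [hm] at hx'
  set z : ℝ := ((m + 1 : ℕ) : ℝ)
  have h3 : z * p ^ m * (p * b) ≤ z * p ^ m * (ρ / 4) := by gcongr
  have h4 : ρ / 4 * (p ^ m * p) ≤ ρ / 4 * (z * p ^ m) := by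
    have : p ^ m * p ≤ z * p ^ m := by nlinarith
    gcongr
  nlinarith

theorem le_totalRate (hρ : 0 ≤ ρ) (hθ : 0 ≤ θ) (hγ : 0 ≤ γ) (x : Population N) :
    N * (θ / 2) ≤ totalRate ρ θ γ x := by
  rw [totalRate_eq hρ hθ hγ]
  have h0 : 0 ≤ ∑ i, ((x i).genes.card : ℝ) := Finset.sum_nonneg fun i _ => Nat.cast_nonneg _
  have h1 : 0 ≤ (N : ℝ) * (N - 1 : ℕ) / 2 := by positivity
  have h2 : 0 ≤ ρ / 2 + γ / (2 * N) * (N - 1 : ℕ) := by positivity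
  have h3 := mul_nonneg h2 h0
  linarith

/-- A Lyapunov function whose drift compensates the total rate outside of the empty state. -/
theorem exists_gen_le_neg_totalRate (hρ : 0 < ρ) (hθ : 0 < θ) (hγ : 0 ≤ γ) (hN : 1 ≤ N) :
    ∃ κ α K p : ℝ, 0 ≤ κ ∧ 0 ≤ α ∧ 0 ≤ K ∧ 0 < p ∧ p ≤ 1 ∧
      ∀ x : Population N, 1 ≤ totalGenes x →
        gen ρ θ γ (fun x => α * lyapunov κ x + K * (1 - p ^ totalGenes x)) x ≤
          -totalRate ρ θ γ x := by
  have hN' : (0 : ℝ) < N := by exact_mod_cast hN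
  obtain ⟨κ, hκ1, hκ⟩ := exists_lyapunov hρ γ
  obtain ⟨R, hR0, hR⟩ := exists_totalRate_le hρ.le hθ.le hγ N
  have hκ0 := zero_le_one.trans hκ1
  obtain ⟨a, ha⟩ : ∃ a, a = N * (θ / 2 * ∑ S : Finset (Fin N), κ ^ S.card) := ⟨_, rfl⟩
  have ha0 : 0 ≤ a := by
    have : 0 ≤ ∑ S : Finset (Fin N), κ ^ S.card := Finset.sum_nonneg fun S _ => pow_nonneg hκ0 _
    rw [ha]
    positivity
  obtain ⟨p, hp0, hp1, hHgen⟩ := exists_gen_one_sub_pow_le hρ hθ hγ hN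
  -- The drift of `lyapunov` is at most `a - M`, and the rate is at most `R * (1 + M)`. Taking `R +
  -- 1` copies compensates the rate as soon as `M ≥ m₀`; the bounded function has to help only below
  -- that level.
  obtain ⟨m₀, hm₀⟩ : ∃ m₀, m₀ = (R + 1) * a + R := ⟨_, rfl⟩
  have hm₀0 : 0 ≤ m₀ := by rw [hm₀]; positivity
  -- If `M < m₀`, then at most `N * M < z₀` genes are present with multiplicity, so `p ^ totalGenes`
  -- is at least `p ^ z₀`, and `K` is chosen to make its drift worth `m₀`.
  obtain ⟨z₀, hz₀⟩ := exists_nat_gt (N * m₀)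
  have hpz₀ := pow_pos hp0 z₀
  obtain ⟨K, hK0, hK⟩ : ∃ K, 0 ≤ K ∧ K * (ρ / 4 * p ^ z₀) = m₀ :=
    ⟨m₀ / (ρ / 4 * p ^ z₀), by positivity, div_mul_cancel₀ _ (by positivity)⟩
  refine ⟨κ, R + 1, K, p, hκ0, by positivity, hK0, hp0, hp1, fun x hx1 => ?_⟩
  rw [gen_add_mul]
  have h1 := gen_lyapunov_le (θ := θ) hN hθ.le hγ hκ1 hκ x
  rw [← ha] at h1
  have h2 := mul_le_mul_of_nonneg_left h1 (show 0 ≤ R + 1 by positivity)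
  have h3 := mul_le_mul_of_nonneg_left (hHgen x hx1) hK0
  have h4 := hR x
  have hZle := sum_card_genes_le x
  rw [← totalGenes_cast] at hZle
  have hM0 : 0 ≤ numGenes Finset.univ x := numGenes_nonneg _ x
  generalize numGenes Finset.univ x = M at *
  have hpz := pow_pos hp0 (totalGenes x)
  have h5 : 0 ≤ K * (ρ / 4 * p ^ totalGenes x) := by positivity
  have h6 : m₀ ≤ M + K * (ρ / 4 * p ^ totalGenes x) := by
    by_cases hM : m₀ ≤ M
    · linarith
    · have hzz : totalGenes x ≤ z₀ := by
        have : (totalGenes x : ℝ) < z₀ :=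
          hZle.trans_lt (lt_of_le_of_lt (by gcongr; exact (not_le.1 hM).le) hz₀)
        exact_mod_cast this.le
      have hpp : p ^ z₀ ≤ p ^ totalGenes x := pow_le_pow_of_le_one hp0.le hp1 hzz
      have : K * (ρ / 4 * p ^ z₀) ≤ K * (ρ / 4 * p ^ totalGenes x) := by gcongr
      linarith
  linarith

/-- The Moran model has an equilibrium. -/
theorem exists_isEquilibrium (hρ : 0 < ρ) (hθ : 0 < θ) (hγ : 0 ≤ γ) (hN : 1 ≤ N) :
    ∃ π : Measure (Population N), IsEquilibrium ρ θ γ π := by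
  have hN' : (0 : ℝ) < N := by exact_mod_cast hN
  obtain ⟨κ, α, K, p, hκ0, hα0, hK0, hp0, hp1, hW⟩ := exists_gen_le_neg_totalRate hρ hθ hγ hN
  have hmeas : Measurable fun x : Population N => p ^ totalGenes x := by
    have : Measurable fun x : Population N => p ^ (totalGenes x : ℝ) :=
      measurable_const.pow measurable_totalGenes
    simpa only [Real.rpow_natCast] using this
  -- The atom is the population without genes, the only state outside `D`.
  refine exists_isEquilibrium_of_drift hρ.le hθ.le hγ (r₀ := N * (θ / 2)) (by positivity)
    (fun x => le_totalRate hρ.le hθ.le hγ x) (fun _ => ⟨∅⟩)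
    (D := {x | (1 : ℝ) ≤ totalGenes x})
    (measurableSet_le measurable_const measurable_totalGenes) (fun x => ?_)
    (W := fun x => α * lyapunov κ x + K * (1 - p ^ totalGenes x))
    (((measurable_lyapunov κ).const_mul α).add ((measurable_const.sub hmeas).const_mul K))
    ?_ (fun x => ?_) fun x hx => hW x (by exact_mod_cast hx)
  · rw [← totalGenes_eq_zero_iff]
    simp
  · intro x i u v hu hv
    simp only [gainInvariant_lyapunov κ x i u v hu hv, totalGenes_gain_fresh x i hu,
      totalGenes_gain_fresh x i hv]
  · have h1 : 0 ≤ 1 - p ^ totalGenes x := sub_nonneg.2 (pow_le_one₀ hp0.le hp1)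
    have h2 := lyapunov_nonneg hκ0 x
    positivity

end Moran

/-! ### Moment equations in equilibrium. -/

namespace Moran

variable {N : ℕ} {ρ θ γ : ℝ} {π : Measure (Population N)}

theorem IsEquilibrium.integrable_cube (h : IsEquilibrium ρ θ γ π) (hN : 1 ≤ N) (hρ : 0 < ρ)
    (hθ : 0 ≤ θ) (hγ : 0 ≤ γ) : Integrable (fun x => numGenes Finset.univ x ^ 3) π := by
  obtain ⟨κ, hκ1, hκ⟩ := exists_lyapunov hρ γ
  obtain ⟨R, hR0, hR⟩ := exists_totalRate_le hρ.le hθ hγ N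
  have hκ0 := zero_le_one.trans hκ1
  obtain ⟨a, ha⟩ := exists_gen_lyapunov_mul_sq_le hN hρ.le hθ hγ hκ1 hκ
  have hM0 : ∀ x : Population N, 0 ≤ numGenes Finset.univ x := fun x => numGenes_nonneg _ x
  have hW : ∀ x : Population N, numGenes Finset.univ x ^ 3 ≤
      lyapunov κ x * numGenes Finset.univ x ^ 2 := fun x => by
    have := mul_le_mul_of_nonneg_right (le_lyapunov hκ1 x) (sq_nonneg (numGenes Finset.univ x))
    calc _ = numGenes Finset.univ x * numGenes Finset.univ x ^ 2 := by ring
      _ ≤ _ := this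
  have hM3 : ∀ x : Population N, 0 ≤ numGenes Finset.univ x ^ 3 := fun x => pow_nonneg (hM0 x) 3
  have key := h.lintegral_le_of_drift hρ.le hθ hγ
    (W := fun y => lyapunov κ y * numGenes Finset.univ y ^ 2)
    (W' := fun y => 1 / 2 * numGenes Finset.univ y ^ 3) (a := max a 0)
    ((measurable_lyapunov κ).mul ((measurable_numGenes _).pow_const 2))
    (fun x i u v hu hv => by
      simp only [gainInvariant_lyapunov κ x i u v hu hv,
        gainInvariant_numGenes _ x i u v hu hv])
    (fun x => (hM3 x).trans (hW x)) (fun x => by have := hM3 x; positivity) (le_max_right _ _)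
    (fun x => (ha x).trans (sub_le_sub_right (le_max_left _ _) _))
    (fun C => ⟨R * (1 + max C 1), fun x hx => (hR x).trans ?_⟩)
  · have hm : Measurable fun x : Population N => 1 / 2 * numGenes Finset.univ x ^ 3 :=
      ((measurable_numGenes _).pow_const 3).const_mul _
    have h1 : Integrable (fun x => 1 / 2 * numGenes Finset.univ x ^ 3) π := by
      refine (lintegral_ofReal_ne_top_iff_integrable hm.aestronglyMeasurable
        (ae_of_all _ fun x => ?_)).1 (ne_top_of_le_ne_top ENNReal.ofReal_ne_top key)
      have := hM3 x
      positivity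
    refine (h1.const_mul 2).congr (ae_of_all _ fun x => ?_)
    ring
  -- Where the test function is below `C`, so is the cube of the number of genes, and a number above
  -- `1` is at most its cube; hence the bound by `max C 1`.
  · gcongr
    by_contra hlt
    rw [not_le] at hlt
    have h1 : 1 < numGenes Finset.univ x := (le_max_right _ _).trans_lt hlt
    have h2 : C < numGenes Finset.univ x := (le_max_left _ _).trans_lt hlt
    have h3 : numGenes Finset.univ x ≤ numGenes Finset.univ x ^ 3 :=
      le_self_pow₀ h1.le (by norm_num)
    linarith [hW x]

theorem IsEquilibrium.integrable_of_le (h : IsEquilibrium ρ θ γ π) (hN : 1 ≤ N) (hρ : 0 < ρ)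
    (hθ : 0 ≤ θ) (hγ : 0 ≤ γ) {g : Population N → ℝ} (hg : Measurable g) {K : ℝ}
    (hK : ∀ x, |g x| ≤ K * (1 + numGenes Finset.univ x) ^ 3) : Integrable g π := by
  have := h.prob
  refine Integrable.mono' (g := fun x => (4 * |K|) * (1 + numGenes Finset.univ x ^ 3))
    (((integrable_const 1).add (h.integrable_cube hN hρ hθ hγ)).const_mul _)
    hg.aestronglyMeasurable (ae_of_all _ fun x => ?_)
  rw [Real.norm_eq_abs]
  have hM0 : 0 ≤ numGenes Finset.univ x := numGenes_nonneg _ x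
  refine (hK x).trans ?_
  generalize numGenes Finset.univ x = M at *
  have h1 : (1 + M) ^ 3 ≤ 4 * (1 + M ^ 3) := by
    nlinarith [mul_nonneg (add_nonneg zero_le_one hM0) (sq_nonneg (M - 1))]
  calc K * (1 + M) ^ 3 ≤ |K| * (1 + M) ^ 3 := by gcongr; exact le_abs_self K
    _ ≤ |K| * (4 * (1 + M ^ 3)) := by gcongr
    _ = _ := by ring

theorem IsEquilibrium.integrable_totalRate_mul (h : IsEquilibrium ρ θ γ π) (hN : 1 ≤ N)
    (hρ : 0 < ρ) (hθ : 0 ≤ θ) (hγ : 0 ≤ γ) {g : Population N → ℝ} (hg : Measurable g) {K : ℝ}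
    (hg0 : ∀ x, 0 ≤ g x) (hK : ∀ x, g x ≤ K * (1 + numGenes Finset.univ x) ^ 2) :
    Integrable (fun x => totalRate ρ θ γ x * g x) π := by
  obtain ⟨R, hR0, hR⟩ := exists_totalRate_le hρ.le hθ hγ N
  refine h.integrable_of_le hN hρ hθ hγ (K := R * K) ((measurable_totalRate ρ θ γ).mul hg)
    fun x => ?_
  have hM0 : 0 ≤ numGenes Finset.univ x := numGenes_nonneg _ x
  rw [abs_of_nonneg (mul_nonneg (totalRate_nonneg ρ θ γ x) (hg0 x))]
  calc totalRate ρ θ γ x * g x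
      ≤ (R * (1 + numGenes Finset.univ x)) * (K * (1 + numGenes Finset.univ x) ^ 2) :=
        mul_le_mul (hR x) (hK x) (hg0 x) (by positivity)
    _ = _ := by ring

/-- The rate equation of an equilibrium. -/
theorem IsEquilibrium.lintegral_jump (h : IsEquilibrium ρ θ γ π) (hN : 1 ≤ N)
    (hρ : 0 < ρ) (hθ : 0 ≤ θ) (hγ : 0 ≤ γ) {f : Population N → ℝ≥0∞} (hf : Measurable f) :
    ∫⁻ x, jump ρ θ γ f x ∂π = ∫⁻ x, ENNReal.ofReal (totalRate ρ θ γ x) * f x ∂π := by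
  have hrm : Measurable fun x : Population N => ENNReal.ofReal (totalRate ρ θ γ x) :=
    (measurable_totalRate ρ θ γ).ennreal_ofReal
  have hint := h.integrable_totalRate_mul hN hρ hθ hγ (g := fun _ => 1) (K := 1) measurable_const
    (fun _ => zero_le_one) fun x => by
      have hM0 : 0 ≤ numGenes Finset.univ x := numGenes_nonneg _ x
      nlinarith
  simp only [mul_one] at hint
  have hfin : IsFiniteMeasure (π.withDensity fun x => ENNReal.ofReal (totalRate ρ θ γ x)) :=
    isFiniteMeasure_withDensity_ofReal hint.2
  have hfin' : IsFiniteMeasure (π.bind (rateKernel N ρ θ γ)) :=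
    isFiniteMeasure_of_le _ h.bind_rateKernel_le
  -- The flow into a set is at most the flow out of it, and both measures have as total mass the
  -- mean rate, which is finite; therefore they coincide.
  have heq : π.bind (rateKernel N ρ θ γ) =
      π.withDensity fun x => ENNReal.ofReal (totalRate ρ θ γ x) := by
    refine Measure.eq_of_le_of_measure_univ_eq h.bind_rateKernel_le ?_
    rw [Measure.bind_apply MeasurableSet.univ (Kernel.aemeasurable _),
      withDensity_apply _ MeasurableSet.univ, Measure.restrict_univ]
    simp only [rateKernel_univ]
  calc ∫⁻ x, jump ρ θ γ f x ∂π = ∫⁻ x, ∫⁻ y, f y ∂rateKernel N ρ θ γ x ∂π :=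
        lintegral_congr fun x => (lintegral_rateKernel ρ θ γ x hf).symm
    _ = ∫⁻ y, f y ∂(π.bind (rateKernel N ρ θ γ)) :=
        (Measure.lintegral_bind (Kernel.aemeasurable _) hf.aemeasurable).symm
    _ = _ := by
        rw [heq]
        exact lintegral_withDensity_eq_lintegral_mul _ hrm hf

/-- The rate equation gives equal integrals of `gen g + totalRate * g` and `totalRate * g`. The
quadratic bound on `g` makes both finite by the third moment, so they can be subtracted. -/
theorem IsEquilibrium.integral_gen_eq_zero (h : IsEquilibrium ρ θ γ π) (hN : 1 ≤ N)
    (hρ : 0 < ρ) (hθ : 0 ≤ θ) (hγ : 0 ≤ γ) {g : Population N → ℝ} (hg : Measurable g) {K : ℝ}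
    (hg0 : ∀ x, 0 ≤ g x) (hgi : GainInvariant g)
    (hK : ∀ x, g x ≤ K * (1 + numGenes Finset.univ x) ^ 2) : ∫ x, gen ρ θ γ g x ∂π = 0 := by
  have hint := h.integrable_totalRate_mul hN hρ hθ hγ hg hg0 hK
  have hbal := h.lintegral_jump hN hρ hθ hγ hg.ennreal_ofReal
  have hnn := gen_add_nonneg hρ.le hθ hγ hg0
  have hrg0 : ∀ x, 0 ≤ totalRate ρ θ γ x * g x :=
    fun x => mul_nonneg (totalRate_nonneg ρ θ γ x) (hg0 x)
  have hjm : Measurable fun x => gen ρ θ γ g x + totalRate ρ θ γ x * g x := by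
    refine (congrArg Measurable (funext fun x => ?_)).mp
      (measurable_jump ρ θ γ hg.ennreal_ofReal).ennreal_toReal
    rw [jump_ofReal hρ.le hθ hγ hg0 hgi, ENNReal.toReal_ofReal (hnn x)]
  simp only [jump_ofReal hρ.le hθ hγ hg0 hgi, ← ENNReal.ofReal_mul (totalRate_nonneg ρ θ γ _)]
    at hbal
  have hfin := (lintegral_ofReal_ne_top_iff_integrable hint.aestronglyMeasurable
    (ae_of_all _ hrg0)).2 hint
  have hint2 : Integrable (fun x => gen ρ θ γ g x + totalRate ρ θ γ x * g x) π :=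
    (lintegral_ofReal_ne_top_iff_integrable hjm.aestronglyMeasurable
      (ae_of_all _ hnn)).1 (by rwa [hbal])
  have heq : ∫ x, (gen ρ θ γ g x + totalRate ρ θ γ x * g x) ∂π =
      ∫ x, totalRate ρ θ γ x * g x ∂π := by
    rw [integral_eq_lintegral_of_nonneg_ae (ae_of_all _ hnn) hjm.aestronglyMeasurable, hbal,
      integral_eq_lintegral_of_nonneg_ae (ae_of_all _ hrg0) hint.aestronglyMeasurable]
  calc ∫ x, gen ρ θ γ g x ∂π =
        ∫ x, ((gen ρ θ γ g x + totalRate ρ θ γ x * g x) - totalRate ρ θ γ x * g x) ∂π :=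
        integral_congr_ae (ae_of_all _ fun x => by ring)
    _ = 0 := by rw [integral_sub hint2 hint, heq, sub_self]

theorem integral_dualGen {F : Finset (Fin N) → Finset (Fin N) → Population N → ℝ}
    (hF : ∀ S T, Integrable (F S T) π) (S T : Finset (Fin N)) :
    Integrable (fun x => dualGen ρ γ (fun S T => F S T x) S T) π ∧
      ∫ x, dualGen ρ γ (fun S T => F S T x) S T ∂π =
        dualGen ρ γ (fun S T => ∫ x, F S T x ∂π) S T := by
  have hd : ∀ S' T', Integrable (fun x => F S' T' x - F S T x) π := fun S' T' =>
    (hF S' T').sub (hF S T)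
  have hs : ∀ G : Fin N → Finset (Fin N) × Finset (Fin N),
      Integrable (fun x => ∑ i, (F (G i).1 (G i).2 x - F S T x)) π := fun G =>
    integrable_finsetSum _ fun i _ => hd _ _
  have hsi : ∀ G : Fin N → Finset (Fin N) × Finset (Fin N),
      ∫ x, (∑ i, (F (G i).1 (G i).2 x - F S T x)) ∂π =
        ∑ i, ((∫ x, F (G i).1 (G i).2 x ∂π) - ∫ x, F S T x ∂π) := fun G => by
    rw [integral_finsetSum _ fun i _ => hd _ _]
    exact Finset.sum_congr rfl fun i _ => integral_sub (hF _ _) (hF _ _)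
  have hss : Integrable (fun x => ∑ i : Fin N, ∑ j : Fin N,
      (F (S.image (Function.update id j i)) (T.image (Function.update id j i)) x - F S T x)) π :=
    integrable_finsetSum _ fun i _ => hs fun j =>
      (S.image (Function.update id j i), T.image (Function.update id j i))
  have hssi : ∫ x, (∑ i : Fin N, ∑ j : Fin N,
      (F (S.image (Function.update id j i)) (T.image (Function.update id j i)) x - F S T x)) ∂π =
      ∑ i : Fin N, ∑ j : Fin N, ((∫ x, F (S.image (Function.update id j i))
        (T.image (Function.update id j i)) x ∂π) - ∫ x, F S T x ∂π) := by
    rw [integral_finsetSum _ fun i _ => hs fun j =>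
      (S.image (Function.update id j i), T.image (Function.update id j i))]
    exact Finset.sum_congr rfl fun i _ => hsi fun j =>
      (S.image (Function.update id j i), T.image (Function.update id j i))
  have l1 := hs fun i => (S.erase i, T)
  have l2 := hs fun i => (S, T.erase i)
  have g1 := hs fun i => (insert i S, T)
  have g2 := hs fun i => (S, insert i T)
  have l1i := hsi fun i => (S.erase i, T)
  have l2i := hsi fun i => (S, T.erase i)
  have g1i := hsi fun i => (insert i S, T)
  have g2i := hsi fun i => (S, insert i T)
  simp only [] at l1 l2 g1 g2 l1i l2i g1i g2i
  have i1 := hss.const_mul (1 / 2)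
  have i2 := (l1.add l2).const_mul (ρ / 2)
  have i3 := ((g1.const_mul (S.card : ℝ)).add (g2.const_mul (T.card : ℝ))).const_mul (γ / (2 * N))
  simp only [dualGen]
  refine ⟨(i1.add i2).add i3, ?_⟩
  have e1 := integral_add (i1.add i2) i3
  have e2 := integral_add i1 i2
  have e3 := integral_add l1 l2
  have e4 := integral_add (g1.const_mul (S.card : ℝ)) (g2.const_mul (T.card : ℝ))
  simp only [Pi.add_apply, integral_const_mul] at e1 e2 e3 e4
  rw [e1, e2, e3, e4, hssi, l1i, l2i, g1i, g2i]

section Moments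

variable (h : IsEquilibrium ρ θ γ π) (hN : 1 ≤ N) (hρ : 0 < ρ) (hθ : 0 ≤ θ) (hγ : 0 ≤ γ)

include h hN hρ hθ hγ

theorem IsEquilibrium.integrable_numGenes (S : Finset (Fin N)) : Integrable (numGenes S) π := by
  refine h.integrable_of_le hN hρ hθ hγ (K := 1) (measurable_numGenes S) fun x => ?_
  rw [abs_of_nonneg (numGenes_nonneg S x), one_mul]
  have h0 := numGenes_nonneg Finset.univ x
  have h1 := numGenes_mono (Finset.subset_univ S) x
  nlinarith [pow_nonneg h0 2, pow_nonneg h0 3]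

theorem IsEquilibrium.integrable_numGenes_mul (S T : Finset (Fin N)) :
    Integrable (fun x => numGenes S x * numGenes T x) π := by
  refine h.integrable_of_le hN hρ hθ hγ (K := 1)
    ((measurable_numGenes S).mul (measurable_numGenes T)) fun x => ?_
  rw [abs_of_nonneg (mul_nonneg (numGenes_nonneg S x) (numGenes_nonneg T x)), one_mul]
  have h0 := numGenes_nonneg Finset.univ x
  have h1 := mul_le_mul (numGenes_mono (Finset.subset_univ S) x)
    (numGenes_mono (Finset.subset_univ T) x) (numGenes_nonneg T x) h0
  nlinarith [pow_nonneg h0 2, pow_nonneg h0 3]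

theorem IsEquilibrium.integrable_numPairs (S T : Finset (Fin N)) :
    Integrable (numPairs S T) π :=
  (((h.integrable_numGenes_mul hN hρ hθ hγ S T).sub (h.integrable_numGenes hN hρ hθ hγ S)).sub
    (h.integrable_numGenes hN hρ hθ hγ T)).add (h.integrable_numGenes hN hρ hθ hγ (S ∪ T))

/-- First moments in equilibrium. -/
theorem IsEquilibrium.dualGen_integral_numGenes (S : Finset (Fin N)) :
    dualGen ρ γ (fun S _ => ∫ x, numGenes S x ∂π) S ∅ + θ / 2 * S.card = 0 := by
  have := h.prob
  have h0 := h.integral_gen_eq_zero hN hρ hθ hγ (g := numGenes S) (K := 1)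
    (measurable_numGenes S) (numGenes_nonneg S) (gainInvariant_numGenes S) fun x => by
      have h0 := numGenes_nonneg Finset.univ x
      have h1 := numGenes_mono (Finset.subset_univ S) x
      nlinarith
  simp only [gen_numGenes] at h0
  obtain ⟨h1, h2⟩ := integral_dualGen (ρ := ρ) (γ := γ) (F := fun S _ x => numGenes S x)
    (fun S _ => h.integrable_numGenes hN hρ hθ hγ S) S ∅
  rw [integral_add h1 (integrable_const _), h2, integral_const, probReal_univ, one_smul] at h0
  exact h0

/-- Second moments in equilibrium. -/
theorem IsEquilibrium.dualGen_integral_numPairs (S T : Finset (Fin N)) :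
    dualGen ρ γ (fun S T => ∫ x, numPairs S T x ∂π) S T +
      θ / 2 * (S.card * ∫ x, numGenes T x ∂π + T.card * ∫ x, numGenes S x ∂π) = 0 := by
  have := h.prob
  have h0 := h.integral_gen_eq_zero hN hρ hθ hγ (g := numPairs S T) (K := 1)
    (measurable_numPairs S T) (numPairs_nonneg S T) (gainInvariant_numPairs S T) fun x => by
      have h0 := numGenes_nonneg Finset.univ x
      have h1 := mul_le_mul (numGenes_mono (Finset.subset_univ S) x)
        (numGenes_mono (Finset.subset_univ T) x) (numGenes_nonneg T x) h0
      have h2 := numGenes_mono (Finset.subset_univ (S ∪ T)) x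
      have h3 := numGenes_nonneg S x
      have h4 := numGenes_nonneg T x
      rw [numPairs]
      nlinarith
  simp only [gen_numPairs] at h0
  obtain ⟨h1, h2⟩ := integral_dualGen (ρ := ρ) (γ := γ) (F := numPairs)
    (fun S T => h.integrable_numPairs hN hρ hθ hγ S T) S T
  have i1 := (h.integrable_numGenes hN hρ hθ hγ T).const_mul (S.card : ℝ)
  have i2 := (h.integrable_numGenes hN hρ hθ hγ S).const_mul (T.card : ℝ)
  have i3 : Integrable
      (fun x => θ / 2 * (S.card * numGenes T x + T.card * numGenes S x)) π :=
    (i1.add i2).const_mul (θ / 2)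
  rwa [integral_add h1 i3, h2, integral_const_mul, integral_add i1 i2, integral_const_mul,
    integral_const_mul] at h0

end Moments

end Moran

/-! ### The dual generator on functions of sizes and overlap. -/

theorem Finset.sum_classify {ι : Type*} [Fintype ι] [DecidableEq ι] (S T : Finset ι)
    (α β δ ε : ℝ) :
    ∑ i, (if i ∈ S then (if i ∈ T then α else β) else (if i ∈ T then δ else ε)) =
      (S ∩ T).card * α + (S.card - (S ∩ T).card) * β + (T.card - (S ∩ T).card) * δ +
        (Fintype.card ι - S.card - T.card + (S ∩ T).card) * ε := by
  have h : ∀ i, (if i ∈ S then (if i ∈ T then α else β) else (if i ∈ T then δ else ε)) =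
      ε + (if i ∈ S then β - ε else 0) + (if i ∈ T then δ - ε else 0) +
        (if i ∈ S ∩ T then α - β - δ + ε else 0) := fun i => by
    by_cases hS : i ∈ S <;> by_cases hT : i ∈ T <;> simp [hS, hT]
    ring
  simp only [h, Finset.sum_add_distrib, Finset.sum_ite_mem, Finset.univ_inter,
    Finset.sum_const, nsmul_eq_mul, Finset.card_univ]
  ring

theorem Finset.image_update_id {ι : Type*} [DecidableEq ι] (S : Finset ι) (i j : ι) :
    S.image (Function.update id j i) = if j ∈ S then insert i (S.erase j) else S := by
  ext k
  split_ifs with h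
  · simp only [mem_image, Function.update_apply, id, mem_insert, mem_erase]
    constructor
    · rintro ⟨a, ha, rfl⟩
      split_ifs with haj
      · exact Or.inl rfl
      · exact Or.inr ⟨haj, ha⟩
    · rintro (rfl | ⟨hk, hkS⟩)
      · exact ⟨j, h, if_pos rfl⟩
      · exact ⟨k, hkS, if_neg hk⟩
  · simp only [mem_image, Function.update_apply, id]
    constructor
    · rintro ⟨a, ha, rfl⟩
      rwa [if_neg (ne_of_mem_of_not_mem ha h)]
    · intro hk
      exact ⟨k, hk, if_neg (ne_of_mem_of_not_mem hk h)⟩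

theorem Finset.card_insert_erase {ι : Type*} [DecidableEq ι] {S : Finset ι} {j : ι} (hj : j ∈ S)
    (i : ι) : (insert i (S.erase j)).card =
      if i = j then S.card else if i ∈ S then S.card - 1 else S.card := by
  split_ifs with h1 h2
  · rw [h1, insert_erase hj]
  · rw [insert_eq_of_mem (mem_erase.2 ⟨h1, h2⟩), card_erase_of_mem hj]
  · rw [card_insert_of_notMem (fun h => h2 (mem_of_mem_erase h)), card_erase_add_one hj]

namespace Moran

variable {N : ℕ} (ρ γ : ℝ)

/-- The generator of the limiting dual process, acting on functions of the sizes `s`, `t`, `b` of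
two sets and of their intersection. -/
def limitGen (F : ℕ → ℕ → ℕ → ℝ) (s t b : ℕ) : ℝ :=
  1 / 2 * ((s - b) * (s + b - 1)) * (F (s - 1) t b - F s t b) +
  1 / 2 * ((t - b) * (t + b - 1)) * (F s (t - 1) b - F s t b) +
  1 / 2 * (b * (b - 1)) * (F (s - 1) (t - 1) (b - 1) - F s t b) +
  (s - b) * (t - b) * (F s t (b + 1) - F s t b) +
  ρ / 2 * ((s - b) * (F (s - 1) t b - F s t b) + b * (F (s - 1) t (b - 1) - F s t b) +
    (t - b) * (F s (t - 1) b - F s t b) + b * (F s (t - 1) (b - 1) - F s t b)) +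
  γ / 2 * (s * (F (s + 1) t b - F s t b) + t * (F s (t + 1) b - F s t b))

/-- Fix the moved line `j` and classify the target `i` by membership in `S` and `T`. If `j` is in
both sets, moving onto a line of both merges both; moving onto a line of only one of them merges
there but keeps the overlap, as `i` becomes the shared line. If `j` is in one set only, hitting that
set merges, and hitting only the other set creates a new shared line. -/
theorem sum_resample_card (F : ℕ → ℕ → ℕ → ℝ) (S T : Finset (Fin N)) :
    ∑ i : Fin N, ∑ j : Fin N, (F (S.image (Function.update id j i)).card
        (T.image (Function.update id j i)).card
        (S.image (Function.update id j i) ∩ T.image (Function.update id j i)).card -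
      F S.card T.card (S ∩ T).card) =
    (S.card - (S ∩ T).card) * (S.card + (S ∩ T).card - 1) *
      (F (S.card - 1) T.card (S ∩ T).card - F S.card T.card (S ∩ T).card) +
    (T.card - (S ∩ T).card) * (T.card + (S ∩ T).card - 1) *
      (F S.card (T.card - 1) (S ∩ T).card - F S.card T.card (S ∩ T).card) +
    (S ∩ T).card * ((S ∩ T).card - 1) *
      (F (S.card - 1) (T.card - 1) ((S ∩ T).card - 1) - F S.card T.card (S ∩ T).card) +
    2 * ((S.card - (S ∩ T).card) * (T.card - (S ∩ T).card)) *
      (F S.card T.card ((S ∩ T).card + 1) - F S.card T.card (S ∩ T).card) := by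
  set F₀ := F S.card T.card (S ∩ T).card with hF₀
  set α := F (S.card - 1) (T.card - 1) ((S ∩ T).card - 1) - F₀ with hα
  set β := F (S.card - 1) T.card (S ∩ T).card - F₀ with hβ
  set δ := F S.card (T.card - 1) (S ∩ T).card - F₀ with hδ
  set ε := F S.card T.card ((S ∩ T).card + 1) - F₀ with hε
  rw [Finset.sum_comm]
  have hj : ∀ j : Fin N, ∑ i : Fin N, (F (S.image (Function.update id j i)).card
        (T.image (Function.update id j i)).card
        (S.image (Function.update id j i) ∩ T.image (Function.update id j i)).card - F₀) =
      if j ∈ S then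
        (if j ∈ T then ((S ∩ T).card - 1) * α + (S.card - (S ∩ T).card) * β +
            (T.card - (S ∩ T).card) * δ
          else ((S ∩ T).card + (S.card - (S ∩ T).card - 1)) * β + (T.card - (S ∩ T).card) * ε)
      else
        (if j ∈ T then ((S ∩ T).card + (T.card - (S ∩ T).card - 1)) * δ +
            (S.card - (S ∩ T).card) * ε else 0) := by
    intro j
    have hcl := fun α β δ => Finset.sum_classify S T α β δ 0
    by_cases hS : j ∈ S <;> by_cases hT : j ∈ T
    · have hb : j ∈ S ∩ T := Finset.mem_inter.2 ⟨hS, hT⟩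
      have e : ∀ i, F (S.image (Function.update id j i)).card
          (T.image (Function.update id j i)).card
          (S.image (Function.update id j i) ∩ T.image (Function.update id j i)).card - F₀ =
          (if i ∈ S then (if i ∈ T then α else β) else (if i ∈ T then δ else 0)) -
            -- The target `i = j` lies in the cell `S ∩ T` but moves nothing, so its entry is
            -- removed again.
            if i = j then α else 0 := fun i => by
        have hST : S.erase j ∩ T.erase j = (S ∩ T).erase j := by
          rw [Finset.erase_inter, Finset.inter_erase, Finset.erase_idem]
        rw [Finset.image_update_id, Finset.image_update_id, if_pos hS, if_pos hT,
          ← Finset.insert_inter_distrib, hST, Finset.card_insert_erase hS,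
          Finset.card_insert_erase hT, Finset.card_insert_erase hb]
        rcases eq_or_ne i j with rfl | hij
        · simp [hS, hT, hF₀]
        · by_cases hiS : i ∈ S <;> by_cases hiT : i ∈ T <;> simp [hij, hiS, hiT, hF₀, hα, hβ, hδ]
      rw [Finset.sum_congr rfl fun i _ => e i, Finset.sum_sub_distrib, hcl, Finset.sum_ite_eq']
      simp only [hS, hT, if_true, Finset.mem_univ]
      ring
    · have hb : j ∉ S ∩ T := fun h => hT (Finset.mem_inter.1 h).2
      have e : ∀ i, F (S.image (Function.update id j i)).card
          (T.image (Function.update id j i)).card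
          (S.image (Function.update id j i) ∩ T.image (Function.update id j i)).card - F₀ =
          (if i ∈ S then (if i ∈ T then β else β) else (if i ∈ T then ε else 0)) -
            if i = j then β else 0 := fun i => by
        have hST : insert i (S.erase j) ∩ T = if i ∈ T then insert i (S ∩ T) else S ∩ T := by
          split_ifs with hiT
          · rw [Finset.insert_inter_of_mem hiT, Finset.erase_inter, Finset.erase_eq_of_notMem hb]
          · rw [Finset.insert_inter_of_notMem hiT, Finset.erase_inter,
              Finset.erase_eq_of_notMem hb]
        rw [Finset.image_update_id, Finset.image_update_id, if_pos hS, if_neg hT, hST,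
          Finset.card_insert_erase hS]
        rcases eq_or_ne i j with rfl | hij
        · simp [hS, hT, hF₀]
        · by_cases hiS : i ∈ S <;> by_cases hiT : i ∈ T <;> simp [hij, hiS, hiT, hF₀, hβ, hε]
      rw [Finset.sum_congr rfl fun i _ => e i, Finset.sum_sub_distrib, hcl, Finset.sum_ite_eq']
      simp only [hS, hT, if_true, if_false, Finset.mem_univ]
      ring
    · have hb : j ∉ S ∩ T := fun h => hS (Finset.mem_inter.1 h).1
      have e : ∀ i, F (S.image (Function.update id j i)).card
          (T.image (Function.update id j i)).card
          (S.image (Function.update id j i) ∩ T.image (Function.update id j i)).card - F₀ =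
          (if i ∈ S then (if i ∈ T then δ else ε) else (if i ∈ T then δ else 0)) -
            if i = j then δ else 0 := fun i => by
        have hST : S ∩ insert i (T.erase j) = if i ∈ S then insert i (S ∩ T) else S ∩ T := by
          split_ifs with hiS
          · rw [Finset.inter_insert_of_mem hiS, Finset.inter_erase, Finset.erase_eq_of_notMem hb]
          · rw [Finset.inter_insert_of_notMem hiS, Finset.inter_erase,
              Finset.erase_eq_of_notMem hb]
        rw [Finset.image_update_id, Finset.image_update_id, if_neg hS, if_pos hT, hST,
          Finset.card_insert_erase hT]
        rcases eq_or_ne i j with rfl | hij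
        · simp [hS, hT, hF₀]
        · by_cases hiS : i ∈ S <;> by_cases hiT : i ∈ T <;> simp [hij, hiS, hiT, hF₀, hδ, hε]
      rw [Finset.sum_congr rfl fun i _ => e i, Finset.sum_sub_distrib, hcl, Finset.sum_ite_eq']
      simp only [hS, hT, if_true, if_false, Finset.mem_univ]
      ring
    · simp only [Finset.image_update_id, hS, hT, if_false, hF₀, sub_self, Finset.sum_const_zero]
  rw [Finset.sum_congr rfl fun j _ => hj j, Finset.sum_classify]
  ring

/-- The generator of the dual process, acting on functions of the sizes of the two sets and of
their intersection. -/
theorem dualGen_card (hN : 1 ≤ N) (F : ℕ → ℕ → ℕ → ℝ) (S T : Finset (Fin N)) :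
    dualGen ρ γ (fun S T => F S.card T.card (S ∩ T).card) S T =
    limitGen ρ γ F S.card T.card (S ∩ T).card + γ / (2 * N) *
      (S.card * ((T.card - (S ∩ T).card) *
          (F (S.card + 1) T.card ((S ∩ T).card + 1) - F (S.card + 1) T.card (S ∩ T).card) -
        S.card * (F (S.card + 1) T.card (S ∩ T).card - F S.card T.card (S ∩ T).card)) +
      T.card * ((S.card - (S ∩ T).card) *
          (F S.card (T.card + 1) ((S ∩ T).card + 1) - F S.card (T.card + 1) (S ∩ T).card) -
        T.card * (F S.card (T.card + 1) (S ∩ T).card - F S.card T.card (S ∩ T).card))) := by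
  have hN' : (N : ℝ) ≠ 0 := by exact_mod_cast (by omega : N ≠ 0)
  set F₀ := F S.card T.card (S ∩ T).card with hF₀
  have l1 : ∀ i, F (S.erase i).card T.card (S.erase i ∩ T).card - F₀ =
      if i ∈ S then (if i ∈ T then F (S.card - 1) T.card ((S ∩ T).card - 1) - F₀
        else F (S.card - 1) T.card (S ∩ T).card - F₀) else (if i ∈ T then 0 else 0) := fun i => by
    rw [Finset.erase_inter, Finset.card_erase_eq_ite, Finset.card_erase_eq_ite]
    by_cases hiS : i ∈ S <;> by_cases hiT : i ∈ T <;> simp [hiS, hiT, hF₀]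
  have l2 : ∀ i, F S.card (T.erase i).card (S ∩ T.erase i).card - F₀ =
      if i ∈ S then (if i ∈ T then F S.card (T.card - 1) ((S ∩ T).card - 1) - F₀
        else 0) else (if i ∈ T then F S.card (T.card - 1) (S ∩ T).card - F₀ else 0) := fun i => by
    rw [Finset.inter_erase, Finset.card_erase_eq_ite, Finset.card_erase_eq_ite]
    by_cases hiS : i ∈ S <;> by_cases hiT : i ∈ T <;> simp [hiS, hiT, hF₀]
  -- In a finite population the donor can already be in `S`, where it changes nothing, or in `T`,
  -- where it enlarges the overlap. These two effects are the terms of order `1 / N`.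
  have g1 : ∀ i, F (insert i S).card T.card (insert i S ∩ T).card - F₀ =
      if i ∈ S then (if i ∈ T then 0 else 0) else
        (if i ∈ T then F (S.card + 1) T.card ((S ∩ T).card + 1) - F₀
          else F (S.card + 1) T.card (S ∩ T).card - F₀) := fun i => by
    by_cases hiS : i ∈ S <;> by_cases hiT : i ∈ T <;>
      simp [hiS, hiT, hF₀, Finset.insert_inter_of_mem, Finset.insert_inter_of_notMem]
  have g2 : ∀ i, F S.card (insert i T).card (S ∩ insert i T).card - F₀ =
      if i ∈ S then (if i ∈ T then 0 else F S.card (T.card + 1) ((S ∩ T).card + 1) - F₀) else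
        (if i ∈ T then 0 else F S.card (T.card + 1) (S ∩ T).card - F₀) := fun i => by
    by_cases hiS : i ∈ S <;> by_cases hiT : i ∈ T <;>
      simp [hiS, hiT, hF₀, Finset.inter_insert_of_mem, Finset.inter_insert_of_notMem]
  simp only [dualGen, limitGen]
  rw [sum_resample_card, ← hF₀]
  simp only [l1, l2, g1, g2, Finset.sum_classify, Fintype.card_fin]
  field_simp
  ring

end Moran

/-! ### Solving the limiting system. -/

/-- Knaster-Tarski for monotone operators on real functions. -/
theorem exists_fixed_point_of_supersolution {E : Type*} (Φ : (E → ℝ) → E → ℝ)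
    (hΦ : ∀ f g, f ≤ g → Φ f ≤ Φ g) (h0 : 0 ≤ Φ 0) {w : E → ℝ} (hw0 : 0 ≤ w) (hw : Φ w ≤ w) :
    ∃ f, 0 ≤ f ∧ f ≤ w ∧ Φ f = f := by
  set A : Set (E → ℝ) := {g | g ≤ w ∧ g ≤ Φ g} with hA
  have hA0 : (0 : E → ℝ) ∈ A := ⟨hw0, h0⟩
  have hbdd : BddAbove A := ⟨w, fun g hg => hg.1⟩
  have hlub : IsLUB A (sSup A) := isLUB_csSup ⟨0, hA0⟩ hbdd
  have hle : sSup A ≤ w := hlub.2 fun g hg => hg.1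
  have h1 : sSup A ≤ Φ (sSup A) := hlub.2 fun g hg => hg.2.trans (hΦ _ _ (hlub.1 hg))
  refine ⟨sSup A, hlub.1 hA0, hle, le_antisymm (hlub.1 ⟨?_, hΦ _ _ h1⟩) h1⟩
  exact (hΦ _ _ hle).trans hw

/-- Supersolutions of a one-dimensional recursion, with geometric growth. -/
theorem exists_geometric_supersolution {ρ : ℝ} (hρ : 0 < ρ) {Γ : ℝ} (hΓ : 0 ≤ Γ) {B : ℝ}
    (hB : 1 ≤ B) : ∃ (D : ℕ → ℝ) (K : ℝ), 0 ≤ K ∧ (∀ n, 0 ≤ D n) ∧ (∀ n, D n ≤ K * B ^ n) ∧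
      ∀ γ, 0 ≤ γ → γ ≤ Γ → ∀ n, B ^ (n + 1) ≤ (n + ρ) * D (n + 1) - γ * D (n + 2) := by
  obtain ⟨n₀, hn₀⟩ := exists_nat_ge (Γ * B + 1)
  have hB0 : 0 < B := one_pos.trans_le hB
  obtain ⟨q, hq0, hq1, hqΓ⟩ : ∃ q : ℝ, 0 < q ∧ q ≤ 1 ∧ q * Γ ≤ ρ / 2 := by
    refine ⟨min 1 (ρ / (2 * (Γ + 1))), lt_min one_pos (by positivity), min_le_left _ _, ?_⟩
    calc min 1 (ρ / (2 * (Γ + 1))) * Γ ≤ ρ / (2 * (Γ + 1)) * (Γ + 1) := by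
          gcongr
          · exact min_le_right _ _
          · linarith
      _ = ρ / 2 := by field_simp
  -- For `n ≥ n₀` the geometric part `B ^ n` is a supersolution by itself, since `n` exceeds `Γ * B
  -- + 1`. For smaller `n` the decaying part, with surplus `ρ / 2 * K₁ * q ^ (n + 1)` thanks to `q *
  -- Γ ≤ ρ / 2`, covers the deficit; `K₁` is chosen for the worst such index. None of the constants
  -- depends on `γ ≤ Γ`.
  set K₁ : ℝ := (Γ * B + 1) * B ^ (n₀ + 1) / (q ^ (n₀ + 1) * (ρ / 2)) with hK₁
  have hK₁0 : 0 ≤ K₁ := by positivity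
  refine ⟨fun n => B ^ n + K₁ * q ^ n, 1 + K₁, by positivity, fun n => by positivity,
    fun n => ?_, fun γ hγ hγΓ n => ?_⟩
  · have h1 : q ^ n ≤ 1 := pow_le_one₀ hq0.le hq1
    have h2 : 1 ≤ B ^ n := one_le_pow₀ hB
    nlinarith [mul_le_mul_of_nonneg_left (h1.trans h2) hK₁0]
  · have hBn : 0 < B ^ (n + 1) := by positivity
    have hqn : 0 < q ^ (n + 1) := by positivity
    have h1 : ρ / 2 * (K₁ * q ^ (n + 1)) ≤
        (n + ρ) * (K₁ * q ^ (n + 1)) - γ * (K₁ * q ^ (n + 2)) := by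
      have h2 : γ * q ≤ ρ / 2 := by nlinarith
      have h3 : (0 : ℝ) ≤ n := Nat.cast_nonneg n
      have h4 : 0 ≤ K₁ * q ^ (n + 1) := by positivity
      have h5 : ρ / 2 ≤ n + ρ - γ * q := by linarith
      calc ρ / 2 * (K₁ * q ^ (n + 1)) ≤ (n + ρ - γ * q) * (K₁ * q ^ (n + 1)) := by gcongr
        _ = _ := by ring
    have h6 : B ^ (n + 1) ≤ (n + ρ) * B ^ (n + 1) - γ * B ^ (n + 2) +
        ρ / 2 * (K₁ * q ^ (n + 1)) := by
      have h7 : γ * B ^ (n + 2) ≤ Γ * B * B ^ (n + 1) := by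
        calc γ * B ^ (n + 2) ≤ Γ * B ^ (n + 2) := by gcongr
          _ = _ := by ring
      by_cases hn : n₀ ≤ n
      · have hn' : Γ * B + 1 ≤ n := hn₀.trans (by exact_mod_cast hn)
        have h8 := mul_le_mul_of_nonneg_right hn' hBn.le
        have h9 : 0 ≤ ρ / 2 * (K₁ * q ^ (n + 1)) := by positivity
        nlinarith [mul_pos hρ hBn]
      · have h8 : (Γ * B + 1) * B ^ (n + 1) ≤ ρ / 2 * (K₁ * q ^ (n + 1)) := by
          have h9 : B ^ (n + 1) ≤ B ^ (n₀ + 1) := pow_le_pow_right₀ hB (by omega)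
          have h10 : q ^ (n₀ + 1) ≤ q ^ (n + 1) := pow_le_pow_of_le_one hq0.le hq1 (by omega)
          calc (Γ * B + 1) * B ^ (n + 1) ≤ (Γ * B + 1) * B ^ (n₀ + 1) := by gcongr
            _ = ρ / 2 * (K₁ * q ^ (n₀ + 1)) := by
              rw [hK₁]; field_simp
            _ ≤ _ := by gcongr
        have h9 : 0 ≤ (n + ρ) * B ^ (n + 1) := by positivity
        nlinarith
    simp only [mul_add]
    linarith

namespace Moran

variable {ρ γ : ℝ}

/-- Partial sums `D 1 + ... + D n`. -/
def partialSum (D : ℕ → ℝ) (n : ℕ) : ℝ := ∑ i ∈ Finset.range n, D (i + 1)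

theorem partialSum_zero (D : ℕ → ℝ) : partialSum D 0 = 0 := Finset.sum_range_zero _

theorem partialSum_succ (D : ℕ → ℝ) (n : ℕ) : partialSum D (n + 1) = partialSum D n + D (n + 1) :=
  Finset.sum_range_succ _ _

theorem partialSum_nonneg {D : ℕ → ℝ} (hD : ∀ n, 0 ≤ D n) (n : ℕ) : 0 ≤ partialSum D n :=
  Finset.sum_nonneg fun _ _ => hD _

theorem partialSum_le {D : ℕ → ℝ} {K B : ℝ} (hK : 0 ≤ K) (hB : 1 ≤ B) (hD : ∀ n, D n ≤ K * B ^ n)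
    (n : ℕ) : partialSum D n ≤ K * (n * B ^ n) := by
  calc partialSum D n ≤ ∑ i ∈ Finset.range n, K * B ^ n :=
        Finset.sum_le_sum fun i hi => (hD _).trans (by
          have := Finset.mem_range.1 hi
          exact mul_le_mul_of_nonneg_left (pow_le_pow_right₀ hB (by omega)) hK)
    _ = _ := by rw [Finset.sum_const, Finset.card_range, nsmul_eq_mul]; ring

/-- For functions of `s` alone the downward rates add up to `s (s - 1 + ρ) / 2` whatever the
overlap, so `limitGen` is the generator of a birth and death process. Supersolutions of the
one-dimensional recursion thus become supersolutions of the full system. -/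
theorem limitGen_partialSum (D : ℕ → ℝ) (s t b : ℕ) :
    limitGen ρ γ (fun s _ _ => partialSum D s) (s + 1) t b =
      -((s + 1) / 2 * ((s + ρ) * D (s + 1) - γ * D (s + 2))) := by
  simp only [limitGen, Nat.add_sub_cancel, partialSum_succ]
  push_cast
  ring

theorem limitGen_partialSum_right (D : ℕ → ℝ) (s t b : ℕ) :
    limitGen ρ γ (fun _ t _ => partialSum D t) s (t + 1) b =
      -((t + 1) / 2 * ((t + ρ) * D (t + 1) - γ * D (t + 2))) := by
  simp only [limitGen, Nat.add_sub_cancel, partialSum_succ]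
  push_cast
  ring

/-- Expected frequencies: the number of genes that are new in the `n`-th individual. -/
theorem exists_firstOrder (hρ : 0 < ρ) {θ : ℝ} (hθ : 0 ≤ θ) (Γ : ℝ) (hΓ : 0 ≤ Γ) :
    ∃ K, 0 ≤ K ∧ ∀ γ, 0 ≤ γ → γ ≤ Γ → ∃ d : ℕ → ℝ, (∀ n, 0 ≤ d n) ∧ (∀ n, d n ≤ K) ∧
      ∀ n, (n + ρ) * d (n + 1) = θ + γ * d (n + 2) := by
  obtain ⟨D, K, hK0, hD0, hDK, hD⟩ := exists_geometric_supersolution hρ hΓ le_rfl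
  simp only [one_pow, mul_one] at hDK hD
  refine ⟨θ * K, by positivity, fun γ hγ hγΓ => ?_⟩
  have hpos : ∀ n : ℕ, (0 : ℝ) < n + ρ := fun n => by positivity
  obtain ⟨f, hf0, hfw, hf⟩ := exists_fixed_point_of_supersolution
    (fun (f : ℕ → ℝ) n => (θ + γ * f (n + 1)) / (n + ρ))
    (fun f g hfg n => by
      have := hfg (n + 1)
      have := hpos n
      dsimp only
      gcongr)
    (fun n => by
      have := hpos n
      simp only [Pi.zero_apply]
      positivity)
    (w := fun n => θ * D (n + 1)) (fun n => mul_nonneg hθ (hD0 _))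
    (fun n => by
      dsimp only
      rw [div_le_iff₀ (hpos n)]
      have := mul_le_mul_of_nonneg_left (hD γ hγ hγΓ n) hθ
      linarith)
  -- The fixed point is indexed from `0` and `d` from `1`; truncated subtraction fills `d 0` with a
  -- value that obeys the bounds and never enters the recursion.
  refine ⟨fun n => f (n - 1), fun n => hf0 _, fun n => (hfw _).trans ?_, fun n => ?_⟩
  · exact mul_le_mul_of_nonneg_left (hDK _) hθ
  · have h := congrFun hf n
    change (n + ρ) * f n = θ + γ * f (n + 1)
    rw [← h, mul_div_cancel₀ _ (hpos n).ne']

/-- The part of `limitGen` that belongs to the targets of the jumps. -/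
def limitSum (ρ γ : ℝ) (F : ℕ → ℕ → ℕ → ℝ) (s t b : ℕ) : ℝ :=
  1 / 2 * ((s - b) * (s + b - 1)) * F (s - 1) t b +
  1 / 2 * ((t - b) * (t + b - 1)) * F s (t - 1) b +
  1 / 2 * (b * (b - 1)) * F (s - 1) (t - 1) (b - 1) +
  (s - b) * (t - b) * F s t (b + 1) +
  ρ / 2 * ((s - b) * F (s - 1) t b + b * F (s - 1) t (b - 1) +
    (t - b) * F s (t - 1) b + b * F s (t - 1) (b - 1)) +
  γ / 2 * (s * F (s + 1) t b + t * F s (t + 1) b)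

/-- The total rate in `limitGen`. -/
def limitRate (ρ γ : ℝ) (s t b : ℕ) : ℝ :=
  1 / 2 * ((s - b) * (s + b - 1)) + 1 / 2 * ((t - b) * (t + b - 1)) + 1 / 2 * (b * (b - 1)) +
  (s - b) * (t - b) + ρ / 2 * (s + t) + γ / 2 * (s + t)

theorem limitGen_eq (F : ℕ → ℕ → ℕ → ℝ) (s t b : ℕ) :
    limitGen ρ γ F s t b = limitSum ρ γ F s t b - limitRate ρ γ s t b * F s t b := by
  simp only [limitGen, limitSum, limitRate]
  ring

theorem nat_mul_pred_nonneg (b : ℕ) : (0 : ℝ) ≤ b * (b - 1) := by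
  rcases b.eq_zero_or_pos with rfl | hb
  · simp
  · have : (1 : ℝ) ≤ b := by exact_mod_cast hb
    exact mul_nonneg (by positivity) (by linarith)

theorem limitRate_pos (hρ : 0 < ρ) (hγ : 0 ≤ γ) {s t b : ℕ} (hs : 1 ≤ s) (ht : 1 ≤ t)
    (hbs : b ≤ s) (hbt : b ≤ t) : 0 < limitRate ρ γ s t b := by
  have hs' : (1 : ℝ) ≤ s := by exact_mod_cast hs
  have ht' : (1 : ℝ) ≤ t := by exact_mod_cast ht
  have hbs' : (0 : ℝ) ≤ s - b := sub_nonneg.2 (by exact_mod_cast hbs)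
  have hbt' : (0 : ℝ) ≤ t - b := sub_nonneg.2 (by exact_mod_cast hbt)
  have hb : (0 : ℝ) ≤ b := Nat.cast_nonneg b
  have h1 := mul_nonneg hbs' (by linarith : (0 : ℝ) ≤ s + b - 1)
  have h2 := mul_nonneg hbt' (by linarith : (0 : ℝ) ≤ t + b - 1)
  have h3 := mul_nonneg hbs' hbt'
  have h4 := nat_mul_pred_nonneg b
  have h5 : 0 < ρ / 2 * (s + t) := by positivity
  have h6 : 0 ≤ γ / 2 * (s + t) := by positivity
  rw [limitRate]
  linarith

theorem limitSum_mono (hρ : 0 ≤ ρ) (hγ : 0 ≤ γ) {s t b : ℕ} (hs : 1 ≤ s) (ht : 1 ≤ t)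
    (hbs : b ≤ s) (hbt : b ≤ t) {F G : ℕ → ℕ → ℕ → ℝ} (hFG : ∀ s t b, F s t b ≤ G s t b) :
    limitSum ρ γ F s t b ≤ limitSum ρ γ G s t b := by
  have hs' : (1 : ℝ) ≤ s := by exact_mod_cast hs
  have ht' : (1 : ℝ) ≤ t := by exact_mod_cast ht
  have hbs' : (0 : ℝ) ≤ s - b := sub_nonneg.2 (by exact_mod_cast hbs)
  have hbt' : (0 : ℝ) ≤ t - b := sub_nonneg.2 (by exact_mod_cast hbt)
  have hb : (0 : ℝ) ≤ b := Nat.cast_nonneg b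
  have h1 := mul_nonneg hbs' (by linarith : (0 : ℝ) ≤ s + b - 1)
  have h2 := mul_nonneg hbt' (by linarith : (0 : ℝ) ≤ t + b - 1)
  have h4 := nat_mul_pred_nonneg b
  rw [limitSum, limitSum]
  gcongr <;> apply hFG

/-- The limiting covariances. -/
theorem exists_secondOrder (hρ : 0 < ρ) (Γ : ℝ) (hΓ : 0 ≤ Γ) (K : ℝ) :
    ∃ (V : ℕ → ℝ) (K' : ℝ), 0 ≤ K' ∧ (∀ s, V s ≤ K' * 4 ^ s) ∧ ∀ γ, 0 ≤ γ → γ ≤ Γ →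
      ∀ d : ℕ → ℝ, (∀ n, 0 ≤ d n) → (∀ n, d n ≤ K) →
      ∃ c : ℕ → ℕ → ℕ → ℝ, (∀ s t b, 0 ≤ c s t b) ∧ (∀ s t b, c s t b ≤ V s) ∧
        (∀ t b, c 0 t b = 0) ∧ (∀ s b, c s 0 b = 0) ∧
        ∀ s t b, 1 ≤ s → 1 ≤ t → b ≤ s → b ≤ t →
          limitGen ρ γ c s t b = -(1 / 2 * (b * (b - 1)) * (d s * d t)) := by
  obtain ⟨D, K₁, hK0, hD0, hDK, hD⟩ := exists_geometric_supersolution hρ hΓ one_le_two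
  have hV0 := partialSum_nonneg hD0
  refine ⟨fun s => K ^ 2 * partialSum D s, K ^ 2 * K₁, by positivity, fun s => ?_,
    fun γ hγ hγΓ d hd0 hdK => ?_⟩
  · have h1 := partialSum_le hK0 one_le_two hDK s
    have h2 : (s : ℝ) ≤ 2 ^ s := by exact_mod_cast Nat.lt_two_pow_self.le
    calc K ^ 2 * partialSum D s ≤ K ^ 2 * (K₁ * (s * 2 ^ s)) := by gcongr
      _ ≤ K ^ 2 * (K₁ * (2 ^ s * 2 ^ s)) := by gcongr
      _ = _ := by rw [← mul_pow]; norm_num; ring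
  have hsrc : ∀ s t b : ℕ, 0 ≤ 1 / 2 * ((b : ℝ) * (b - 1)) * (d s * d t) := fun s t b => by
    have := nat_mul_pred_nonneg b
    have := hd0 s
    have := hd0 t
    positivity
  have hsuper : ∀ s t b : ℕ, 1 ≤ s → b ≤ s → 1 / 2 * ((b : ℝ) * (b - 1)) * (d s * d t) +
      limitGen ρ γ (fun s _ _ => K ^ 2 * partialSum D s) s t b ≤ 0 := by
    intro s t b hs hbs
    obtain ⟨m, rfl⟩ : ∃ m, s = m + 1 := ⟨s - 1, by omega⟩
    have e : limitGen ρ γ (fun s _ _ => K ^ 2 * partialSum D s) (m + 1) t b =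
        K ^ 2 * limitGen ρ γ (fun s _ _ => partialSum D s) (m + 1) t b := by
      simp only [limitGen]; ring
    rw [e, limitGen_partialSum]
    have h1 : d (m + 1) * d t ≤ K ^ 2 := by
      rw [sq]
      exact mul_le_mul (hdK _) (hdK _) (hd0 _) ((hd0 0).trans (hdK 0))
    -- The source is quadratic in `b ≤ s`, but the supersolution offers a factor linear in `s` times
    -- `B ^ s`; this is why `B = 2` is used instead of `B = 1`.
    have h2 : (b : ℝ) * (b - 1) ≤ (m + 1) * 2 ^ (m + 1) := by
      have hb : (b : ℝ) ≤ m + 1 := by exact_mod_cast hbs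
      have hb0 : (0 : ℝ) ≤ b := Nat.cast_nonneg b
      have hm : (m + 1 : ℝ) ≤ 2 ^ (m + 1) := by
        exact_mod_cast (Nat.lt_two_pow_self (n := m + 1)).le
      calc (b : ℝ) * (b - 1) ≤ b * b := by nlinarith
        _ ≤ (m + 1) * (m + 1) := by gcongr
        _ ≤ _ := by gcongr
    have h3 : 1 / 2 * ((b : ℝ) * (b - 1)) * (d (m + 1) * d t) ≤
        1 / 2 * ((m + 1) * 2 ^ (m + 1)) * K ^ 2 := by
      have := nat_mul_pred_nonneg b
      have := mul_nonneg (hd0 (m + 1)) (hd0 t)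
      gcongr
    have h4 := hD γ hγ hγΓ m
    have h5 : K ^ 2 * ((m + 1) / 2 * 2 ^ (m + 1)) ≤
        K ^ 2 * ((m + 1) / 2 * ((m + ρ) * D (m + 1) - γ * D (m + 2))) := by gcongr
    linarith
  classical
  -- The equation is solved for its diagonal term, which gives a monotone operator since all rates
  -- are nonnegative on admissible triples. Elsewhere the operator is `0`; this provides the
  -- boundary values for empty sets.
  obtain ⟨f, hf0, hfw, hf⟩ := exists_fixed_point_of_supersolution
    (E := ℕ × ℕ × ℕ)
    (fun f p => if 1 ≤ p.1 ∧ 1 ≤ p.2.1 ∧ p.2.2 ≤ p.1 ∧ p.2.2 ≤ p.2.1 then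
      (1 / 2 * ((p.2.2 : ℝ) * (p.2.2 - 1)) * (d p.1 * d p.2.1) +
        limitSum ρ γ (fun s t b => f (s, t, b)) p.1 p.2.1 p.2.2) /
          limitRate ρ γ p.1 p.2.1 p.2.2 else 0)
    (fun f g hfg p => by
      dsimp only
      split_ifs with hp
      · obtain ⟨h1, h2, h3, h4⟩ := hp
        have := limitRate_pos hρ hγ h1 h2 h3 h4
        have := limitSum_mono hρ.le hγ h1 h2 h3 h4 (F := fun s t b => f (s, t, b))
          (G := fun s t b => g (s, t, b)) fun s t b => hfg _
        gcongr
      · exact le_rfl)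
    (fun p => by
      dsimp only
      split_ifs with hp
      · obtain ⟨h1, h2, h3, h4⟩ := hp
        have := limitRate_pos hρ hγ h1 h2 h3 h4
        have e : limitSum ρ γ (fun s t b => (0 : ℕ × ℕ × ℕ → ℝ) (s, t, b)) p.1 p.2.1 p.2.2 = 0 := by
          simp [limitSum]
        rw [e, add_zero]
        exact div_nonneg (hsrc _ _ _) this.le
      · exact le_rfl)
    (w := fun p => K ^ 2 * partialSum D p.1)
    (fun p => mul_nonneg (sq_nonneg K) (hV0 _))
    (fun p => by
      dsimp only
      split_ifs with hp
      · obtain ⟨h1, h2, h3, h4⟩ := hp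
        rw [div_le_iff₀ (limitRate_pos hρ hγ h1 h2 h3 h4)]
        have := hsuper p.1 p.2.1 p.2.2 h1 h3
        rw [limitGen_eq] at this
        linarith
      · exact mul_nonneg (sq_nonneg K) (hV0 _))
  refine ⟨fun s t b => f (s, t, b), fun s t b => hf0 _, fun s t b => hfw _, fun t b => ?_,
    fun s b => ?_, fun s t b hs ht hbs hbt => ?_⟩
  · exact (congrFun hf (0, t, b)).symm.trans (by simp)
  · exact (congrFun hf (s, 0, b)).symm.trans (by simp)
  · have h := congrFun hf (s, t, b)
    simp only at h
    rw [if_pos ⟨hs, ht, hbs, hbt⟩, div_eq_iff (limitRate_pos hρ hγ hs ht hbs hbt).ne'] at h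
    rw [limitGen_eq]
    linarith

/-- The limiting second moments solve the limiting system. -/
theorem limitGen_add_mul {θ : ℝ} {d : ℕ → ℝ} (hd : ∀ n : ℕ, (n + ρ) * d (n + 1) = θ + γ * d (n + 2))
    {c : ℕ → ℕ → ℕ → ℝ} {s t b : ℕ} (hs : 1 ≤ s) (ht : 1 ≤ t)
    (hc : limitGen ρ γ c s t b = -(1 / 2 * (b * (b - 1)) * (d s * d t))) :
    limitGen ρ γ (fun s t b => c s t b + partialSum d s * partialSum d t) s t b =
      -(θ / 2 * (s * partialSum d t + t * partialSum d s)) := by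
  obtain ⟨s, rfl⟩ : ∃ m, s = m + 1 := ⟨s - 1, by omega⟩
  obtain ⟨t, rfl⟩ : ∃ m, t = m + 1 := ⟨t - 1, by omega⟩
  have e : limitGen ρ γ (fun s t b => c s t b + partialSum d s * partialSum d t) (s + 1) (t + 1) b =
      limitGen ρ γ c (s + 1) (t + 1) b +
        limitGen ρ γ (fun s t b => partialSum d s * partialSum d t) (s + 1) (t + 1) b := by
    simp only [limitGen]; ring
  have hs' := hd s
  have ht' := hd t
  rw [e, hc]
  simp only [limitGen, Nat.add_sub_cancel, partialSum_succ]
  push_cast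
  -- The product of first moments satisfies the system up to simultaneous coalescence of two shared
  -- lines, whose defect `b (b - 1) / 2 * d s * d t` is what the source of `c` cancels. The rest is
  -- the recursion of `d` at `s` and at `t`.
  linear_combination (-1 / 2 * (s + 1) * (partialSum d t + d (t + 1))) * hs' +
    (-1 / 2 * (t + 1) * (partialSum d s + d (s + 1))) * ht'

/-- The limiting first moments `d 1 + ... + d s` and covariances `c s t b`. -/
structure IsLimitSolution (ρ θ γ : ℝ) (d : ℕ → ℝ) (c : ℕ → ℕ → ℕ → ℝ) : Prop where
  d_nonneg : ∀ n, 0 ≤ d n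
  d_bdd : ∃ K, ∀ n, d n ≤ K
  d_eq : ∀ n : ℕ, (n + ρ) * d (n + 1) = θ + γ * d (n + 2)
  c_nonneg : ∀ s t b, 0 ≤ c s t b
  c_bdd : ∃ K, ∀ s t b, c s t b ≤ K * 4 ^ s
  c_zero_left : ∀ t b, c 0 t b = 0
  c_zero_right : ∀ s b, c s 0 b = 0
  c_eq : ∀ s t b, 1 ≤ s → 1 ≤ t → b ≤ s → b ≤ t →
    limitGen ρ γ c s t b = -(1 / 2 * (b * (b - 1)) * (d s * d t))

/-- There is a limiting solution for all `γ`, with bounds that are uniform in `γ ≤ 1`. -/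
theorem exists_isLimitSolution (hρ : 0 < ρ) {θ : ℝ} (hθ : 0 ≤ θ) :
    ∃ (d : ℝ → ℕ → ℝ) (c : ℝ → ℕ → ℕ → ℕ → ℝ) (K : ℝ) (V : ℕ → ℝ),
      (∀ γ, 0 ≤ γ → IsLimitSolution ρ θ γ (d γ) (c γ)) ∧
      ∀ γ, 0 ≤ γ → γ ≤ 1 → (∀ n, d γ n ≤ K) ∧ ∀ s t b, c γ s t b ≤ V s := by
  choose K hK0 hK using fun Γ : {Γ : ℝ // 0 ≤ Γ} => exists_firstOrder hρ hθ Γ.1 Γ.2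
  choose V K' hK'0 hV hc using fun Γ : {Γ : ℝ // 0 ≤ Γ} => exists_secondOrder hρ Γ.1 Γ.2 (K Γ)
  -- All `γ ≤ 1` are assigned the same `Γ = 1`, hence the same bounds; larger `γ` use `Γ = γ`.
  let g : ℝ → {Γ : ℝ // 0 ≤ Γ} := fun γ => ⟨max γ 1, zero_le_one.trans (le_max_right _ _)⟩
  have hex : ∀ γ, ∃ (d : ℕ → ℝ) (c : ℕ → ℕ → ℕ → ℝ), 0 ≤ γ → IsLimitSolution ρ θ γ d c ∧
      (∀ n, d n ≤ K (g γ)) ∧ ∀ s t b, c s t b ≤ V (g γ) s := fun γ => by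
    by_cases hγ : 0 ≤ γ
    · obtain ⟨d, hd0, hdK, hd⟩ := hK (g γ) γ hγ (le_max_left _ _)
      obtain ⟨c, h1, h2, h3, h4, h5⟩ := hc (g γ) γ hγ (le_max_left _ _) d hd0 hdK
      exact ⟨d, c, fun _ => ⟨⟨hd0, ⟨_, hdK⟩, hd, h1,
        ⟨_, fun s t b => (h2 s t b).trans (hV (g γ) s)⟩, h3, h4, h5⟩, hdK, h2⟩⟩
    · exact ⟨0, 0, fun h => absurd h hγ⟩
  choose d c hdc using hex
  refine ⟨d, c, K (g 1), V (g 1), fun γ hγ => (hdc γ hγ).1, fun γ hγ hγ1 => ?_⟩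
  have hg : g γ = g 1 := Subtype.ext (by simp only [g, max_self, max_eq_right hγ1])
  rw [← hg]
  exact (hdc γ hγ).2

end Moran

/-! ### Convergence of the moments at rate `1 / N`. -/

namespace Moran

variable {N : ℕ} {ρ θ γ : ℝ}

theorem dualGen_sub (F G : Finset (Fin N) → Finset (Fin N) → ℝ) (S T : Finset (Fin N)) :
    dualGen ρ γ (fun S T => F S T - G S T) S T = dualGen ρ γ F S T - dualGen ρ γ G S T := by
  simp only [dualGen, Finset.sum_sub_distrib]
  ring

theorem dualGen_add (F G : Finset (Fin N) → Finset (Fin N) → ℝ) (S T : Finset (Fin N)) :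
    dualGen ρ γ (fun S T => F S T + G S T) S T = dualGen ρ γ F S T + dualGen ρ γ G S T := by
  simp only [dualGen, Finset.sum_sub_distrib, Finset.sum_add_distrib]
  ring

theorem dualGen_const_mul (k : ℝ) (F : Finset (Fin N) → Finset (Fin N) → ℝ)
    (S T : Finset (Fin N)) :
    dualGen ρ γ (fun S T => k * F S T) S T = k * dualGen ρ γ F S T := by
  simp only [dualGen, ← mul_sub, ← Finset.mul_sum]
  ring

/-- The maximum principle for the dual process. -/
theorem nonpos_of_dualGen_pos (hρ : 0 ≤ ρ) (hγ : 0 ≤ γ)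
    {G : Finset (Fin N) → Finset (Fin N) → ℝ} {P : Finset (Fin N) → Finset (Fin N) → Prop}
    (h1 : ∀ S T, P S T → 0 < dualGen ρ γ G S T) (h2 : ∀ S T, ¬ P S T → G S T ≤ 0)
    (S T : Finset (Fin N)) : G S T ≤ 0 := by
  obtain ⟨⟨S₀, T₀⟩, hmax⟩ := Finite.exists_max fun p : Finset (Fin N) × Finset (Fin N) => G p.1 p.2
  refine (hmax (S, T)).trans ?_
  refine h2 _ _ fun hP => ?_
  have hle : ∀ S' T', G S' T' - G S₀ T₀ ≤ 0 := fun S' T' => sub_nonpos.2 (hmax (S', T'))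
  have hγN : 0 ≤ γ / (2 * N) := by positivity
  refine (h1 _ _ hP).not_ge ?_
  rw [dualGen]
  have e1 : ∑ i, ∑ j, (G (S₀.image (Function.update id j i)) (T₀.image (Function.update id j i)) -
    G S₀ T₀) ≤ 0 := Finset.sum_nonpos fun i _ => Finset.sum_nonpos fun j _ => hle _ _
  have e2 : ∑ i, (G (S₀.erase i) T₀ - G S₀ T₀) ≤ 0 := Finset.sum_nonpos fun i _ => hle _ _
  have e3 : ∑ i, (G S₀ (T₀.erase i) - G S₀ T₀) ≤ 0 := Finset.sum_nonpos fun i _ => hle _ _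
  have e4 : ∑ i, (G (insert i S₀) T₀ - G S₀ T₀) ≤ 0 := Finset.sum_nonpos fun i _ => hle _ _
  have e5 : ∑ i, (G S₀ (insert i T₀) - G S₀ T₀) ≤ 0 := Finset.sum_nonpos fun i _ => hle _ _
  have f2 := mul_nonpos_of_nonneg_of_nonpos (by positivity : 0 ≤ ρ / 2) (add_nonpos e2 e3)
  have f4 := mul_nonpos_of_nonneg_of_nonpos (by positivity : (0 : ℝ) ≤ S₀.card) e4
  have f5 := mul_nonpos_of_nonneg_of_nonpos (by positivity : (0 : ℝ) ≤ T₀.card) e5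
  have f6 := mul_nonpos_of_nonneg_of_nonpos hγN (add_nonpos f4 f5)
  linarith

/-- The finite-size term has a favourable sign: for nonnegative `D` and `γ` it only improves a
supersolution. -/
theorem dualGen_partialSum (hN : 1 ≤ N) (D : ℕ → ℝ) {S : Finset (Fin N)} {s : ℕ}
    (hS : S.card = s + 1) (T : Finset (Fin N)) :
    dualGen ρ γ (fun S _ => partialSum D S.card) S T =
      -((s + 1) / 2 * ((s + ρ) * D (s + 1) - γ * D (s + 2))) -
        γ / (2 * N) * (s + 1) ^ 2 * D (s + 2) := by
  have h := dualGen_card ρ γ hN (fun s _ _ => partialSum D s) S T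
  rw [hS] at h
  rw [h, limitGen_partialSum]
  simp only [partialSum_succ]
  push_cast
  ring

theorem dualGen_partialSum_right (hN : 1 ≤ N) (D : ℕ → ℝ) (S : Finset (Fin N))
    {T : Finset (Fin N)} {t : ℕ} (hT : T.card = t + 1) :
    dualGen ρ γ (fun _ T => partialSum D T.card) S T =
      -((t + 1) / 2 * ((t + ρ) * D (t + 1) - γ * D (t + 2))) -
        γ / (2 * N) * (t + 1) ^ 2 * D (t + 2) := by
  have h := dualGen_card ρ γ hN (fun _ t _ => partialSum D t) S T
  rw [hT] at h
  rw [h, limitGen_partialSum_right]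
  simp only [partialSum_succ]
  push_cast
  ring

/-- First moments converge at rate `1 / N`. -/
theorem IsLimitSolution.abs_integral_numGenes_sub_le {d : ℕ → ℝ} {c : ℕ → ℕ → ℕ → ℝ}
    (h : IsLimitSolution ρ θ γ d c) (hρ : 0 < ρ) (hθ : 0 ≤ θ) (hγ : 0 ≤ γ) :
    ∃ C, 0 ≤ C ∧ ∀ N : ℕ, 1 ≤ N → ∀ π : Measure (Population N), IsEquilibrium ρ θ γ π →
      ∀ S : Finset (Fin N),
        |∫ x, numGenes S x ∂π - partialSum d S.card| ≤ C / N * 4 ^ S.card := by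
  obtain ⟨D, K, hK0, hD0, hDK, hD⟩ := exists_geometric_supersolution hρ hγ one_le_two
  have hD := hD γ hγ le_rfl
  obtain ⟨Kd, hKd⟩ := h.d_bdd
  have hKd0 : 0 ≤ Kd := (h.d_nonneg 0).trans (hKd 0)
  refine ⟨(γ * Kd + 1) * K, by positivity, fun N hN π hπ S => ?_⟩
  have hN' : (0 : ℝ) < N := by exact_mod_cast hN
  -- The signed error minus a barrier of order `1 / N` has a strictly positive dual generator on
  -- nonempty sets and vanishes on `∅`. In the factor `γ * Kd + 1`, the first summand pays for the
  -- finite-size error of the limit solution and the second makes the inequality strict.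
  have hmain : ∀ ε : ℝ, |ε| = 1 → ε * (∫ x, numGenes S x ∂π - partialSum d S.card) -
      (γ * Kd + 1) / N * partialSum D S.card ≤ 0 := by
    intro ε hε
    refine nonpos_of_dualGen_pos hρ.le hγ (G := fun S _ : Finset (Fin N) =>
      ε * (∫ x, numGenes S x ∂π - partialSum d S.card) - (γ * Kd + 1) / N * partialSum D S.card)
      (P := fun S _ => S.Nonempty) (fun S T hS => ?_) (fun S T hS => ?_) S ∅
    · obtain ⟨s, hs⟩ : ∃ s, S.card = s + 1 := ⟨S.card - 1, by have := hS.card_pos; omega⟩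
      rw [dualGen_sub, dualGen_const_mul, dualGen_const_mul, dualGen_sub,
        dualGen_partialSum hN d hs, dualGen_partialSum hN D hs, h.d_eq s]
      have e : dualGen ρ γ (fun S _ => ∫ x, numGenes S x ∂π) S T = -(θ / 2 * (s + 1)) := by
        have h0 := hπ.dualGen_integral_numGenes hN hρ hθ hγ S
        have h1 : dualGen ρ γ (fun S _ => ∫ x, numGenes S x ∂π) S T =
            dualGen ρ γ (fun S _ => ∫ x, numGenes S x ∂π) S ∅ := by simp [dualGen]
        rw [hs] at h0
        push_cast at h0
        rw [h1]
        linarith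
      rw [e]
      have h2 := hD s
      have h3 := hD0 (s + 2)
      have h4 : |ε * (γ / (2 * N) * (s + 1) ^ 2 * d (s + 2))| ≤
          γ * Kd / N * ((s + 1) / 2 * 2 ^ (s + 1)) := by
        have hs2 : (s + 1 : ℝ) ≤ 2 ^ (s + 1) := by
          exact_mod_cast (Nat.lt_two_pow_self (n := s + 1)).le
        have h5 := h.d_nonneg (s + 2)
        rw [abs_mul, hε, one_mul, abs_of_nonneg (by positivity)]
        calc γ / (2 * N) * (s + 1) ^ 2 * d (s + 2) ≤ γ / (2 * N) * (s + 1) ^ 2 * Kd := by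
              gcongr
              exact hKd _
          _ = γ * Kd / N * ((s + 1) / 2 * (s + 1)) := by ring
          _ ≤ _ := by gcongr
      have h5 : (γ * Kd + 1) / N * ((s + 1) / 2 * 2 ^ (s + 1)) ≤
          (γ * Kd + 1) / N * ((s + 1) / 2 * ((s + ρ) * D (s + 1) - γ * D (s + 2)) +
            γ / (2 * N) * (s + 1) ^ 2 * D (s + 2)) := by
        refine mul_le_mul_of_nonneg_left ?_ (by positivity)
        have h6 : 0 ≤ γ / (2 * N) * (s + 1 : ℝ) ^ 2 * D (s + 2) := by positivity
        have h7 := mul_le_mul_of_nonneg_left h2 (by positivity : (0 : ℝ) ≤ (s + 1) / 2)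
        linarith
      have h6 : 0 < 1 / (N : ℝ) * ((s + 1) / 2 * 2 ^ (s + 1)) := by positivity
      have h7 : (γ * Kd + 1) / N * ((s + 1 : ℝ) / 2 * 2 ^ (s + 1)) =
          γ * Kd / N * ((s + 1) / 2 * 2 ^ (s + 1)) + 1 / N * ((s + 1) / 2 * 2 ^ (s + 1)) := by ring
      have h8 := (abs_le.1 h4).1
      linarith
    · rw [Finset.not_nonempty_iff_eq_empty.1 hS]
      simp [numGenes_empty, partialSum_zero]
  have hle := partialSum_le hK0 one_le_two hDK S.card
  have h1 := hmain 1 (by simp)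
  have h2 := hmain (-1) (by simp)
  have h3 : (γ * Kd + 1) / N * partialSum D S.card ≤ (γ * Kd + 1) * K / N * 4 ^ S.card := by
    have hs2 : (S.card : ℝ) ≤ 2 ^ S.card := by exact_mod_cast (Nat.lt_two_pow_self).le
    calc (γ * Kd + 1) / N * partialSum D S.card
        ≤ (γ * Kd + 1) / N * (K * (2 ^ S.card * 2 ^ S.card)) := by
          gcongr
          exact hle.trans (by gcongr)
      _ = _ := by rw [← mul_pow]; norm_num; ring
  rw [abs_le]
  constructor <;> linarith

/-- A growth bound for the limiting second moments; it decides how fast the barrier for second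
moments has to grow. -/
theorem IsLimitSolution.exists_moment_le {d : ℕ → ℝ} {c : ℕ → ℕ → ℕ → ℝ}
    (h : IsLimitSolution ρ θ γ d c) : ∃ K, 0 ≤ K ∧ ∀ s t b : ℕ,
      0 ≤ c s t b + partialSum d s * partialSum d t ∧
      c s t b + partialSum d s * partialSum d t ≤ K * (4 ^ s + 4 ^ t) := by
  obtain ⟨Kd, hKd⟩ := h.d_bdd
  have hKd0 : 0 ≤ Kd := (h.d_nonneg 0).trans (hKd 0)
  obtain ⟨K, hK⟩ := h.c_bdd
  have ha0 := partialSum_nonneg h.d_nonneg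
  have ha : ∀ s : ℕ, partialSum d s ≤ Kd * 2 ^ s := fun s => by
    have h1 := partialSum_le hKd0 le_rfl (by simpa using hKd) s
    rw [one_pow, mul_one] at h1
    refine h1.trans ?_
    gcongr
    exact_mod_cast (Nat.lt_two_pow_self (n := s)).le
  refine ⟨|K| + Kd ^ 2, by positivity, fun s t b =>
    ⟨add_nonneg (h.c_nonneg s t b) (mul_nonneg (ha0 s) (ha0 t)), ?_⟩⟩
  have h1 : c s t b ≤ |K| * (4 ^ s + 4 ^ t) := by
    calc c s t b ≤ K * 4 ^ s := hK s t b
      _ ≤ |K| * 4 ^ s := by gcongr; exact le_abs_self K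
      _ ≤ _ := by gcongr; exact le_add_of_nonneg_right (by positivity)
  have h2 : partialSum d s * partialSum d t ≤ Kd ^ 2 * (4 ^ s + 4 ^ t) := by
    have e : ∀ n : ℕ, (4 : ℝ) ^ n = (2 ^ n) ^ 2 := fun n => by
      rw [← pow_mul, mul_comm, pow_mul]; norm_num
    calc partialSum d s * partialSum d t ≤ (Kd * 2 ^ s) * (Kd * 2 ^ t) :=
          mul_le_mul (ha s) (ha t) (ha0 t) (by positivity)
      _ = Kd ^ 2 * (2 ^ s * 2 ^ t) := by ring
      _ ≤ Kd ^ 2 * (4 ^ s + 4 ^ t) := by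
          rw [e, e]
          gcongr
          nlinarith [sq_nonneg ((2 : ℝ) ^ s - 2 ^ t), sq_nonneg ((2 : ℝ) ^ s),
            sq_nonneg ((2 : ℝ) ^ t)]
  linarith

/-- The effect of the finite size of the population on the dual generator. -/
theorem abs_dualGen_correction_le {F : ℕ → ℕ → ℕ → ℝ} {K : ℝ} (hK : 0 ≤ K)
    (hF : ∀ s t b : ℕ, 0 ≤ F s t b ∧ F s t b ≤ K * (4 ^ s + 4 ^ t)) {s t b : ℕ} (hbs : b ≤ s)
    (hbt : b ≤ t) :
    |(s : ℝ) * ((t - b) * (F (s + 1) t (b + 1) - F (s + 1) t b) -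
        s * (F (s + 1) t b - F s t b)) +
      t * ((s - b) * (F s (t + 1) (b + 1) - F s (t + 1) b) -
        t * (F s (t + 1) b - F s t b))| ≤ 16 * K * (16 ^ s + 16 ^ t) := by
  set X : ℝ := 4 ^ s + 4 ^ t with hX
  have hs4 : (0 : ℝ) < 4 ^ s := by positivity
  have ht4 : (0 : ℝ) < 4 ^ t := by positivity
  have hb1 : ∀ b, F (s + 1) t b ≤ 4 * K * X := fun b => (hF _ _ b).2.trans (by
    rw [pow_succ, hX]; nlinarith)
  have hb2 : ∀ b, F s (t + 1) b ≤ 4 * K * X := fun b => (hF _ _ b).2.trans (by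
    rw [pow_succ, hX]; nlinarith)
  have hb3 : F s t b ≤ 4 * K * X := (hF _ _ b).2.trans (by rw [hX]; nlinarith)
  have hdiff : ∀ x y : ℝ, 0 ≤ x → x ≤ 4 * K * X → 0 ≤ y → y ≤ 4 * K * X → |x - y| ≤ 4 * K * X :=
    fun x y h1 h2 h3 h4 => abs_le.2 ⟨by linarith, by linarith⟩
  have d1 := hdiff _ _ (hF (s + 1) t (b + 1)).1 (hb1 _) (hF (s + 1) t b).1 (hb1 _)
  have d2 := hdiff _ _ (hF (s + 1) t b).1 (hb1 _) (hF s t b).1 hb3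
  have d3 := hdiff _ _ (hF s (t + 1) (b + 1)).1 (hb2 _) (hF s (t + 1) b).1 (hb2 _)
  have d4 := hdiff _ _ (hF s (t + 1) b).1 (hb2 _) (hF s t b).1 hb3
  have hs0 : (0 : ℝ) ≤ s := Nat.cast_nonneg s
  have ht0 : (0 : ℝ) ≤ t := Nat.cast_nonneg t
  have hb0 : (0 : ℝ) ≤ b := Nat.cast_nonneg b
  have hbs' : (b : ℝ) ≤ s := by exact_mod_cast hbs
  have hbt' : (b : ℝ) ≤ t := by exact_mod_cast hbt
  have hY : 0 ≤ 4 * K * X := by positivity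
  have hcoef : ∀ u v w z Y : ℝ, 0 ≤ u → 0 ≤ v → v ≤ w → |z| ≤ Y → |u * (v * z)| ≤ u * (w * Y) :=
    fun u v w z Y hu hv hvw hz => by
      rw [abs_mul, abs_mul, abs_of_nonneg hu, abs_of_nonneg hv]
      have := abs_nonneg z
      have := hv.trans hvw
      gcongr
  have c1 := hcoef s (t - b) t _ _ hs0 (by linarith) (by linarith) d1
  have c2 := hcoef s s s _ _ hs0 hs0 le_rfl d2
  have c3 := hcoef t (s - b) s _ _ ht0 (by linarith) (by linarith) d3
  have c4 := hcoef t t t _ _ ht0 ht0 le_rfl d4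
  have hsum : |(s : ℝ) * ((t - b) * (F (s + 1) t (b + 1) - F (s + 1) t b) -
        s * (F (s + 1) t b - F s t b)) +
      t * ((s - b) * (F s (t + 1) (b + 1) - F s (t + 1) b) -
        t * (F s (t + 1) b - F s t b))| ≤ (s + t) ^ 2 * (4 * K * X) := by
    rw [abs_le] at c1 c2 c3 c4 ⊢
    constructor <;> linarith [c1.1, c1.2, c2.1, c2.2, c3.1, c3.2, c4.1, c4.2]
  refine hsum.trans ?_
  have e : ∀ n : ℕ, (4 : ℝ) ^ n = (2 ^ n) ^ 2 := fun n => by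
    rw [← pow_mul, mul_comm, pow_mul]; norm_num
  have e' : ∀ n : ℕ, (16 : ℝ) ^ n = (4 ^ n) ^ 2 := fun n => by
    rw [← pow_mul, mul_comm n, pow_mul]; norm_num
  have hs2 : (s : ℝ) ≤ 2 ^ s := by exact_mod_cast (Nat.lt_two_pow_self).le
  have ht2 : (t : ℝ) ≤ 2 ^ t := by exact_mod_cast (Nat.lt_two_pow_self).le
  have h1 : ((s : ℝ) + t) ^ 2 ≤ 2 * X := by
    rw [hX, e, e]
    have := pow_le_pow_left₀ hs0 hs2 2
    have := pow_le_pow_left₀ ht0 ht2 2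
    nlinarith [sq_nonneg ((s : ℝ) - t)]
  have h2 : X ^ 2 ≤ 2 * (16 ^ s + 16 ^ t) := by
    rw [hX, e', e']
    nlinarith [sq_nonneg ((4 : ℝ) ^ s - 4 ^ t)]
  calc ((s : ℝ) + t) ^ 2 * (4 * K * X) ≤ 2 * X * (4 * K * X) := by gcongr
    _ = 8 * K * X ^ 2 := by ring
    _ ≤ 8 * K * (2 * (16 ^ s + 16 ^ t)) := by gcongr
    _ = _ := by ring

/-- Collects the two errors in the equation for second moments: the first moments in the gain term
are off by order `1 / N`, and the dual generator differs from its limit by `γ / (2 * N) * Z`. -/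
theorem abs_source_error_le (hN : 1 ≤ N) (hθ : 0 ≤ θ) (hγ : 0 ≤ γ) {s t : ℕ} {C K x y Z : ℝ}
    (hC : 0 ≤ C) (hx : |x| ≤ C / N * 4 ^ s) (hy : |y| ≤ C / N * 4 ^ t)
    (hZ : |Z| ≤ 16 * K * (16 ^ s + 16 ^ t)) :
    |θ / 2 * (s * y + t * x) + γ / (2 * N) * Z| ≤
      (8 * γ * K + θ * C) / N * (16 ^ s + 16 ^ t) := by
  have hN' : (0 : ℝ) < N := by exact_mod_cast hN
  have e' : ∀ n : ℕ, (16 : ℝ) ^ n = (4 ^ n) ^ 2 := fun n => by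
    rw [← pow_mul, mul_comm n, pow_mul]; norm_num
  have h4 : ∀ n : ℕ, (n : ℝ) ≤ 4 ^ n := fun n => by
    exact_mod_cast (Nat.lt_pow_self (by norm_num)).le
  have h1 : |(s : ℝ) * y| ≤ C / N * (4 ^ s * 4 ^ t) := by
    rw [abs_mul, Nat.abs_cast]
    calc (s : ℝ) * |y| ≤ 4 ^ s * (C / N * 4 ^ t) := by gcongr; exact h4 s
      _ = _ := by ring
  have h2 : |(t : ℝ) * x| ≤ C / N * (4 ^ s * 4 ^ t) := by
    rw [abs_mul, Nat.abs_cast]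
    calc (t : ℝ) * |x| ≤ 4 ^ t * (C / N * 4 ^ s) := by gcongr; exact h4 t
      _ = _ := by ring
  have h3 : (4 : ℝ) ^ s * 4 ^ t ≤ 16 ^ s + 16 ^ t := by
    rw [e', e']
    nlinarith [sq_nonneg ((4 : ℝ) ^ s - 4 ^ t), sq_nonneg ((4 : ℝ) ^ s), sq_nonneg ((4 : ℝ) ^ t)]
  calc |θ / 2 * (s * y + t * x) + γ / (2 * N) * Z|
      ≤ θ / 2 * (|s * y| + |t * x|) + γ / (2 * N) * |Z| := by
        refine (abs_add_le _ _).trans ?_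
        rw [abs_mul, abs_mul, abs_of_nonneg (by positivity : 0 ≤ θ / 2),
          abs_of_nonneg (by positivity : 0 ≤ γ / (2 * N))]
        gcongr
        exact abs_add_le _ _
    _ ≤ θ / 2 * (C / N * (16 ^ s + 16 ^ t) + C / N * (16 ^ s + 16 ^ t)) +
        γ / (2 * N) * (16 * K * (16 ^ s + 16 ^ t)) := by
        gcongr
        · exact h1.trans (by gcongr)
        · exact h2.trans (by gcongr)
    _ = _ := by ring

/-- Second moments converge at rate `1 / N`. -/
theorem IsLimitSolution.abs_integral_numPairs_sub_le {d : ℕ → ℝ} {c : ℕ → ℕ → ℕ → ℝ}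
    (h : IsLimitSolution ρ θ γ d c) (hρ : 0 < ρ) (hθ : 0 ≤ θ) (hγ : 0 ≤ γ) :
    ∃ W : ℕ → ℝ, ∀ N : ℕ, 1 ≤ N → ∀ π : Measure (Population N), IsEquilibrium ρ θ γ π →
      ∀ S T : Finset (Fin N),
        |∫ x, numPairs S T x ∂π -
          (c S.card T.card (S ∩ T).card + partialSum d S.card * partialSum d T.card)| ≤
          (W S.card + W T.card) / N := by
  -- The error terms grow at most like `16 ^ s + 16 ^ t`, so the barrier is built with `B = 16`.
  obtain ⟨D, K, hK0, hD0, hDK, hD⟩ :=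
    exists_geometric_supersolution hρ hγ (by norm_num : (1 : ℝ) ≤ 16)
  have hD := hD γ hγ le_rfl
  obtain ⟨C, hC0, hC⟩ := h.abs_integral_numGenes_sub_le hρ hθ hγ
  obtain ⟨K', hK'0, hF⟩ := h.exists_moment_le
  obtain ⟨F, hFdef⟩ : ∃ F : ℕ → ℕ → ℕ → ℝ,
    F = fun s t b => c s t b + partialSum d s * partialSum d t := ⟨_, rfl⟩
  have hFe : ∀ s t b, c s t b + partialSum d s * partialSum d t = F s t b := fun s t b => by
    rw [hFdef]
  simp only [hFe] at hF ⊢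
  -- The barrier yields only half of `16 ^ s + 16 ^ t`, hence the factor `2`; the summand `1` gives
  -- strictness.
  obtain ⟨L, hL⟩ : ∃ L, L = 2 * (8 * γ * K' + θ * C) + 1 := ⟨_, rfl⟩
  have hL0 : 0 ≤ L := by rw [hL]; positivity
  refine ⟨fun s => L * partialSum D s, fun N hN π hπ S T => ?_⟩
  have hN' : (0 : ℝ) < N := by exact_mod_cast hN
  have hmain : ∀ ε : ℝ, |ε| = 1 →
      ε * (∫ x, numPairs S T x ∂π - F S.card T.card (S ∩ T).card) -
        L / N * (partialSum D S.card + partialSum D T.card) ≤ 0 := by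
    intro ε hε
    refine nonpos_of_dualGen_pos hρ.le hγ (G := fun S T : Finset (Fin N) =>
      ε * (∫ x, numPairs S T x ∂π - F S.card T.card (S ∩ T).card) -
        L / N * (partialSum D S.card + partialSum D T.card))
      (P := fun S T => S.Nonempty ∧ T.Nonempty) (fun S T hST => ?_) (fun S T hST => ?_) S T
    · obtain ⟨s, hs⟩ : ∃ s, S.card = s + 1 := ⟨S.card - 1, by have := hST.1.card_pos; omega⟩
      obtain ⟨t, ht⟩ : ∃ t, T.card = t + 1 := ⟨T.card - 1, by have := hST.2.card_pos; omega⟩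
      have hbs : (S ∩ T).card ≤ S.card := Finset.card_le_card Finset.inter_subset_left
      have hbt : (S ∩ T).card ≤ T.card := Finset.card_le_card Finset.inter_subset_right
      rw [dualGen_sub, dualGen_const_mul, dualGen_const_mul, dualGen_sub, dualGen_add,
        dualGen_partialSum hN D hs, dualGen_partialSum_right hN D S ht, dualGen_card ρ γ hN]
      have e1 := hπ.dualGen_integral_numPairs hN hρ hθ hγ S T
      have e2 := limitGen_add_mul h.d_eq (by omega : 1 ≤ S.card) (by omega : 1 ≤ T.card)
        (h.c_eq S.card T.card (S ∩ T).card (by omega) (by omega) hbs hbt)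
      rw [← hFdef] at e2
      have hcor := abs_dualGen_correction_le hK'0 hF hbs hbt
      rw [e2]
      generalize (S.card : ℝ) * ((T.card - (S ∩ T).card) *
          (F (S.card + 1) T.card ((S ∩ T).card + 1) - F (S.card + 1) T.card (S ∩ T).card) -
        S.card * (F (S.card + 1) T.card (S ∩ T).card - F S.card T.card (S ∩ T).card)) +
        T.card * ((S.card - (S ∩ T).card) *
          (F S.card (T.card + 1) ((S ∩ T).card + 1) - F S.card (T.card + 1) (S ∩ T).card) -
        T.card * (F S.card (T.card + 1) (S ∩ T).card - F S.card T.card (S ∩ T).card)) = Z at *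
      have hE := abs_source_error_le hN hθ hγ hC0 (hC N hN π hπ S) (hC N hN π hπ T) hcor
      have e3 : dualGen ρ γ (fun S T => ∫ x, numPairs S T x ∂π) S T -
          (-(θ / 2 * (S.card * partialSum d T.card + T.card * partialSum d S.card)) +
            γ / (2 * N) * Z) =
          -(θ / 2 * (S.card * (∫ x, numGenes T x ∂π - partialSum d T.card) +
            T.card * (∫ x, numGenes S x ∂π - partialSum d S.card)) + γ / (2 * N) * Z) := by
        linear_combination e1
      rw [e3]
      have hE' := (neg_abs_le (ε * -(θ / 2 * (S.card * (∫ x, numGenes T x ∂π -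
        partialSum d T.card) + T.card * (∫ x, numGenes S x ∂π - partialSum d S.card)) +
          γ / (2 * N) * Z)))
      rw [abs_mul, abs_neg, hε, one_mul] at hE'
      have hsup : ∀ m : ℕ, 1 / 2 * (16 : ℝ) ^ (m + 1) ≤
          (m + 1) / 2 * ((m + ρ) * D (m + 1) - γ * D (m + 2)) +
            γ / (2 * N) * (m + 1) ^ 2 * D (m + 2) := fun m => by
        have h2 := hD0 (m + 2)
        have h3 : 0 ≤ γ / (2 * N) * (m + 1 : ℝ) ^ 2 * D (m + 2) := by positivity
        have h4 : 1 / 2 * (16 : ℝ) ^ (m + 1) ≤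
            (m + 1) / 2 * ((m + ρ) * D (m + 1) - γ * D (m + 2)) := by
          have := hD m
          have hm : (0 : ℝ) ≤ m := Nat.cast_nonneg m
          refine mul_le_mul ?_ this (by positivity) (by positivity)
          linarith
        linarith
      have hs' := hsup s
      have ht' := hsup t
      rw [← hs] at hs'
      rw [← ht] at ht'
      have hfin : L / N * (1 / 2 * (16 ^ S.card + 16 ^ T.card)) ≤ L / N *
          (((s + 1) / 2 * ((s + ρ) * D S.card - γ * D (s + 2)) +
            γ / (2 * N) * (s + 1) ^ 2 * D (s + 2)) +
          ((t + 1) / 2 * ((t + ρ) * D T.card - γ * D (t + 2)) +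
            γ / (2 * N) * (t + 1) ^ 2 * D (t + 2))) := by
        refine mul_le_mul_of_nonneg_left ?_ (by positivity)
        linarith
      have hpos : 0 < 1 / (N : ℝ) * (1 / 2 * (16 ^ S.card + 16 ^ T.card)) := by positivity
      have hLe : L / N * (1 / 2 * ((16 : ℝ) ^ S.card + 16 ^ T.card)) =
          (8 * γ * K' + θ * C) / N * (16 ^ S.card + 16 ^ T.card) +
            1 / N * (1 / 2 * (16 ^ S.card + 16 ^ T.card)) := by
        rw [hL]; ring
      rw [← hs, ← ht]
      linarith
    · have hV0 := partialSum_nonneg hD0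
      have h0 : ∫ x, numPairs S T x ∂π - F S.card T.card (S ∩ T).card = 0 := by
        rw [not_and_or, Finset.not_nonempty_iff_eq_empty, Finset.not_nonempty_iff_eq_empty] at hST
        rcases hST with rfl | rfl
        · simp [numPairs, numGenes_empty, hFdef, h.c_zero_left, partialSum_zero]
        · simp [numPairs, numGenes_empty, hFdef, h.c_zero_right, partialSum_zero]
      rw [h0, mul_zero, zero_sub, neg_nonpos]
      have := hV0 S.card
      have := hV0 T.card
      positivity
  have h1 := hmain 1 (by simp)
  have h2 := hmain (-1) (by simp)
  have h3 : (L * partialSum D S.card + L * partialSum D T.card) / N =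
    L / N * (partialSum D S.card + partialSum D T.card) := by ring
  rw [h3, abs_le]
  constructor <;> linarith

end Moran

/-! ### Limits of the variances. -/

namespace Moran

variable {N : ℕ} {ρ θ γ : ℝ}

theorem tendsto_of_abs_sub_le_div {f : ℕ → ℝ} {L C : ℝ}
    (h : ∀ᶠ N : ℕ in atTop, |f N - L| ≤ C / N) : Tendsto f atTop (𝓝 L) := by
  rw [tendsto_iff_norm_sub_tendsto_zero]
  refine squeeze_zero' (Eventually.of_forall fun _ => norm_nonneg _)
    (h.mono fun N hN => ?_) (tendsto_const_div_atTop_nhds_zero_nat C)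
  rwa [Real.norm_eq_abs]

section Limits

variable {d : ℕ → ℝ} {c : ℕ → ℕ → ℕ → ℝ} {π : (N : ℕ) → Measure (Population N)}
  {S T : (N : ℕ) → Finset (Fin N)} {s t b u : ℕ}

theorem IsLimitSolution.tendsto_integral_numGenes (h : IsLimitSolution ρ θ γ d c) (hρ : 0 < ρ)
    (hθ : 0 ≤ θ) (hγ : 0 ≤ γ) (hπ : ∀ N, 1 ≤ N → IsEquilibrium ρ θ γ (π N))
    (hS : ∀ᶠ N in atTop, (S N).card = s) :
    Tendsto (fun N => ∫ x, numGenes (S N) x ∂π N) atTop (𝓝 (partialSum d s)) := by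
  obtain ⟨C, hC0, hC⟩ := h.abs_integral_numGenes_sub_le hρ hθ hγ
  refine tendsto_of_abs_sub_le_div (C := C * 4 ^ s) ?_
  filter_upwards [hS, eventually_ge_atTop 1] with N hN h1
  have := hC N h1 (π N) (hπ N h1) (S N)
  rw [hN] at this
  refine this.trans_eq ?_
  ring

/-- The product of two counts is recovered from `numPairs` by adding back the pairs of equal genes,
whose number is again a combination of gene counts. -/
theorem IsLimitSolution.tendsto_integral_mul (h : IsLimitSolution ρ θ γ d c) (hρ : 0 < ρ)
    (hθ : 0 ≤ θ) (hγ : 0 ≤ γ) (hπ : ∀ N, 1 ≤ N → IsEquilibrium ρ θ γ (π N))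
    (hS : ∀ᶠ N in atTop, (S N).card = s) (hT : ∀ᶠ N in atTop, (T N).card = t)
    (hb : ∀ᶠ N in atTop, (S N ∩ T N).card = b) (hu : ∀ᶠ N in atTop, (S N ∪ T N).card = u) :
    Tendsto (fun N => ∫ x, numGenes (S N) x * numGenes (T N) x ∂π N) atTop
      (𝓝 (c s t b + partialSum d s * partialSum d t + partialSum d s + partialSum d t -
        partialSum d u)) := by
  obtain ⟨W, hW⟩ := h.abs_integral_numPairs_sub_le hρ hθ hγ
  have hP : Tendsto (fun N => ∫ x, numPairs (S N) (T N) x ∂π N) atTop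
      (𝓝 (c s t b + partialSum d s * partialSum d t)) := by
    refine tendsto_of_abs_sub_le_div (C := W s + W t) ?_
    filter_upwards [hS, hT, hb, eventually_ge_atTop 1] with N h1 h2 h3 h4
    have := hW N h4 (π N) (hπ N h4) (S N) (T N)
    rwa [h1, h2, h3] at this
  refine (((hP.add (h.tendsto_integral_numGenes hρ hθ hγ hπ hS)).add
    (h.tendsto_integral_numGenes hρ hθ hγ hπ hT)).sub
    (h.tendsto_integral_numGenes hρ hθ hγ hπ hu)).congr' ?_
  filter_upwards [eventually_ge_atTop 1] with N hN
  have i1 := (hπ N hN).integrable_numPairs hN hρ hθ hγ (S N) (T N)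
  have i2 := fun S => (hπ N hN).integrable_numGenes hN hρ hθ hγ S
  rw [← integral_add' i1 (i2 (S N)), ← integral_add' (i1.add (i2 (S N))) (i2 (T N)),
    ← integral_sub' ((i1.add (i2 (S N))).add (i2 (T N))) (i2 (S N ∪ T N))]
  refine integral_congr_ae (ae_of_all _ fun x => ?_)
  simp only [Pi.sub_apply, Pi.add_apply, numPairs]
  ring

end Limits

/-- The individuals with numbers `m, ..., n - 1`. -/
def sample (N m n : ℕ) : Finset (Fin N) := {i | m ≤ i.val ∧ i.val < n}

theorem card_sample {m n : ℕ} (h : n ≤ N) : (sample N m n).card = n - m := by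
  have : (sample N m n).map Fin.valEmbedding = Finset.Ico m n := by
    ext k
    simp only [sample, Finset.mem_map, Finset.mem_filter, Finset.mem_univ, true_and,
      Fin.valEmbedding_apply, Finset.mem_Ico]
    constructor
    · rintro ⟨i, hi, rfl⟩
      exact hi
    · intro hk
      exact ⟨⟨k, hk.2.trans_le h⟩, hk, rfl⟩
  rw [← Finset.card_map, this, Nat.card_Ico]

theorem mem_sample {m n : ℕ} {i : Fin N} : i ∈ sample N m n ↔ m ≤ i.val ∧ i.val < n := by
  simp [sample]

theorem avgGenes_one_eq (hN : 1 ≤ N) (x : Population N) :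
    avgGenes 1 x = numGenes (sample N 0 1) x := by
  have h1 : sample N 0 1 = {⟨0, hN⟩} := by
    ext i
    simp only [mem_sample, Finset.mem_singleton, Fin.ext_iff]
    omega
  have h2 : (Finset.univ.filter fun i : Fin N => i.val < 1) = {⟨0, hN⟩} := by
    ext i
    simp only [Finset.mem_filter, Finset.mem_univ, true_and, Finset.mem_singleton, Fin.ext_iff]
    omega
  rw [avgGenes, h1, h2, Finset.sum_singleton, card_genes_eq]
  simp

theorem card_sdiff_genes (x : Population N) (i j : Fin N) :
    (((x i).genes \ (x j).genes).card : ℝ) = numGenes {i, j} x - numGenes {j} x := by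
  have h := Finset.card_sdiff_add_card (x i).genes (x j).genes
  have e : numGenes {i, j} x = (((x i).genes ∪ (x j).genes).card : ℝ) := by
    simp [numGenes, unionGenes]
  rw [e, ← h, ← card_genes_eq]
  push_cast
  ring

/-- Each set difference is the union of the two genomes without the genes of one of them, so the
statistic is linear in gene counts. -/
theorem avgDiff_two_eq (hN : 2 ≤ N) (x : Population N) :
    avgDiff 2 x = numGenes (sample N 0 2) x -
      1 / 2 * (numGenes (sample N 0 1) x + numGenes (sample N 1 2) x) := by
  have hne : (⟨0, by omega⟩ : Fin N) ≠ ⟨1, by omega⟩ := by simp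
  have h1 : sample N 0 1 = {⟨0, by omega⟩} := by
    ext i
    simp only [mem_sample, Finset.mem_singleton, Fin.ext_iff]
    omega
  have h1' : sample N 1 2 = {⟨1, by omega⟩} := by
    ext i
    simp only [mem_sample, Finset.mem_singleton, Fin.ext_iff]
    omega
  have h2 : sample N 0 2 = {⟨0, by omega⟩, ⟨1, by omega⟩} := by
    ext i
    simp only [mem_sample, Finset.mem_singleton, Finset.mem_insert, Fin.ext_iff]
    omega
  have f2 : (Finset.univ.filter fun i : Fin N => i.val < 2) =
      {⟨0, by omega⟩, ⟨1, by omega⟩} := by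
    ext i
    simp only [Finset.mem_filter, Finset.mem_univ, true_and, Finset.mem_singleton,
      Finset.mem_insert, Fin.ext_iff]
    omega
  have f0 : (Finset.univ.filter fun j : Fin N => j.val < 2 ∧ (⟨0, by omega⟩ : Fin N) ≠ j) =
      {⟨1, by omega⟩} := by
    ext i
    simp only [Finset.mem_filter, Finset.mem_univ, true_and, Finset.mem_singleton, ne_eq,
      Fin.ext_iff]
    omega
  have f1 : (Finset.univ.filter fun j : Fin N => j.val < 2 ∧ (⟨1, by omega⟩ : Fin N) ≠ j) =
      {⟨0, by omega⟩} := by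
    ext i
    simp only [Finset.mem_filter, Finset.mem_univ, true_and, Finset.mem_singleton, ne_eq,
      Fin.ext_iff]
    omega
  rw [avgDiff, f2, Finset.sum_pair hne, f0, f1, Finset.sum_singleton, Finset.sum_singleton,
    card_sdiff_genes, card_sdiff_genes, h1, h1', h2, Finset.pair_comm (⟨1, by omega⟩ : Fin N)]
  push_cast
  ring

/-- Finite second moments are claimed for `N = 1` as well, where there is no second individual. -/
theorem avgDiff_two_of_one (x : Population 1) : avgDiff 2 x = 0 := by
  rw [avgDiff, mul_eq_zero]
  right
  refine Finset.sum_eq_zero fun i _ => Finset.sum_eq_zero fun j hj => ?_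
  exact absurd (Subsingleton.elim i j) (Finset.mem_filter.1 hj).2.2

section Variance

variable {π : Measure (Population N)}

theorem IsEquilibrium.memLp_numGenes (h : IsEquilibrium ρ θ γ π) (hN : 1 ≤ N) (hρ : 0 < ρ)
    (hθ : 0 ≤ θ) (hγ : 0 ≤ γ) (S : Finset (Fin N)) : MemLp (numGenes S) 2 π := by
  rw [memLp_two_iff_integrable_sq (measurable_numGenes S).aestronglyMeasurable]
  refine (h.integrable_numGenes_mul hN hρ hθ hγ S S).congr (ae_of_all _ fun x => ?_)
  simp only [sq]

theorem IsEquilibrium.memLp_avgGenes (h : IsEquilibrium ρ θ γ π) (hN : 1 ≤ N) (hρ : 0 < ρ)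
    (hθ : 0 ≤ θ) (hγ : 0 ≤ γ) : MemLp (avgGenes 1) 2 π := by
  rw [show (avgGenes 1 : Population N → ℝ) = numGenes (sample N 0 1) from
    funext (avgGenes_one_eq hN)]
  exact h.memLp_numGenes hN hρ hθ hγ _

theorem IsEquilibrium.memLp_avgDiff (h : IsEquilibrium ρ θ γ π) (hN : 1 ≤ N) (hρ : 0 < ρ)
    (hθ : 0 ≤ θ) (hγ : 0 ≤ γ) : MemLp (avgDiff 2) 2 π := by
  rcases hN.eq_or_lt with rfl | hN2
  · rw [show (avgDiff 2 : Population 1 → ℝ) = fun _ => 0 from funext avgDiff_two_of_one]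
    exact MemLp.zero'
  · rw [show (avgDiff 2 : Population N → ℝ) = fun x => numGenes (sample N 0 2) x -
      1 / 2 * (numGenes (sample N 0 1) x + numGenes (sample N 1 2) x) from
      funext (avgDiff_two_eq hN2)]
    have h := h.memLp_numGenes hN hρ hθ hγ
    exact (h _).sub (((h _).add (h _)).const_mul _)

theorem IsEquilibrium.variance_avgGenes (h : IsEquilibrium ρ θ γ π) (hN : 1 ≤ N) (hρ : 0 < ρ)
    (hθ : 0 ≤ θ) (hγ : 0 ≤ γ) : variance (avgGenes 1) π =
      ∫ x, numGenes (sample N 0 1) x * numGenes (sample N 0 1) x ∂π -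
        (∫ x, numGenes (sample N 0 1) x ∂π) ^ 2 := by
  have := h.prob
  rw [variance_eq_sub (h.memLp_avgGenes hN hρ hθ hγ), show (avgGenes 1 : Population N → ℝ) =
    numGenes (sample N 0 1) from funext (avgGenes_one_eq hN)]
  simp only [Pi.pow_apply, sq]

theorem IsEquilibrium.variance_avgDiff (h : IsEquilibrium ρ θ γ π) (hN : 2 ≤ N) (hρ : 0 < ρ)
    (hθ : 0 ≤ θ) (hγ : 0 ≤ γ) : variance (avgDiff 2) π =
      (∫ x, numGenes (sample N 0 2) x * numGenes (sample N 0 2) x ∂π +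
        1 / 4 * ∫ x, numGenes (sample N 0 1) x * numGenes (sample N 0 1) x ∂π +
        1 / 4 * ∫ x, numGenes (sample N 1 2) x * numGenes (sample N 1 2) x ∂π +
        1 / 2 * ∫ x, numGenes (sample N 0 1) x * numGenes (sample N 1 2) x ∂π -
        ∫ x, numGenes (sample N 0 2) x * numGenes (sample N 0 1) x ∂π -
        ∫ x, numGenes (sample N 0 2) x * numGenes (sample N 1 2) x ∂π) -
      (∫ x, numGenes (sample N 0 2) x ∂π - 1 / 2 * (∫ x, numGenes (sample N 0 1) x ∂π +
        ∫ x, numGenes (sample N 1 2) x ∂π)) ^ 2 := by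
  have := h.prob
  have hN1 : 1 ≤ N := by omega
  have i1 := fun S => h.integrable_numGenes hN1 hρ hθ hγ S
  have i2 := fun S T => h.integrable_numGenes_mul hN1 hρ hθ hγ S T
  rw [variance_eq_sub (h.memLp_avgDiff hN1 hρ hθ hγ), show (avgDiff 2 : Population N → ℝ) =
    fun x => numGenes (sample N 0 2) x -
      1 / 2 * (numGenes (sample N 0 1) x + numGenes (sample N 1 2) x) from
      funext (avgDiff_two_eq hN)]
  generalize sample N 0 2 = U
  generalize sample N 0 1 = S
  generalize sample N 1 2 = T
  congr 1
  · rw [← integral_const_mul, ← integral_const_mul, ← integral_const_mul,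
      ← integral_add' (i2 U U) ((i2 S S).const_mul _),
      ← integral_add' ((i2 U U).add ((i2 S S).const_mul _)) ((i2 T T).const_mul _),
      ← integral_add' (((i2 U U).add ((i2 S S).const_mul _)).add ((i2 T T).const_mul _))
        ((i2 S T).const_mul _),
      ← integral_sub' ((((i2 U U).add ((i2 S S).const_mul _)).add ((i2 T T).const_mul _)).add
        ((i2 S T).const_mul _)) (i2 U S),
      ← integral_sub' (((((i2 U U).add ((i2 S S).const_mul _)).add ((i2 T T).const_mul _)).add
        ((i2 S T).const_mul _)).sub (i2 U S)) (i2 U T)]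
    refine integral_congr_ae (ae_of_all _ fun x => ?_)
    simp only [Pi.add_apply, Pi.sub_apply, Pi.pow_apply]
    ring
  · rw [← integral_add' (i1 S) (i1 T), ← integral_const_mul,
      ← integral_sub' (i1 U) (((i1 S).add (i1 T)).const_mul _)]
    rfl

end Variance

section Limits

variable {d : ℕ → ℝ} {c : ℕ → ℕ → ℕ → ℝ} {π : (N : ℕ) → Measure (Population N)}

theorem eventually_card_sample (m n : ℕ) : ∀ᶠ N in atTop, (sample N m n).card = n - m :=
  (eventually_ge_atTop n).mono fun _ h => card_sample h

theorem IsLimitSolution.tendsto_variance_avgGenes (h : IsLimitSolution ρ θ γ d c) (hρ : 0 < ρ)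
    (hθ : 0 ≤ θ) (hγ : 0 ≤ γ) (hπ : ∀ N, 1 ≤ N → IsEquilibrium ρ θ γ (π N)) :
    Tendsto (fun N => variance (avgGenes 1) (π N)) atTop (𝓝 (c 1 1 1 + d 1)) := by
  have hS := eventually_card_sample 0 1
  have h1 := h.tendsto_integral_numGenes hρ hθ hγ hπ hS
  have h2 := h.tendsto_integral_mul hρ hθ hγ hπ hS hS (by simpa using hS) (by simpa using hS)
  have h3 := h2.sub (h1.pow 2)
  have e : c (1 - 0) (1 - 0) (1 - 0) + partialSum d (1 - 0) * partialSum d (1 - 0) +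
      partialSum d (1 - 0) + partialSum d (1 - 0) - partialSum d (1 - 0) -
      partialSum d (1 - 0) ^ 2 = c 1 1 1 + d 1 := by
    simp [partialSum]
    ring
  rw [e] at h3
  refine h3.congr' ?_
  filter_upwards [eventually_ge_atTop 1] with N hN
  rw [(hπ N hN).variance_avgGenes hN hρ hθ hγ]

/-- The products of first moments cancel against the squared mean. The covariances remain, together
with the terms from equal genes, which combine to half of `partialSum d 2 - partialSum d 1 = d 2`.
-/
theorem IsLimitSolution.tendsto_variance_avgDiff (h : IsLimitSolution ρ θ γ d c) (hρ : 0 < ρ)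
    (hθ : 0 ≤ θ) (hγ : 0 ≤ γ) (hπ : ∀ N, 1 ≤ N → IsEquilibrium ρ θ γ (π N)) :
    Tendsto (fun N => variance (avgDiff 2) (π N)) atTop
      (𝓝 (c 2 2 2 + 1 / 2 * (c 1 1 1 + c 1 1 0) - 2 * c 2 1 1 + 1 / 2 * d 2)) := by
  have hS : ∀ᶠ N in atTop, (sample N 0 1).card = 1 := eventually_card_sample 0 1
  have hT : ∀ᶠ N in atTop, (sample N 1 2).card = 1 := eventually_card_sample 1 2
  have hU : ∀ᶠ N in atTop, (sample N 0 2).card = 2 := eventually_card_sample 0 2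
  have iUS : ∀ N, sample N 0 2 ∩ sample N 0 1 = sample N 0 1 := fun N => by
    ext i; simp only [Finset.mem_inter, mem_sample]; omega
  have iUT : ∀ N, sample N 0 2 ∩ sample N 1 2 = sample N 1 2 := fun N => by
    ext i; simp only [Finset.mem_inter, mem_sample]; omega
  have iST : ∀ N, sample N 0 1 ∩ sample N 1 2 = ∅ := fun N => by
    ext i; simp only [Finset.mem_inter, mem_sample, Finset.notMem_empty, iff_false]; omega
  have uUS : ∀ N, sample N 0 2 ∪ sample N 0 1 = sample N 0 2 := fun N => by
    ext i; simp only [Finset.mem_union, mem_sample]; omega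
  have uUT : ∀ N, sample N 0 2 ∪ sample N 1 2 = sample N 0 2 := fun N => by
    ext i; simp only [Finset.mem_union, mem_sample]; omega
  have uST : ∀ N, sample N 0 1 ∪ sample N 1 2 = sample N 0 2 := fun N => by
    ext i; simp only [Finset.mem_union, mem_sample]; omega
  have aS := h.tendsto_integral_numGenes hρ hθ hγ hπ hS
  have aT := h.tendsto_integral_numGenes hρ hθ hγ hπ hT
  have aU := h.tendsto_integral_numGenes hρ hθ hγ hπ hU
  have mUU := h.tendsto_integral_mul hρ hθ hγ hπ hU hU (by simpa using hU) (by simpa using hU)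
  have mSS := h.tendsto_integral_mul hρ hθ hγ hπ hS hS (by simpa using hS) (by simpa using hS)
  have mTT := h.tendsto_integral_mul hρ hθ hγ hπ hT hT (by simpa using hT) (by simpa using hT)
  have mST := h.tendsto_integral_mul hρ hθ hγ hπ hS hT (b := 0) (by simp [iST])
    (by simpa only [uST] using hU)
  have mUS := h.tendsto_integral_mul hρ hθ hγ hπ hU hS (by simpa only [iUS] using hS)
    (by simpa only [uUS] using hU)
  have mUT := h.tendsto_integral_mul hρ hθ hγ hπ hU hT (by simpa only [iUT] using hT)
    (by simpa only [uUT] using hU)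
  have key := (((((mUU.add (mSS.const_mul (1 / 4))).add (mTT.const_mul (1 / 4))).add
    (mST.const_mul (1 / 2))).sub mUS).sub mUT).sub
    ((aU.sub ((aS.add aT).const_mul (1 / 2))).pow 2)
  have key' := key.congr' (f₂ := fun N => variance (avgDiff 2) (π N)) (by
    filter_upwards [eventually_ge_atTop 2] with N hN
    rw [(hπ N (by omega)).variance_avgDiff hN hρ hθ hγ])
  convert key' using 2
  simp only [partialSum, Finset.sum_range_succ, Finset.sum_range_zero]
  ring

end Limits

end Moran

/-! ### Orders in `γ` and the low-order equations. -/

namespace Moran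

/-- `f γ = O(γ ^ k)` as `γ → 0` with `γ ≥ 0`. -/
def IsOrder (k : ℕ) (f : ℝ → ℝ) : Prop := f =O[𝓝[≥] (0 : ℝ)] fun γ => γ ^ k

namespace IsOrder

variable {j k : ℕ} {f g : ℝ → ℝ}

theorem congr (hg : IsOrder k g) (h : ∀ γ, 0 ≤ γ → f γ = g γ) : IsOrder k f :=
  IsBigO.congr' hg (eventually_nhdsWithin_of_forall fun γ hγ => (h γ hγ).symm) EventuallyEq.rfl

theorem add (hf : IsOrder k f) (hg : IsOrder k g) : IsOrder k fun γ => f γ + g γ :=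
  IsBigO.add hf hg

theorem sub (hf : IsOrder k f) (hg : IsOrder k g) : IsOrder k fun γ => f γ - g γ :=
  IsBigO.sub hf hg

theorem const_mul (hf : IsOrder k f) (a : ℝ) : IsOrder k fun γ => a * f γ :=
  IsBigO.const_mul_left hf a

theorem mul (hf : IsOrder j f) (hg : IsOrder k g) : IsOrder (j + k) fun γ => f γ * g γ := by
  have := IsBigO.mul hf hg
  simpa only [IsOrder, pow_add] using this

/-- Drives the expansion: in every equation the transfer terms carry a factor `γ`, so a bound of
order `k` on them counts as order `k + 1`. -/
theorem shift (hf : IsOrder k f) : IsOrder (k + 1) fun γ => γ * f γ := by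
  have := IsBigO.mul (isBigO_refl (fun γ : ℝ => γ) (𝓝[≥] (0 : ℝ))) hf
  simpa only [IsOrder, pow_succ'] using this

theorem of_succ (hf : IsOrder (k + 1) f) : IsOrder k f := by
  refine IsBigO.trans hf (IsBigO.of_bound 1 ?_)
  have h1 : ∀ᶠ γ : ℝ in 𝓝[≥] 0, γ < 1 :=
    eventually_nhdsWithin_of_eventually_nhds (eventually_lt_nhds one_pos)
  filter_upwards [h1, self_mem_nhdsWithin] with γ hγ1 hγ0
  rw [Set.mem_Ici] at hγ0
  rw [Real.norm_of_nonneg (by positivity), Real.norm_of_nonneg (by positivity), one_mul]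
  exact pow_le_pow_of_le_one hγ0 hγ1.le (Nat.le_succ k)

theorem of_eq_const_mul {q : ℝ} (hq : q ≠ 0) (hg : IsOrder k g)
    (h : ∀ γ, 0 ≤ γ → q * f γ = g γ) : IsOrder k f :=
  (hg.const_mul q⁻¹).congr fun γ hγ => by rw [← h γ hγ, inv_mul_cancel_left₀ hq]

theorem const (a : ℝ) : IsOrder 0 fun _ => a := by
  simpa only [IsOrder, pow_zero] using isBigO_const_const a one_ne_zero _

theorem of_bdd {K : ℝ} (h : ∀ γ, 0 ≤ γ → γ ≤ 1 → |f γ| ≤ K) : IsOrder 0 f := by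
  refine IsBigO.of_bound K ?_
  have h1 : ∀ᶠ γ : ℝ in 𝓝[≥] 0, γ < 1 :=
    eventually_nhdsWithin_of_eventually_nhds (eventually_lt_nhds one_pos)
  filter_upwards [h1, self_mem_nhdsWithin] with γ hγ1 hγ0
  simpa using h γ hγ0 hγ1.le

end IsOrder

variable {ρ θ γ : ℝ} {d : ℕ → ℝ} {c : ℕ → ℕ → ℕ → ℝ}

section Equations

variable (h : IsLimitSolution ρ θ γ d c)

include h

/-- This and the following identities are instances of `c_eq`, solved for the diagonal term with
everything due to transfer collected behind a factor `γ`. At `γ = 0` they form a triangular system.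
-/
theorem IsLimitSolution.eq_one_one_one :
    ρ * c 1 1 1 = γ * (1 / 2 * (c 2 1 1 + c 1 2 1) - c 1 1 1) := by
  have := h.c_eq 1 1 1 le_rfl le_rfl le_rfl le_rfl
  norm_num [limitGen, h.c_zero_left, h.c_zero_right] at this
  linarith

theorem IsLimitSolution.eq_one_one_zero :
    (1 + ρ) * c 1 1 0 = c 1 1 1 + γ * (1 / 2 * (c 2 1 0 + c 1 2 0) - c 1 1 0) := by
  have := h.c_eq 1 1 0 le_rfl le_rfl (by norm_num) (by norm_num)
  norm_num [limitGen, h.c_zero_left, h.c_zero_right] at this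
  linarith

theorem IsLimitSolution.eq_two_one_one :
    (1 + 3 * ρ / 2) * c 2 1 1 = (1 + ρ / 2) * c 1 1 1 + ρ / 2 * c 1 1 0 +
      γ * (1 / 2 * c 2 2 1 + c 3 1 1 - 3 / 2 * c 2 1 1) := by
  have := h.c_eq 2 1 1 (by norm_num) le_rfl (by norm_num) le_rfl
  norm_num [limitGen, h.c_zero_left, h.c_zero_right] at this
  linarith

/-- Symmetry of `c` in its first two arguments is not established, so the mirrored equations are
recorded separately. -/
theorem IsLimitSolution.eq_one_two_one :
    (1 + 3 * ρ / 2) * c 1 2 1 = (1 + ρ / 2) * c 1 1 1 + ρ / 2 * c 1 1 0 +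
      γ * (1 / 2 * c 2 2 1 + c 1 3 1 - 3 / 2 * c 1 2 1) := by
  have := h.c_eq 1 2 1 le_rfl (by norm_num) le_rfl (by norm_num)
  norm_num [limitGen, h.c_zero_left, h.c_zero_right] at this
  linarith

theorem IsLimitSolution.eq_two_one_zero :
    (3 + 3 * ρ / 2) * c 2 1 0 = (1 + ρ) * c 1 1 0 + 2 * c 2 1 1 +
      γ * (c 3 1 0 + 1 / 2 * c 2 2 0 - 3 / 2 * c 2 1 0) := by
  have := h.c_eq 2 1 0 (by norm_num) le_rfl (by norm_num) (by norm_num)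
  norm_num [limitGen, h.c_zero_left, h.c_zero_right] at this
  linarith

theorem IsLimitSolution.eq_one_two_zero :
    (3 + 3 * ρ / 2) * c 1 2 0 = (1 + ρ) * c 1 1 0 + 2 * c 1 2 1 +
      γ * (c 1 3 0 + 1 / 2 * c 2 2 0 - 3 / 2 * c 1 2 0) := by
  have := h.c_eq 1 2 0 le_rfl (by norm_num) (by norm_num) (by norm_num)
  norm_num [limitGen, h.c_zero_left, h.c_zero_right] at this
  linarith

theorem IsLimitSolution.eq_three_one_one :
    (3 + 2 * ρ) * c 3 1 1 = (3 + ρ) * c 2 1 1 + ρ / 2 * c 2 1 0 +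
      γ * (3 / 2 * c 4 1 1 + 1 / 2 * c 3 2 1 - 2 * c 3 1 1) := by
  have := h.c_eq 3 1 1 (by norm_num) le_rfl (by norm_num) le_rfl
  norm_num [limitGen, h.c_zero_left, h.c_zero_right] at this
  linarith

theorem IsLimitSolution.eq_one_three_one :
    (3 + 2 * ρ) * c 1 3 1 = (3 + ρ) * c 1 2 1 + ρ / 2 * c 1 2 0 +
      γ * (3 / 2 * c 1 4 1 + 1 / 2 * c 2 3 1 - 2 * c 1 3 1) := by
  have := h.c_eq 1 3 1 le_rfl (by norm_num) le_rfl (by norm_num)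
  norm_num [limitGen, h.c_zero_left, h.c_zero_right] at this
  linarith

theorem IsLimitSolution.eq_two_two_one :
    (3 + 2 * ρ) * c 2 2 1 = (1 + ρ / 2) * (c 2 1 1 + c 1 2 1) + c 2 2 2 +
      ρ / 2 * (c 2 1 0 + c 1 2 0) + γ * (c 3 2 1 + c 2 3 1 - 2 * c 2 2 1) := by
  have := h.c_eq 2 2 1 (by norm_num) (by norm_num) (by norm_num) (by norm_num)
  norm_num [limitGen, h.c_zero_left, h.c_zero_right] at this
  linarith

theorem IsLimitSolution.eq_two_two_two :
    (1 + 2 * ρ) * c 2 2 2 = c 1 1 1 + d 2 * d 2 + ρ * (c 2 1 1 + c 1 2 1) +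
      γ * (c 3 2 2 + c 2 3 2 - 2 * c 2 2 2) := by
  have := h.c_eq 2 2 2 (by norm_num) (by norm_num) (by norm_num) (by norm_num)
  norm_num [limitGen, h.c_zero_left, h.c_zero_right] at this
  linarith

theorem IsLimitSolution.eq_three_two_two :
    (3 + 5 * ρ / 2) * c 3 2 2 = d 2 * d 3 + (2 + ρ / 2) * c 2 2 2 + c 2 1 1 + ρ * c 2 2 1 +
      ρ * c 3 1 1 + γ * (3 / 2 * c 4 2 2 + c 3 3 2 - 5 / 2 * c 3 2 2) := by
  have := h.c_eq 3 2 2 (by norm_num) (by norm_num) (by norm_num) (by norm_num)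
  norm_num [limitGen, h.c_zero_left, h.c_zero_right] at this
  linarith

theorem IsLimitSolution.eq_two_three_two :
    (3 + 5 * ρ / 2) * c 2 3 2 = d 2 * d 3 + (2 + ρ / 2) * c 2 2 2 + c 1 2 1 + ρ * c 2 2 1 +
      ρ * c 1 3 1 + γ * (3 / 2 * c 2 4 2 + c 3 3 2 - 5 / 2 * c 2 3 2) := by
  have := h.c_eq 2 3 2 (by norm_num) (by norm_num) (by norm_num) (by norm_num)
  norm_num [limitGen, h.c_zero_left, h.c_zero_right] at this
  linarith

end Equations

end Moran

/-! ### Perturbation expansion. -/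

namespace Moran

section Expansion

variable {ρ θ : ℝ} {d : ℝ → ℕ → ℝ} {c : ℝ → ℕ → ℕ → ℕ → ℝ}
  (hρ : 0 < ρ) (h : ∀ γ, 0 ≤ γ → IsLimitSolution ρ θ γ (d γ) (c γ))
  (hd : ∀ n, IsOrder 0 fun γ => d γ n) (hc : ∀ s t b, IsOrder 0 fun γ => c γ s t b)

include hρ h hd

theorem isOrder_d_sub (n : ℕ) : IsOrder 1 fun γ => d γ (n + 1) - θ / (n + ρ) := by
  have hn : (n + ρ : ℝ) ≠ 0 := by positivity
  refine IsOrder.of_eq_const_mul hn (hd (n + 2)).shift fun γ hγ => ?_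
  rw [mul_sub, (h γ hγ).d_eq n]
  field_simp
  ring

theorem isOrder_d_sub_two (n : ℕ) : IsOrder 2 fun γ => d γ (n + 1) -
    (θ / (n + ρ) + θ / ((n + ρ) * (n + 1 + ρ)) * γ) := by
  have hn : (n + ρ : ℝ) ≠ 0 := by positivity
  have hn1 : (n + 1 + ρ : ℝ) ≠ 0 := by positivity
  refine IsOrder.of_eq_const_mul hn (isOrder_d_sub hρ h hd (n + 1)).shift fun γ hγ => ?_
  rw [mul_sub, (h γ hγ).d_eq n]
  push_cast
  field_simp
  ring

theorem isOrder_d_sub_three (n : ℕ) : IsOrder 3 fun γ => d γ (n + 1) -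
    (θ / (n + ρ) + θ / ((n + ρ) * (n + 1 + ρ)) * γ +
      θ / ((n + ρ) * (n + 1 + ρ) * (n + 2 + ρ)) * γ ^ 2) := by
  have hn : (n + ρ : ℝ) ≠ 0 := by positivity
  have hn1 : (n + 1 + ρ : ℝ) ≠ 0 := by positivity
  have hn2 : (n + 2 + ρ : ℝ) ≠ 0 := by positivity
  refine IsOrder.of_eq_const_mul hn (isOrder_d_sub_two hρ h hd (n + 1)).shift fun γ hγ => ?_
  rw [mul_sub, (h γ hγ).d_eq n]
  push_cast
  rw [show (n + 1 + 1 + ρ : ℝ) = n + 2 + ρ by ring]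
  field_simp
  ring

/-- With `a = θ / (1 + ρ)`, write `d ^ 2 - a ^ 2 = (d - a) ^ 2 + 2 * a * (d - a)`: the square is of
second order already, and the linear part is expanded once more. -/
theorem isOrder_d_two_sq : IsOrder 2 fun γ => d γ 2 * d γ 2 -
    (θ ^ 2 / (1 + ρ) ^ 2 + 2 * θ ^ 2 / ((1 + ρ) ^ 2 * (2 + ρ)) * γ) := by
  have h1 := isOrder_d_sub hρ h hd 1
  have h2 := isOrder_d_sub_two hρ h hd 1
  refine ((h1.mul h1).add (h2.const_mul (2 * (θ / (1 + ρ))))).congr fun γ _ => ?_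
  have e1 : (1 + ρ : ℝ) ≠ 0 := by positivity
  have e2 : (2 + ρ : ℝ) ≠ 0 := by positivity
  push_cast
  rw [show (1 + 1 + ρ : ℝ) = 2 + ρ by ring]
  field_simp
  ring

theorem isOrder_d_two_mul_d_three : IsOrder 1 fun γ => d γ 2 * d γ 3 -
    θ ^ 2 / ((1 + ρ) * (2 + ρ)) := by
  have h1 := isOrder_d_sub hρ h hd 1
  have h2 := isOrder_d_sub hρ h hd 2
  refine (((h1.mul (hd 3)).add (h2.const_mul (θ / (1 + ρ))))).congr fun γ _ => ?_
  have e1 : (1 + ρ : ℝ) ≠ 0 := by positivity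
  have e2 : (2 + ρ : ℝ) ≠ 0 := by positivity
  push_cast
  field_simp
  ring

omit hd
include hc

/-- The source needs an overlap of two lines, hence `s, t ≥ 2`. From a set with a single line this
requires a transfer, so these covariances vanish at `γ = 0`. -/
theorem isOrder_one_one_one : IsOrder 1 fun γ => c γ 1 1 1 :=
  IsOrder.of_eq_const_mul hρ.ne'
    ((((hc 2 1 1).add (hc 1 2 1)).const_mul (1 / 2)).sub (hc 1 1 1)).shift
    fun γ hγ => (h γ hγ).eq_one_one_one

theorem isOrder_one_one_zero : IsOrder 1 fun γ => c γ 1 1 0 :=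
  IsOrder.of_eq_const_mul (by positivity)
    ((isOrder_one_one_one hρ h hc).add
      ((((hc 2 1 0).add (hc 1 2 0)).const_mul (1 / 2)).sub (hc 1 1 0)).shift)
    fun γ hγ => (h γ hγ).eq_one_one_zero

theorem isOrder_two_one_one : IsOrder 1 fun γ => c γ 2 1 1 :=
  IsOrder.of_eq_const_mul (by positivity)
    ((((isOrder_one_one_one hρ h hc).const_mul (1 + ρ / 2)).add
      ((isOrder_one_one_zero hρ h hc).const_mul (ρ / 2))).add
      ((((hc 2 2 1).const_mul (1 / 2)).add (hc 3 1 1)).sub ((hc 2 1 1).const_mul (3 / 2))).shift)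
    fun γ hγ => (h γ hγ).eq_two_one_one

theorem isOrder_one_two_one : IsOrder 1 fun γ => c γ 1 2 1 :=
  IsOrder.of_eq_const_mul (by positivity)
    ((((isOrder_one_one_one hρ h hc).const_mul (1 + ρ / 2)).add
      ((isOrder_one_one_zero hρ h hc).const_mul (ρ / 2))).add
      ((((hc 2 2 1).const_mul (1 / 2)).add (hc 1 3 1)).sub ((hc 1 2 1).const_mul (3 / 2))).shift)
    fun γ hγ => (h γ hγ).eq_one_two_one

theorem isOrder_two_one_zero : IsOrder 1 fun γ => c γ 2 1 0 :=
  IsOrder.of_eq_const_mul (by positivity)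
    ((((isOrder_one_one_zero hρ h hc).const_mul (1 + ρ)).add
      ((isOrder_two_one_one hρ h hc).const_mul 2)).add
      (((hc 3 1 0).add ((hc 2 2 0).const_mul (1 / 2))).sub ((hc 2 1 0).const_mul (3 / 2))).shift)
    fun γ hγ => (h γ hγ).eq_two_one_zero

theorem isOrder_one_two_zero : IsOrder 1 fun γ => c γ 1 2 0 :=
  IsOrder.of_eq_const_mul (by positivity)
    ((((isOrder_one_one_zero hρ h hc).const_mul (1 + ρ)).add
      ((isOrder_one_two_one hρ h hc).const_mul 2)).add
      (((hc 1 3 0).add ((hc 2 2 0).const_mul (1 / 2))).sub ((hc 1 2 0).const_mul (3 / 2))).shift)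
    fun γ hγ => (h γ hγ).eq_one_two_zero

theorem isOrder_three_one_one : IsOrder 1 fun γ => c γ 3 1 1 :=
  IsOrder.of_eq_const_mul (by positivity)
    ((((isOrder_two_one_one hρ h hc).const_mul (3 + ρ)).add
      ((isOrder_two_one_zero hρ h hc).const_mul (ρ / 2))).add
      ((((hc 4 1 1).const_mul (3 / 2)).add ((hc 3 2 1).const_mul (1 / 2))).sub
        ((hc 3 1 1).const_mul 2)).shift)
    fun γ hγ => (h γ hγ).eq_three_one_one

theorem isOrder_one_three_one : IsOrder 1 fun γ => c γ 1 3 1 :=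
  IsOrder.of_eq_const_mul (by positivity)
    ((((isOrder_one_two_one hρ h hc).const_mul (3 + ρ)).add
      ((isOrder_one_two_zero hρ h hc).const_mul (ρ / 2))).add
      ((((hc 1 4 1).const_mul (3 / 2)).add ((hc 2 3 1).const_mul (1 / 2))).sub
        ((hc 1 3 1).const_mul 2)).shift)
    fun γ hγ => (h γ hγ).eq_one_three_one

/-- Second pass through the same equation: the neighbours are now known to be of order one. In the
dual picture both sets have to gain a line by transfer before two lines can be shared. -/
theorem isOrder_two_of_one_one_one : IsOrder 2 fun γ => c γ 1 1 1 :=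
  IsOrder.of_eq_const_mul hρ.ne'
    ((((isOrder_two_one_one hρ h hc).add (isOrder_one_two_one hρ h hc)).const_mul (1 / 2)).sub
      (isOrder_one_one_one hρ h hc)).shift
    fun γ hγ => (h γ hγ).eq_one_one_one

theorem isOrder_two_of_one_one_zero : IsOrder 2 fun γ => c γ 1 1 0 :=
  IsOrder.of_eq_const_mul (by positivity)
    ((isOrder_two_of_one_one_one hρ h hc).add
      ((((isOrder_two_one_zero hρ h hc).add (isOrder_one_two_zero hρ h hc)).const_mul (1 / 2)).sub
        (isOrder_one_one_zero hρ h hc)).shift)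
    fun γ hγ => (h γ hγ).eq_one_one_zero

include hd

theorem isOrder_two_two_two_sub : IsOrder 1 fun γ => c γ 2 2 2 -
    θ ^ 2 / ((1 + ρ) ^ 2 * (1 + 2 * ρ)) := by
  have hq : 1 + 2 * ρ ≠ 0 := by positivity
  have h1 := (isOrder_d_two_sq hρ h hd).of_succ.add
    ((IsOrder.const (2 * θ ^ 2 / ((1 + ρ) ^ 2 * (2 + ρ)))).shift)
  refine IsOrder.of_eq_const_mul hq (((h1.add (isOrder_one_one_one hρ h hc)).add
    (((isOrder_two_one_one hρ h hc).add (isOrder_one_two_one hρ h hc)).const_mul ρ)).add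
    (((hc 3 2 2).add (hc 2 3 2)).sub ((hc 2 2 2).const_mul 2)).shift) fun γ hγ => ?_
  rw [mul_sub, (h γ hγ).eq_two_two_two]
  have e1 : (1 + ρ : ℝ) ≠ 0 := by positivity
  have e3 : (1 + 2 * ρ) * (θ ^ 2 / ((1 + ρ) ^ 2 * (1 + 2 * ρ))) = θ ^ 2 / (1 + ρ) ^ 2 := by
    field_simp
  rw [e3]
  ring

/-- At `γ = 0` the only non-vanishing neighbour is `(2, 2, 2)`, reached at rate `1` when the two
unshared lines coalesce, out of a total rate `3 + 2 * ρ`. -/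
theorem isOrder_two_two_one_sub : IsOrder 1 fun γ => c γ 2 2 1 -
    θ ^ 2 / ((1 + ρ) ^ 2 * (1 + 2 * ρ)) / (3 + 2 * ρ) := by
  have hq : 3 + 2 * ρ ≠ 0 := by positivity
  refine IsOrder.of_eq_const_mul hq ((((((isOrder_two_one_one hρ h hc).add
    (isOrder_one_two_one hρ h hc)).const_mul (1 + ρ / 2)).add
    (isOrder_two_two_two_sub hρ h hd hc)).add
    (((isOrder_two_one_zero hρ h hc).add (isOrder_one_two_zero hρ h hc)).const_mul (ρ / 2))).add
    (((hc 3 2 1).add (hc 2 3 1)).sub ((hc 2 2 1).const_mul 2)).shift) fun γ hγ => ?_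
  rw [mul_sub, (h γ hγ).eq_two_two_one, mul_div_cancel₀ _ hq]
  ring

theorem isOrder_three_two_two_sub : IsOrder 1 fun γ => c γ 3 2 2 -
    (θ ^ 2 / ((1 + ρ) * (2 + ρ)) + (2 + ρ / 2) * (θ ^ 2 / ((1 + ρ) ^ 2 * (1 + 2 * ρ))) +
      ρ * (θ ^ 2 / ((1 + ρ) ^ 2 * (1 + 2 * ρ)) / (3 + 2 * ρ))) / (3 + 5 * ρ / 2) := by
  have hq : 3 + 5 * ρ / 2 ≠ 0 := by positivity
  refine IsOrder.of_eq_const_mul hq (((((((isOrder_d_two_mul_d_three hρ h hd).add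
    ((isOrder_two_two_two_sub hρ h hd hc).const_mul (2 + ρ / 2))).add
    (isOrder_two_one_one hρ h hc)).add
    ((isOrder_two_two_one_sub hρ h hd hc).const_mul ρ)).add
    ((isOrder_three_one_one hρ h hc).const_mul ρ))).add
    ((((hc 4 2 2).const_mul (3 / 2)).add (hc 3 3 2)).sub
      ((hc 3 2 2).const_mul (5 / 2))).shift) fun γ hγ => ?_
  rw [mul_sub, (h γ hγ).eq_three_two_two, mul_div_cancel₀ _ hq]
  ring

theorem isOrder_two_three_two_sub : IsOrder 1 fun γ => c γ 2 3 2 -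
    (θ ^ 2 / ((1 + ρ) * (2 + ρ)) + (2 + ρ / 2) * (θ ^ 2 / ((1 + ρ) ^ 2 * (1 + 2 * ρ))) +
      ρ * (θ ^ 2 / ((1 + ρ) ^ 2 * (1 + 2 * ρ)) / (3 + 2 * ρ))) / (3 + 5 * ρ / 2) := by
  have hq : 3 + 5 * ρ / 2 ≠ 0 := by positivity
  refine IsOrder.of_eq_const_mul hq (((((((isOrder_d_two_mul_d_three hρ h hd).add
    ((isOrder_two_two_two_sub hρ h hd hc).const_mul (2 + ρ / 2))).add
    (isOrder_one_two_one hρ h hc)).add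
    ((isOrder_two_two_one_sub hρ h hd hc).const_mul ρ)).add
    ((isOrder_one_three_one hρ h hc).const_mul ρ))).add
    ((((hc 2 4 2).const_mul (3 / 2)).add (hc 3 3 2)).sub
      ((hc 2 3 2).const_mul (5 / 2))).shift) fun γ hγ => ?_
  rw [mul_sub, (h γ hγ).eq_two_three_two, mul_div_cancel₀ _ hq]
  ring

/-- The leading contribution is one transfer into the second set, at rate `γ / 2`, to `(2, 2, 1)`;
all other neighbours contribute at second order. -/
theorem isOrder_two_one_one_sub : IsOrder 2 fun γ => c γ 2 1 1 -
    γ * (1 / 2 * (θ ^ 2 / ((1 + ρ) ^ 2 * (1 + 2 * ρ)) / (3 + 2 * ρ)) / (1 + 3 * ρ / 2)) := by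
  have hq : 1 + 3 * ρ / 2 ≠ 0 := by positivity
  refine IsOrder.of_eq_const_mul hq
    ((((isOrder_two_of_one_one_one hρ h hc).const_mul (1 + ρ / 2)).add
      ((isOrder_two_of_one_one_zero hρ h hc).const_mul (ρ / 2))).add
      ((((isOrder_two_two_one_sub hρ h hd hc).const_mul (1 / 2)).add
        (isOrder_three_one_one hρ h hc)).sub
        ((isOrder_two_one_one hρ h hc).const_mul (3 / 2))).shift) fun γ hγ => ?_
  rw [mul_sub, (h γ hγ).eq_two_one_one, mul_left_comm, mul_div_cancel₀ _ hq]
  ring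

theorem isOrder_one_two_one_sub : IsOrder 2 fun γ => c γ 1 2 1 -
    γ * (1 / 2 * (θ ^ 2 / ((1 + ρ) ^ 2 * (1 + 2 * ρ)) / (3 + 2 * ρ)) / (1 + 3 * ρ / 2)) := by
  have hq : 1 + 3 * ρ / 2 ≠ 0 := by positivity
  refine IsOrder.of_eq_const_mul hq
    ((((isOrder_two_of_one_one_one hρ h hc).const_mul (1 + ρ / 2)).add
      ((isOrder_two_of_one_one_zero hρ h hc).const_mul (ρ / 2))).add
      ((((isOrder_two_two_one_sub hρ h hd hc).const_mul (1 / 2)).add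
        (isOrder_one_three_one hρ h hc)).sub
        ((isOrder_one_two_one hρ h hc).const_mul (3 / 2))).shift) fun γ hγ => ?_
  rw [mul_sub, (h γ hγ).eq_one_two_one, mul_left_comm, mul_div_cancel₀ _ hq]
  ring

theorem isOrder_one_one_one_sub : IsOrder 3 fun γ => c γ 1 1 1 - γ ^ 2 *
    (1 / 2 * (θ ^ 2 / ((1 + ρ) ^ 2 * (1 + 2 * ρ)) / (3 + 2 * ρ)) / (1 + 3 * ρ / 2) / ρ) := by
  refine IsOrder.of_eq_const_mul hρ.ne'
    ((((isOrder_two_one_one_sub hρ h hd hc).add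
      (isOrder_one_two_one_sub hρ h hd hc)).const_mul (1 / 2)).sub
      (isOrder_two_of_one_one_one hρ h hc)).shift fun γ hγ => ?_
  rw [mul_sub, (h γ hγ).eq_one_one_one, mul_left_comm, mul_div_cancel₀ _ hρ.ne']
  ring

/-- The first-order coefficient has four sources: the correction of `d 2 * d 2`, losses to `(2, 1,
1)` and `(1, 2, 1)`, transfers to `(3, 2, 2)` and `(2, 3, 2)` at leading order, and the outflow `-2
* c 2 2 2`. The state `(1, 1, 1)` enters only at order two. -/
theorem isOrder_two_two_two_sub_two : IsOrder 2 fun γ => c γ 2 2 2 -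
    (θ ^ 2 / ((1 + ρ) ^ 2 * (1 + 2 * ρ)) + γ *
      ((2 * θ ^ 2 / ((1 + ρ) ^ 2 * (2 + ρ)) +
      2 * ρ *
        (1 / 2 * (θ ^ 2 / ((1 + ρ) ^ 2 * (1 + 2 * ρ)) / (3 + 2 * ρ)) / (1 + 3 * ρ / 2)) +
      2 * ((θ ^ 2 / ((1 + ρ) * (2 + ρ)) + (2 + ρ / 2) * (θ ^ 2 / ((1 + ρ) ^ 2 * (1 + 2 * ρ))) +
        ρ * (θ ^ 2 / ((1 + ρ) ^ 2 * (1 + 2 * ρ)) / (3 + 2 * ρ))) / (3 + 5 * ρ / 2)) -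
      2 * (θ ^ 2 / ((1 + ρ) ^ 2 * (1 + 2 * ρ)))) / (1 + 2 * ρ))) := by
  have hq : 1 + 2 * ρ ≠ 0 := by positivity
  refine IsOrder.of_eq_const_mul hq ((((isOrder_d_two_sq hρ h hd).add
    (isOrder_two_of_one_one_one hρ h hc)).add
    (((isOrder_two_one_one_sub hρ h hd hc).add
      (isOrder_one_two_one_sub hρ h hd hc)).const_mul ρ)).add
    (((isOrder_three_two_two_sub hρ h hd hc).add
      (isOrder_two_three_two_sub hρ h hd hc)).sub
      ((isOrder_two_two_two_sub hρ h hd hc).const_mul 2)).shift) fun γ hγ => ?_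
  have e1 : (1 + ρ : ℝ) ≠ 0 := by positivity
  have e3 : (1 + 2 * ρ) * (θ ^ 2 / ((1 + ρ) ^ 2 * (1 + 2 * ρ))) = θ ^ 2 / (1 + ρ) ^ 2 := by
    field_simp
  rw [mul_sub, mul_add, e3, (h γ hγ).eq_two_two_two, mul_left_comm, mul_div_cancel₀ _ hq]
  ring

theorem isBigO_variance_avgGenes : (fun γ : ℝ => (c γ 1 1 1 + d γ 1) -
      θ / ρ * (1 + 1 / (1 + ρ) * γ +
        (1 / ((1 + ρ) * (2 + ρ)) +
          θ / ((1 + ρ) ^ 2 * (3 + 2 * ρ) * (2 + 7 * ρ + 6 * ρ ^ 2))) * γ ^ 2))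
    =O[𝓝[≥] 0] (fun γ : ℝ => γ ^ 3) := by
  refine ((isOrder_one_one_one_sub hρ h hd hc).add (isOrder_d_sub_three hρ h hd 0)).congr
    fun γ _ => ?_
  -- Splitting the quadratic exposes the factors `1 + 2 * ρ` of state `(2, 2, 2)` and `2 + 3 * ρ` of
  -- state `(2, 1, 1)`.
  have e0 : (2 + 7 * ρ + 6 * ρ ^ 2 : ℝ) = (2 + 3 * ρ) * (1 + 2 * ρ) := by ring
  have e1 : (1 + ρ : ℝ) ≠ 0 := by positivity
  have e2 : (2 + ρ : ℝ) ≠ 0 := by positivity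
  have e3 : (1 + 2 * ρ : ℝ) ≠ 0 := by positivity
  have e4 : (3 + 2 * ρ : ℝ) ≠ 0 := by positivity
  have e5 : (2 + 3 * ρ : ℝ) ≠ 0 := by positivity
  have e6 : (1 + 3 * ρ / 2 : ℝ) = (2 + 3 * ρ) / 2 := by ring
  rw [e0, e6]
  push_cast
  simp only [zero_add]
  field_simp
  ring

theorem isBigO_variance_avgDiff : (fun γ : ℝ =>
      (c γ 2 2 2 + 1 / 2 * (c γ 1 1 1 + c γ 1 1 0) - 2 * c γ 2 1 1 + 1 / 2 * d γ 2) -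
      θ / (1 + ρ) * (1 / 2 + θ / ((1 + ρ) * (1 + 2 * ρ)) +
        (1 / (2 * (2 + ρ)) +
          θ * (2 * (12 + 110 * ρ + 248 * ρ ^ 2 + 209 * ρ ^ 3 + 60 * ρ ^ 4) /
            ((1 + ρ) * (2 + ρ) * (1 + 2 * ρ) ^ 2 * (3 + 2 * ρ) * (2 + 3 * ρ) *
              (6 + 5 * ρ)))) * γ))
    =O[𝓝[≥] 0] (fun γ : ℝ => γ ^ 2) := by
  refine ((((isOrder_two_two_two_sub_two hρ h hd hc).add
    (((isOrder_two_of_one_one_one hρ h hc).add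
      (isOrder_two_of_one_one_zero hρ h hc)).const_mul (1 / 2))).sub
    ((isOrder_two_one_one_sub hρ h hd hc).const_mul 2)).add
    ((isOrder_d_sub_two hρ h hd 1).const_mul (1 / 2))).congr fun γ _ => ?_
  have e1 : (1 + ρ : ℝ) ≠ 0 := by positivity
  have e2 : (2 + ρ : ℝ) ≠ 0 := by positivity
  have e3 : (1 + 2 * ρ : ℝ) ≠ 0 := by positivity
  have e4 : (3 + 2 * ρ : ℝ) ≠ 0 := by positivity
  have e5 : (2 + 3 * ρ : ℝ) ≠ 0 := by positivity
  have e6 : (1 + 3 * ρ / 2 : ℝ) = (2 + 3 * ρ) / 2 := by ring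
  have e7 : (3 + 5 * ρ / 2 : ℝ) = (6 + 5 * ρ) / 2 := by ring
  have e8 : (6 + 5 * ρ : ℝ) ≠ 0 := by positivity
  rw [e6, e7]
  push_cast
  rw [show (1 + 1 + ρ : ℝ) = 2 + ρ by ring]
  field_simp
  ring

end Expansion

end Moran

end

/-! ### The theorem. -/

theorem theorem3 (ρ θ : ℝ) (hρ : 0 < ρ) (hθ : 0 < θ) :
    (∀ γ : ℝ, 0 ≤ γ → ∀ N : ℕ, 1 ≤ N →
      ∃ π : Measure (Population N), Moran.IsEquilibrium ρ θ γ π) ∧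
    ∃ VA VD : ℝ → ℝ,
      (∀ γ : ℝ, 0 ≤ γ → ∀ π : (N : ℕ) → Measure (Population N),
        (∀ N : ℕ, 1 ≤ N → Moran.IsEquilibrium ρ θ γ (π N)) →
          (∀ N : ℕ, 1 ≤ N →
            MemLp (Moran.avgGenes 1) 2 (π N) ∧ MemLp (Moran.avgDiff 2) 2 (π N)) ∧
          Tendsto (fun N => variance (Moran.avgGenes 1) (π N)) atTop (𝓝 (VA γ)) ∧
          Tendsto (fun N => variance (Moran.avgDiff 2) (π N)) atTop (𝓝 (VD γ))) ∧
      (fun γ : ℝ => VA γ -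
          θ / ρ * (1 + 1 / (1 + ρ) * γ +
            (1 / ((1 + ρ) * (2 + ρ)) +
              θ / ((1 + ρ) ^ 2 * (3 + 2 * ρ) * (2 + 7 * ρ + 6 * ρ ^ 2))) * γ ^ 2))
        =O[𝓝[≥] 0] (fun γ : ℝ => γ ^ 3) ∧
      (fun γ : ℝ => VD γ -
          θ / (1 + ρ) * (1 / 2 + θ / ((1 + ρ) * (1 + 2 * ρ)) +
            (1 / (2 * (2 + ρ)) +
              θ * (2 * (12 + 110 * ρ + 248 * ρ ^ 2 + 209 * ρ ^ 3 + 60 * ρ ^ 4) /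
                ((1 + ρ) * (2 + ρ) * (1 + 2 * ρ) ^ 2 * (3 + 2 * ρ) * (2 + 3 * ρ) *
                  (6 + 5 * ρ)))) * γ))
        =O[𝓝[≥] 0] (fun γ : ℝ => γ ^ 2) := by
  refine ⟨fun γ hγ N hN => Moran.exists_isEquilibrium hρ hθ hγ hN, ?_⟩
  obtain ⟨d, c, K, V, h, hbdd⟩ := Moran.exists_isLimitSolution hρ hθ.le
  have hd : ∀ n, Moran.IsOrder 0 fun γ => d γ n := fun n =>
    Moran.IsOrder.of_bdd (K := K) fun γ hγ hγ1 => by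
      rw [abs_of_nonneg ((h γ hγ).d_nonneg n)]
      exact (hbdd γ hγ hγ1).1 n
  have hc : ∀ s t b, Moran.IsOrder 0 fun γ => c γ s t b := fun s t b =>
    Moran.IsOrder.of_bdd (K := V s) fun γ hγ hγ1 => by
      rw [abs_of_nonneg ((h γ hγ).c_nonneg s t b)]
      exact (hbdd γ hγ hγ1).2 s t b
  -- The limits are fixed through the limiting solution before any equilibrium is chosen, so they
  -- depend only on `ρ`, `θ` and `γ`.
  refine ⟨fun γ => c γ 1 1 1 + d γ 1, fun γ => c γ 2 2 2 + 1 / 2 * (c γ 1 1 1 + c γ 1 1 0) -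
    2 * c γ 2 1 1 + 1 / 2 * d γ 2, fun γ hγ π hπ => ⟨fun N hN =>
      ⟨(hπ N hN).memLp_avgGenes hN hρ hθ.le hγ, (hπ N hN).memLp_avgDiff hN hρ hθ.le hγ⟩,
      (h γ hγ).tendsto_variance_avgGenes hρ hθ.le hγ hπ,
      (h γ hγ).tendsto_variance_avgDiff hρ hθ.le hγ hπ⟩,
    Moran.isBigO_variance_avgGenes hρ h hd hc, Moran.isBigO_variance_avgDiff hρ h hd hc⟩
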